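/- Let $\mathbf Q$ be the set of all $q\in C^2([0,1])$ with $q([0,1])\subseteq[0,1]$ and $\max_{i=0,1,2}\max_{x\in[0,1]}|q^{(i)}(x)|\le 1$. For every $q\in\mathbf Q$ the Sturm–Liouville problem $-u''+qu=\lambda u$ on $(0,1)$, $u(0)=u(1)=0$, $0\neq u\in C^2([0,1])$, has a smallest eigenvalue $\lambda(q)$. We study its approximation by randomized algorithms. *Randomized algorithms.* A randomized algorithm $\phi$ is defined over a probability space. For each random element $\omega$ it evaluates $q\in\mathbf Q$ at adaptively chosen points $t_{i,\omega}\in[0,1]$, stops after an adaptively chosen number $n_{q,\omega}$ of evaluations, and outputs $\phi_\omega(q)\in\mathbb R$, where the points, the stopping decision and the output depend only on $\omega$ and on the points and values obtained so far; for every fixed $q\in\mathbf Q$ the quantities $t_{i,\omega}$, $n_{q,\omega}$ and $\phi_\omega(q)$ are random variables. Its error is $\sup_{q\in\mathbf Q}\bigl(\mathbb E(\lambda(q)-\phi_\omega(q))^2\bigr)^{1/2}$, and $n^{\mathrm{ran}}(\varepsilon)$ is the infimum of $\sup_{q\in\mathbf Q}\mathbb E(n_{q,\omega})$ over all randomized algorithms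 with error at most $\varepsilon$. *Complexity.* In the real number model of computation with an oracle, $\phi$ is a finite program for a random access machine that works exactly with real numbers and draws random numbers. One function value of $q$ costs $c>0$; every other operation (arithmetic operation, evaluation of an elementary function, comparison, drawing a random number, copying, indexing) costs $1$. If $m_{q,\omega}$ is the number of these other operations, the cost of $\phi$ is $\sup_{q\in\mathbf Q}\bigl(\mathbb E(c\,n_{q,\omega}+m_{q,\omega})^2\bigr)^{1/2}$, and $\mathrm{comp}^{\mathrm{ran}}(\varepsilon)=\mathrm{comp}^{\mathrm{ran}}_c(\varepsilon)$ is the infimum of the cost over all programs with error at most $\varepsilon$. **Theorem.** $n^{\mathrm{ran}}(\varepsilon)=\Theta(\varepsilon^{-2/5})$ and $\Omega(c\,\varepsilon^{-2/5})=\mathrm{comp}^{\mathrm{ran}}(\varepsilon)=O(c\,\varepsilon^{-2/5}+\varepsilon^{-1/2}\log_2\varepsilon^{-1})$ as $\varepsilon\to0$, with constants independent of $\varepsilon$ and $c$. That is, there are positive numbers $\alpha_1,\alpha_2,\alpha_3,\varepsilon_0$ such that for all $\varepsilon\in(0,\varepsilon_0)$ $$\alpha_1\,\varepsilon^{-2/5}\le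 n^{\mathrm{ran}}(\varepsilon)\le \alpha_2\,\varepsilon^{-2/5},$$ and, for all $c>0$, $$\alpha_1\,c\,\varepsilon^{-2/5}\le \mathrm{comp}^{\mathrm{ran}}(\varepsilon)\le \alpha_2\,c\,\varepsilon^{-2/5}+\alpha_3\,\varepsilon^{-1/2}\log_2\varepsilon^{-1}.$$ -/

import Mathlib

noncomputable section

namespace SturmLiouville

open MeasureTheory Set
open scoped ENNReal

/-! ### The class of inputs and the smallest eigenvalue -/

/-- The class `Q` of functions `q : [0,1] → [0,1]` that are twice continuously differentiable on
`[0,1]` and satisfy `max_{i = 0,1,2} max_{[0,1]} |q^{(i)}| ≤ 1`. A function on `[0,1]` is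
represented by a function on `ℝ`; nothing below depends on its values outside `[0,1]`. -/
def classQ : Set (ℝ → ℝ) :=
  {q | ContDiffOn ℝ 2 q (Icc 0 1) ∧ (∀ x ∈ Icc (0 : ℝ) 1, q x ∈ Icc (0 : ℝ) 1) ∧
    ∀ i ≤ 2, ∀ x ∈ Icc (0 : ℝ) 1, |iteratedDerivWithin i q (Icc 0 1) x| ≤ 1}

/-- `l` is an eigenvalue of `u ↦ -u'' + q u` on `(0,1)` with `u(0) = u(1) = 0`: there is a
non-zero `u ∈ C²([0,1])` with these boundary values and `u'' - q u + l u = 0` on `(0,1)`. -/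
def IsEigenvalue (q : ℝ → ℝ) (l : ℝ) : Prop :=
  ∃ u : ℝ → ℝ, ContDiffOn ℝ 2 u (Icc 0 1) ∧ u 0 = 0 ∧ u 1 = 0 ∧
    (∃ x ∈ Ioo (0 : ℝ) 1, u x ≠ 0) ∧
    ∀ x ∈ Ioo (0 : ℝ) 1, deriv (deriv u) x - q x * u x + l * u x = 0

/-- The smallest eigenvalue `λ(q)`. -/
def smallestEigenvalue (q : ℝ → ℝ) : ℝ := sInf {l | IsEigenvalue q l}

/-! ### Randomized algorithms that use function values -/

/-- A randomized algorithm using function values: for every random element `ω`, an adaptive choice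
of sample points in `[0,1]`, an adaptive stopping rule and an output mapping, each depending on the
points and values collected so far (the list is in order of evaluation). No restriction is put on
the computational power; measurability is required in `IsMeasurable` below. -/
structure RandAlg where
  Ω : Type
  mΩ : MeasurableSpace Ω
  P : Measure Ω
  isProb : IsProbabilityMeasure P
  point : Ω → List (unitInterval × ℝ) → unitInterval
  isDone : Ω → List (unitInterval × ℝ) → Bool
  out : Ω → List (unitInterval × ℝ) → ℝ

namespace RandAlg

/-- The information (points and values of `q`) collected after at most `k` function evaluations. -/
def hist (A : RandAlg) (q : ℝ → ℝ) (ω : A.Ω) : ℕ → List (unitInterval × ℝ)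
  | 0 => []
  | k + 1 =>
    if A.isDone ω (A.hist q ω k) then A.hist q ω k
    else A.hist q ω k ++ [(A.point ω (A.hist q ω k), q (A.point ω (A.hist q ω k)))]

/-- `n_{q,ω}`, the number of function values used (`∞` if the algorithm never stops). -/
def count (A : RandAlg) (q : ℝ → ℝ) (ω : A.Ω) : ℝ≥0∞ :=
  ⨆ k : ℕ, ((A.hist q ω k).length : ℝ≥0∞)

open Classical in
/-- `φ_ω(q)`, the output on all the information collected when the algorithm stops. (The value `0`
is a convention for runs that never stop; such runs have `count = ∞`.) -/
def output (A : RandAlg) (q : ℝ → ℝ) (ω : A.Ω) : ℝ :=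
  if h : ∃ k, A.isDone ω (A.hist q ω k) = true then A.out ω (A.hist q ω (Nat.find h)) else 0

/-- `t_{i+1,ω}`, the sample point with index `i` counted from `0` (`0` if there is no such
evaluation). -/
def samplePoint (A : RandAlg) (q : ℝ → ℝ) (i : ℕ) (ω : A.Ω) : unitInterval :=
  ((A.hist q ω (i + 1)).map Prod.fst).getD i 0

/-- For every `q ∈ Q` the sample points, the number of function values and the output are random
variables. -/
def IsMeasurable (A : RandAlg) : Prop :=
  ∀ q ∈ classQ,
    (∀ i, @Measurable A.Ω unitInterval A.mΩ _ (A.samplePoint q i)) ∧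
    @Measurable A.Ω ℝ≥0∞ A.mΩ _ (A.count q) ∧
    @Measurable A.Ω ℝ A.mΩ _ (A.output q)

/-- `n = sup_{q ∈ Q} E(n_{q,ω})`. -/
def card (A : RandAlg) : ℝ≥0∞ :=
  ⨆ q ∈ classQ, @lintegral A.Ω A.mΩ A.P (fun ω => A.count q ω)

/-- The randomized error `sup_{q ∈ Q} (E (λ(q) - φ_ω(q))²)^{1/2}`. -/
def error (A : RandAlg) : ℝ≥0∞ :=
  ⨆ q ∈ classQ,
    (@lintegral A.Ω A.mΩ A.P
      (fun ω => ENNReal.ofReal ((smallestEigenvalue q - A.output q ω) ^ 2))) ^ (1 / 2 : ℝ)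

end RandAlg

/-- The randomized information complexity `n^ran(ε)`. -/
def nRan (ε : ℝ) : ℝ≥0∞ :=
  ⨅ (A : RandAlg) (_ : A.IsMeasurable) (_ : A.error ≤ ENNReal.ofReal ε), A.card

/-! ### The real number model of computation with an oracle for function values -/

/-- Arithmetic operations. -/
inductive ArithOp
  | add | sub | mul | div

/-- Elementary functions. -/
inductive ElemFun
  | abs | sqrt | exp | log | sin | cos | arctan

/-- The real operation denoted by an `ArithOp` (with the convention `x / 0 = 0`). -/
def ArithOp.eval : ArithOp → ℝ → ℝ → ℝ
  | .add, x, y => x + y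
  | .sub, x, y => x - y
  | .mul, x, y => x * y
  | .div, x, y => x / y

/-- The real function denoted by an `ElemFun`. -/
def ElemFun.eval : ElemFun → ℝ → ℝ
  | .abs, x => |x|
  | .sqrt, x => Real.sqrt x
  | .exp, x => Real.exp x
  | .log, x => Real.log x
  | .sin, x => Real.sin x
  | .cos, x => Real.cos x
  | .arctan, x => Real.arctan x

/-- Instructions of a random access machine with real registers `r 0, r 1, …` and index registers
`j 0, j 1, …` that hold natural numbers and are used for indirect addressing and loops.

* `const d x`: `r d := x`
* `copy d a`: `r d := r a`
* `arith o d a b`: `r d := o (r a) (r b)`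
* `elem f d a`: `r d := f (r a)`
* `query d a`: `r d := q (r a)` (the argument is first projected to `[0,1]`)
* `rand d`: `r d :=` the next random number
* `load d k`: `r d := r (j k)`
* `store k a`: `r (j k) := r a`
* `idxConst k n`: `j k := n`
* `idxAdd k l m`: `j k := j l + j m`
* `idxSub k l m`: `j k := j l - j m` (truncated)
* `jumpLE a b p`: go to instruction `p` if `r a ≤ r b`
* `jumpIdxLE k l p`: go to instruction `p` if `j k ≤ j l` -/
inductive Instr
  | const (d : ℕ) (x : ℝ)
  | copy (d a : ℕ)
  | arith (o : ArithOp) (d a b : ℕ)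
  | elem (f : ElemFun) (d a : ℕ)
  | query (d a : ℕ)
  | rand (d : ℕ)
  | load (d k : ℕ)
  | store (k a : ℕ)
  | idxConst (k n : ℕ)
  | idxAdd (k l m : ℕ)
  | idxSub (k l m : ℕ)
  | jumpLE (a b p : ℕ)
  | jumpIdxLE (k l p : ℕ)

/-- A configuration: program counter, real registers, index registers, number of random numbers
drawn, number of function values used, number of other operations executed. -/
structure Config where
  pc : ℕ
  reg : ℕ → ℝ
  idx : ℕ → ℕ
  draws : ℕ
  queries : ℕ
  ops : ℕ

/-- The effect of one instruction; `ξ` is the sequence of random numbers and `q` the function that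
is accessible through the oracle. A query raises `queries` by one, every other instruction raises
`ops` by one. -/
def Instr.exec (q : ℝ → ℝ) (ξ : ℕ → ℝ) (s : Config) : Instr → Config
  | .const d x =>
    { s with pc := s.pc + 1, ops := s.ops + 1, reg := Function.update s.reg d x }
  | .copy d a =>
    { s with pc := s.pc + 1, ops := s.ops + 1, reg := Function.update s.reg d (s.reg a) }
  | .arith o d a b =>
    { s with
      pc := s.pc + 1, ops := s.ops + 1
      reg := Function.update s.reg d (o.eval (s.reg a) (s.reg b)) }
  | .elem f d a =>
    { s with pc := s.pc + 1, ops := s.ops + 1, reg := Function.update s.reg d (f.eval (s.reg a)) }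
  | .query d a =>
    { s with
      pc := s.pc + 1, queries := s.queries + 1
      reg := Function.update s.reg d (q (projIcc (0 : ℝ) 1 zero_le_one (s.reg a))) }
  | .rand d =>
    { s with
      pc := s.pc + 1, ops := s.ops + 1, draws := s.draws + 1
      reg := Function.update s.reg d (ξ s.draws) }
  | .load d k =>
    { s with pc := s.pc + 1, ops := s.ops + 1, reg := Function.update s.reg d (s.reg (s.idx k)) }
  | .store k a =>
    { s with pc := s.pc + 1, ops := s.ops + 1, reg := Function.update s.reg (s.idx k) (s.reg a) }
  | .idxConst k n =>
    { s with pc := s.pc + 1, ops := s.ops + 1, idx := Function.update s.idx k n }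
  | .idxAdd k l m =>
    { s with
      pc := s.pc + 1, ops := s.ops + 1
      idx := Function.update s.idx k (s.idx l + s.idx m) }
  | .idxSub k l m =>
    { s with
      pc := s.pc + 1, ops := s.ops + 1
      idx := Function.update s.idx k (s.idx l - s.idx m) }
  | .jumpLE a b p =>
    open Classical in
    { s with pc := if s.reg a ≤ s.reg b then p else s.pc + 1, ops := s.ops + 1 }
  | .jumpIdxLE k l p =>
    { s with pc := if s.idx k ≤ s.idx l then p else s.pc + 1, ops := s.ops + 1 }

/-- A randomized algorithm in the real number model: a finite program together with a sequence of
real random variables on some probability space, which the program can draw one after another. -/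
structure RandProgram where
  code : List Instr
  Ω : Type
  mΩ : MeasurableSpace Ω
  P : Measure Ω
  isProb : IsProbabilityMeasure P
  ξ : ℕ → Ω → ℝ
  measurable_ξ : ∀ k, @Measurable Ω ℝ mΩ _ (ξ k)

namespace RandProgram

/-- One step; the machine has halted when the program counter has left the program. -/
def step (A : RandProgram) (q : ℝ → ℝ) (ω : A.Ω) (s : Config) : Config :=
  match A.code[s.pc]? with
  | some i => i.exec q (fun k => A.ξ k ω) s
  | none => s

/-- The configuration after `k` steps, from the start with all registers and counters zero. -/
def run (A : RandProgram) (q : ℝ → ℝ) (ω : A.Ω) : ℕ → Config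
  | 0 => ⟨0, fun _ => 0, fun _ => 0, 0, 0, 0⟩
  | k + 1 => A.step q ω (A.run q ω k)

/-- The machine has halted after at most `k` steps. -/
def HaltedAt (A : RandProgram) (q : ℝ → ℝ) (ω : A.Ω) (k : ℕ) : Prop :=
  A.code.length ≤ (A.run q ω k).pc

/-- `n_{q,ω}`, the number of function values used. -/
def count (A : RandProgram) (q : ℝ → ℝ) (ω : A.Ω) : ℝ≥0∞ :=
  ⨆ k : ℕ, ((A.run q ω k).queries : ℝ≥0∞)

/-- `m_{q,ω}`, the number of all other operations executed. On a run that does not halt,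
`count` or `opCount` is `∞`. -/
def opCount (A : RandProgram) (q : ℝ → ℝ) (ω : A.Ω) : ℝ≥0∞ :=
  ⨆ k : ℕ, ((A.run q ω k).ops : ℝ≥0∞)

open Classical in
/-- `φ_ω(q)`, the content of the real register `0` when the machine halts. (The value `0` is a
convention for runs that do not halt; such runs have infinite cost.) -/
def output (A : RandProgram) (q : ℝ → ℝ) (ω : A.Ω) : ℝ :=
  if h : ∃ k, A.HaltedAt q ω k then (A.run q ω (Nat.find h)).reg 0 else 0

/-- The randomized error `sup_{q ∈ Q} (E (λ(q) - φ_ω(q))²)^{1/2}`. -/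
def error (A : RandProgram) : ℝ≥0∞ :=
  ⨆ q ∈ classQ,
    (@lintegral A.Ω A.mΩ A.P
      (fun ω => ENNReal.ofReal ((smallestEigenvalue q - A.output q ω) ^ 2))) ^ (1 / 2 : ℝ)

/-- The randomized cost `sup_{q ∈ Q} (E (c n_{q,ω} + m_{q,ω})²)^{1/2}`, where `c` is the cost of
one function value. -/
def cost (A : RandProgram) (c : ℝ) : ℝ≥0∞ :=
  ⨆ q ∈ classQ,
    (@lintegral A.Ω A.mΩ A.P
      (fun ω => (ENNReal.ofReal c * A.count q ω + A.opCount q ω) ^ 2)) ^ (1 / 2 : ℝ)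

end RandProgram

/-- The randomized complexity `comp^ran(ε)` when one function value costs `c`. -/
def compRan (c ε : ℝ) : ℝ≥0∞ :=
  ⨅ (A : RandProgram) (_ : A.error ≤ ENNReal.ofReal ε), A.cost c

end SturmLiouville

end

namespace SturmLiouville
open MeasureTheory Set Filter Topology
open scoped ENNReal

/-! ### Solutions of `y'' = -κ y` with right derivatives -/

/-! Both bounds rest on first order perturbation. If `v` is the positive eigenfunction of `q`, a
change of `q` of size `R` changes the smallest eigenvalue by the mean of the change with weight `v²`
(normalized), up to `O(R²)` (`IsShot.expansion`). The problem is thus close to weighted integration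
of `C²` functions, for which random sampling has the rate `n^(-5/2)`.

Sturm theory enters only through the Wronskian identity (`SolOn.wronskian`) and comparison with
explicit sines. Eigenfunctions are shooting solutions with `y(0) = 0`, `y'(0) = 1`. Right
derivatives are used because potentials may be step functions; they suffice for the fundamental
theorem of calculus and for Grönwall's inequality. All potentials that occur have values in `[-1/2,
3/2]`, so that `[8, 12]` always brackets the eigenvalue.

Lower bound: add `N` disjoint bumps of width `1/N`, height `N^(-2)` and arbitrary signs to the
constant `1/2`. The eigenvalue is linear in the signs with coefficients at least of order `N^(-3)`,
up to `O(N^(-4))` (`fool_eigenvalue`). One function value reveals at most one sign. If at most `N/4`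
values are used on average, then with probability at least `1/2` half of the signs stay unknown, and
averaging over them gives a mean square error of order at least `N · N^(-6) = N^(-5)`
(`sum_sq_error_ge`, `exists_large_error`). Hence `N` of order `ε^(-2/5)` forces that many
evaluations. `TraceMethod` lets one argument serve algorithms and programs.

Upper bound: split `[0,1]` into `n = N^4` cells; in each, take the line with the secant slope
through the value at a uniform random point. It deviates from `q` by `O(n^(-2))`, so a cell
contributes `O(n^(-3))` to the first order error, with mean only `O(n^(-4))`. By independence the
root mean square of the sum is `O(n^(-5/2)) = O(N^(-10))`. Each line is then replaced by its
midpoint values on `N` subcells; with `m = N^5` subcells in all, this adds `O(m^(-2))`, and the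
quadratic remainder is `O((n^(-2) + m^(-1))²)`, both `O(N^(-10))`. For a step potential the shooting
solution is an explicit product of sines and cosines, and about `log N^10` bisection steps find the
eigenvalue (`exists_sampledEigenvalue_bound`). With `ε` of order `N^(-10)` this uses `3 N^4` values
and `O(N^5 log N)` other operations, that is `O(ε^(-2/5))` and `O(ε^(-1/2) log ε^(-1))`. -/

/-- `y` solves `y'' = -κ y` on `[a,b]`, with `y' = dy`, in the sense of right derivatives. -/
structure SolOn (κ : ℝ → ℝ) (a b : ℝ) (y dy : ℝ → ℝ) : Prop where
  int : IntervalIntegrable κ volume a b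
  cont : ContinuousOn y (Icc a b)
  cont' : ContinuousOn dy (Icc a b)
  deriv : ∀ x ∈ Ico a b, HasDerivWithinAt y (dy x) (Ici x) x
  deriv' : ∀ x ∈ Ico a b, HasDerivWithinAt dy (-(κ x) * y x) (Ici x) x

namespace SolOn

variable {κ κ₁ κ₂ y dy v dv : ℝ → ℝ} {a b c d : ℝ}

theorem mono (h : SolOn κ a b y dy) (hac : a ≤ c) (hcd : c ≤ d) (hdb : d ≤ b) :
    SolOn κ c d y dy where
  int := h.int.mono_set (by
    rw [uIcc_of_le hcd, uIcc_of_le (hac.trans (hcd.trans hdb))]; exact Icc_subset_Icc hac hdb)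
  cont := h.cont.mono (Icc_subset_Icc hac hdb)
  cont' := h.cont'.mono (Icc_subset_Icc hac hdb)
  deriv x hx := h.deriv x ⟨hac.trans hx.1, hx.2.trans_le hdb⟩
  deriv' x hx := h.deriv' x ⟨hac.trans hx.1, hx.2.trans_le hdb⟩

theorem congr (h : SolOn κ₁ a b y dy) (hab : a ≤ b) (hκ : ∀ x ∈ Ico a b, κ₂ x = κ₁ x) :
    SolOn κ₂ a b y dy where
  int := by
    refine h.int.congr_ae ?_
    rw [uIoc_of_le hab, ← restrict_Ioo_eq_restrict_Ioc]
    filter_upwards [ae_restrict_mem measurableSet_Ioo] with x hx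
    exact (hκ x ⟨hx.1.le, hx.2⟩).symm
  cont := h.cont
  cont' := h.cont'
  deriv := h.deriv
  deriv' x hx := by rw [hκ x hx]; exact h.deriv' _ hx

theorem neg (h : SolOn κ a b y dy) : SolOn κ a b (fun x => -y x) (fun x => -dy x) where
  int := h.int
  cont := h.cont.neg
  cont' := h.cont'.neg
  deriv x hx := (h.deriv x hx).neg
  deriv' x hx := by
    have := (h.deriv' x hx).neg
    exact this.congr_deriv (by ring)

theorem of_hasDerivAt (hκ : ContinuousOn κ (Icc a b)) (hab : a ≤ b)
    (h1 : ∀ x ∈ Icc a b, HasDerivAt y (dy x) x)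
    (h2 : ∀ x ∈ Icc a b, HasDerivAt dy (-(κ x) * y x) x) : SolOn κ a b y dy where
  int := ContinuousOn.intervalIntegrable_of_Icc hab hκ
  cont x hx := (h1 x hx).continuousAt.continuousWithinAt
  cont' x hx := (h2 x hx).continuousAt.continuousWithinAt
  deriv x hx := (h1 x ⟨hx.1, hx.2.le⟩).hasDerivWithinAt
  deriv' x hx := (h2 x ⟨hx.1, hx.2.le⟩).hasDerivWithinAt

theorem sine (k c : ℝ) (hab : a ≤ b) :
    SolOn (fun _ => k ^ 2) a b (fun x => Real.sin (k * (x - c)))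
      (fun x => k * Real.cos (k * (x - c))) := by
  apply of_hasDerivAt continuousOn_const hab
  · intro x _
    have h0 : HasDerivAt (fun x : ℝ => k * (x - c)) k x := by
      simpa using ((hasDerivAt_id x).sub_const c).const_mul k
    exact h0.sin.congr_deriv (by ring)
  · intro x _
    have h0 : HasDerivAt (fun x : ℝ => k * (x - c)) k x := by
      simpa using ((hasDerivAt_id x).sub_const c).const_mul k
    exact (h0.cos.const_mul k).congr_deriv (by ring)

/-- The right derivative of `y v' - y' v` is `(κ₁ - κ₂) y v`. Every comparison argument and the
perturbation formula come from this identity. -/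
theorem wronskian (hab : a ≤ b) (hy : SolOn κ₁ a b y dy) (hv : SolOn κ₂ a b v dv) :
    IntervalIntegrable (fun x => (κ₁ x - κ₂ x) * (y x * v x)) volume a b ∧
    ∫ x in a..b, (κ₁ x - κ₂ x) * (y x * v x) =
      (y b * dv b - dy b * v b) - (y a * dv a - dy a * v a) := by
  have hint : IntervalIntegrable (fun x => (κ₁ x - κ₂ x) * (y x * v x)) volume a b := by
    apply (hy.int.sub hv.int).mul_continuousOn
    rw [uIcc_of_le hab]; exact hy.cont.mul hv.cont
  refine ⟨hint, ?_⟩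
  refine intervalIntegral.integral_eq_sub_of_hasDeriv_right_of_le
    (f := fun x => y x * dv x - dy x * v x) hab
    ((hy.cont.mul hv.cont').sub (hy.cont'.mul hv.cont)) ?_ hint
  intro x hx
  have hx' : x ∈ Ico a b := ⟨hx.1.le, hx.2⟩
  have := ((hy.deriv x hx').mul (hv.deriv' x hx')).sub ((hy.deriv' x hx').mul (hv.deriv x hx'))
  refine HasDerivWithinAt.mono ?_ Ioi_subset_Ici_self
  exact this.congr_deriv (by ring)

theorem wronskian_pos (hab : a < b) (hy : SolOn κ₁ a b y dy) (hv : SolOn κ₂ a b v dv)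
    (hκ : ∀ x ∈ Ioo a b, κ₂ x < κ₁ x) (hyp : ∀ x ∈ Ioo a b, 0 < y x)
    (hvp : ∀ x ∈ Ioo a b, 0 < v x) :
    y a * dv a - dy a * v a < y b * dv b - dy b * v b := by
  obtain ⟨h1, h2⟩ := wronskian hab.le hy hv
  have : 0 < ∫ x in a..b, (κ₁ x - κ₂ x) * (y x * v x) :=
    intervalIntegral.intervalIntegral_pos_of_pos_on h1
      (fun x hx => mul_pos (sub_pos.2 (hκ x hx)) (mul_pos (hyp x hx) (hvp x hx))) hab
  linarith

end SolOn

/-- The smallest zero to the right of `a` of a function that is positive immediately after `a`. -/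
theorem exists_first_zero {y : ℝ → ℝ} {a b : ℝ} (hc : ContinuousOn y (Icc a b))
    (hpos : ∀ᶠ x in 𝓝[>] a, 0 < y x) (hab : a < b) (hb : y b ≤ 0) :
    ∃ z ∈ Ioc a b, y z = 0 ∧ ∀ x ∈ Ioo a z, 0 < y x := by
  obtain ⟨c, hac, hc'⟩ := (mem_nhdsGT_iff_exists_Ioo_subset' hab).1 hpos
  obtain ⟨d, hd1, hd2⟩ : ∃ d, a < d ∧ d < min c b := exists_between (lt_min hac hab)
  have hdc : d < c := hd2.trans_le (min_le_left _ _)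
  have hdb : d < b := hd2.trans_le (min_le_right _ _)
  have hyd : 0 < y d := hc' ⟨hd1, hdc⟩
  have hcd : ContinuousOn y (Icc d b) := hc.mono (Icc_subset_Icc hd1.le le_rfl)
  set S := Icc d b ∩ y ⁻¹' Iic 0 with hS
  have hScl : IsClosed S := hcd.preimage_isClosed_of_isClosed isClosed_Icc isClosed_Iic
  have hSne : S.Nonempty := ⟨b, ⟨hdb.le, le_rfl⟩, hb⟩
  have hSbd : BddBelow S := ⟨d, fun x hx => hx.1.1⟩
  have hz := hScl.csInf_mem hSne hSbd
  set z := sInf S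
  have hzp : ∀ x ∈ Ioo a z, 0 < y x := by
    intro x hx
    by_cases hxd : x < c
    · exact hc' ⟨hx.1, hxd⟩
    · by_contra hn
      have : x ∈ S := ⟨⟨(hdc.le.trans (not_lt.1 hxd)), hx.2.le.trans hz.1.2⟩, not_lt.1 hn⟩
      exact absurd (csInf_le hSbd this) (not_le.2 hx.2)
  have hdz : d < z := by
    rcases eq_or_lt_of_le hz.1.1 with h | h
    · exact absurd hz.2 (by rw [← h]; simpa using hyd)
    · exact h
  refine ⟨z, ⟨hd1.trans hdz, hz.1.2⟩, le_antisymm hz.2 ?_, hzp⟩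
  have hcz : ContinuousWithinAt y (Icc d z) z := (hcd z hz.1).mono (Icc_subset_Icc le_rfl hz.1.2)
  have : z ∈ closure (Ioo d z) := by rw [closure_Ioo hdz.ne]; exact ⟨hdz.le, le_rfl⟩
  have hmem := (hcz.mono Ioo_subset_Icc_self).mem_closure (t := Ici 0) this
    (fun x hx => (hzp x ⟨hd1.trans hx.1, hx.2⟩).le)
  simpa using hmem

theorem eventually_pos_of_deriv_pos {y : ℝ → ℝ} {y' a : ℝ} (h : HasDerivWithinAt y y' (Ici a) a)
    (ha : y a = 0) (hy' : 0 < y') : ∀ᶠ x in 𝓝[>] a, 0 < y x := by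
  have h1 := hasDerivWithinAt_iff_tendsto_slope.1 h
  rw [Ici_sdiff_left] at h1
  filter_upwards [h1.eventually (lt_mem_nhds hy'), self_mem_nhdsWithin] with x hx hxa
  rw [slope_def_field, ha, sub_zero] at hx
  have : 0 < x - a := sub_pos.2 hxa
  have := mul_pos hx this
  rwa [div_mul_cancel₀ _ (by linarith)] at this

namespace SolOn

variable {κ κ₁ κ₂ y dy v dv : ℝ → ℝ} {a b c d : ℝ}

/-- A solution that is positive on `(a,b)` and vanishes at `a` and `b` crosses zero at `b`. -/
theorem deriv_neg_of_first_zero (h : SolOn κ a b y dy) (hab : a < b) (hba : b - a ≤ 1)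
    (hκ : ∀ x ∈ Icc a b, 4 < κ x) (ha : y a = 0) (hb : y b = 0)
    (hpos : ∀ x ∈ Ioo a b, 0 < y x) : dy b < 0 := by
  -- The slower oscillation `sin 2(x - a)` (as `4 = 2² < κ`) is still positive at `b` because `2(b -
  -- a) ≤ 2 < π`. The strict Wronskian inequality makes the crossing transversal without a
  -- uniqueness theorem.
  have hs : ∀ x ∈ Ioc a b, 0 < Real.sin (2 * (x - a)) := fun x hx =>
    Real.sin_pos_of_pos_of_lt_pi (by linarith [hx.1]) (by linarith [hx.2, Real.pi_gt_three])
  have := wronskian_pos hab h (sine 2 a hab.le)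
    (fun x hx => by linarith [hκ x ⟨hx.1.le, hx.2.le⟩]) hpos (fun x hx => hs x ⟨hx.1, hx.2.le⟩)
  simp only [ha, hb, sub_self, mul_zero, Real.sin_zero, zero_mul, zero_sub] at this
  have h2 := hs b ⟨hab, le_rfl⟩
  by_contra hn
  have := mul_nonneg (not_lt.1 hn) h2.le
  linarith

/-- At a first zero `z`, compare with the faster sine `sin K(z - x)`, positive on `[a, z)` since
`K(b - a) < π`. The Wronskian would have to increase from a positive value at `a` to `0` at `z`. -/
theorem pos_of_lt (h : SolOn κ a b y dy) (hab : a < b) {K : ℝ} (hK : 0 < K)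
    (hba : K * (b - a) < Real.pi)
    (hκ : ∀ x ∈ Icc a b, κ x < K ^ 2) (ha : y a = 0) (ha' : 0 < dy a) :
    ∀ x ∈ Ioc a b, 0 < y x := by
  intro x hx
  by_contra hn
  obtain ⟨z, hz, hz0, hzp⟩ := exists_first_zero (h.cont.mono (Icc_subset_Icc le_rfl hx.2))
    (eventually_pos_of_deriv_pos (h.deriv a ⟨le_rfl, hab⟩) ha ha') hx.1 (not_lt.1 hn)
  have hzb : z ≤ b := hz.2.trans hx.2
  have hz' := h.mono le_rfl hz.1.le hzb
  -- The phase `z - π / K` turns the sine into `sin K(z - x)`.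
  have h4 := wronskian_pos hz.1 (sine K (z - Real.pi / K) hz.1.le) hz'
    (fun x hx => hκ x ⟨hx.1.le, hx.2.le.trans hzb⟩)
    (fun x hx => by
      have e : K * (x - (z - Real.pi / K)) = Real.pi - K * (z - x) := by field_simp; ring
      rw [e, Real.sin_pi_sub]
      refine Real.sin_pos_of_pos_of_lt_pi (mul_pos hK (by linarith [hx.2])) ?_
      exact lt_of_le_of_lt (mul_le_mul_of_nonneg_left (by linarith [hx.1]) hK.le) hba) hzp
  have e : K * (z - (z - Real.pi / K)) = Real.pi := by field_simp; ring
  have e' : K * (a - (z - Real.pi / K)) = Real.pi - K * (z - a) := by field_simp; ring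
  have h5 : 0 < Real.sin (K * (z - a)) :=
    Real.sin_pos_of_pos_of_lt_pi (mul_pos hK (by linarith [hz.1]))
      (lt_of_le_of_lt (mul_le_mul_of_nonneg_left (by linarith) hK.le) hba)
  simp only [ha, hz0, e, e', Real.sin_pi, Real.sin_pi_sub, mul_zero, zero_mul] at h4
  have h6 := mul_pos h5 ha'
  linarith

end SolOn

/-! ### Shooting solutions -/

/-- `y` is the solution of `y'' = -κ y`, `y(0) = 0`, `y'(0) = 1` on `[0,1]`. -/
structure IsShot (κ y dy : ℝ → ℝ) : Prop where
  sol : SolOn κ 0 1 y dy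
  zero : y 0 = 0
  one : dy 0 = 1

/-- The bound `e^16` for solutions with coefficients bounded by `16`. -/
noncomputable def solBound : ℝ := Real.exp 16

theorem one_le_solBound : 1 ≤ solBound := Real.one_le_exp (by norm_num)

theorem solBound_pos : 0 < solBound := Real.exp_pos _

/-- A lower bound for `∫ v²`. -/
noncomputable def sqBound : ℝ := (1 / (32 * solBound)) ^ 3 / 32

theorem sqBound_pos : 0 < sqBound := by
  have := solBound_pos
  unfold sqBound; positivity

namespace IsShot

variable {κ κ₁ κ₂ y dy y₁ dy₁ y₂ dy₂ v dv p q : ℝ → ℝ} {a b l m R : ℝ}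

theorem pos_of_lt_nine (h : IsShot κ y dy) (hκ : ∀ x ∈ Icc (0 : ℝ) 1, κ x < 9) : 0 < y 1 :=
  h.sol.pos_of_lt one_pos (K := 3) (by norm_num) (by linarith [Real.pi_gt_three])
    (fun x hx => by linarith [hκ x hx]) h.zero (by rw [h.one]; exact one_pos) 1 ⟨one_pos, le_rfl⟩

/-- As `κ < 4²`, the first zero `z` satisfies `z ≥ π/4`, and after it the solution keeps its sign
for any length below `π/4`. Two such gaps exceed the unit interval, so once `y` has crossed zero it
is still negative at `1`. -/
theorem neg_of_nonpos (h : IsShot κ y dy) (hκ : ∀ x ∈ Icc (0 : ℝ) 1, 4 < κ x ∧ κ x < 16)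
    {x : ℝ} (hx : x ∈ Ioo (0 : ℝ) 1) (hyx : y x ≤ 0) : y 1 < 0 := by
  have h1 : 0 < dy 0 := by rw [h.one]; exact one_pos
  have hpi := Real.pi_gt_three
  obtain ⟨z, hz, hz0, hzp⟩ := exists_first_zero
    (h.sol.cont.mono (Icc_subset_Icc le_rfl hx.2.le))
    (eventually_pos_of_deriv_pos (h.sol.deriv 0 ⟨le_rfl, one_pos⟩) h.zero h1) hx.1 hyx
  have hz1 : z < 1 := hz.2.trans_lt hx.2
  have hsol := h.sol.mono le_rfl hz.1.le hz1.le
  have hd : dy z < 0 := hsol.deriv_neg_of_first_zero hz.1 (by linarith)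
    (fun x hx => (hκ x ⟨hx.1, hx.2.trans hz1.le⟩).1) h.zero hz0 hzp
  have hzpi : Real.pi ≤ 4 * z := by
    by_contra hn
    have := hsol.pos_of_lt hz.1 (K := 4) (by norm_num) (by linarith)
      (fun x hx => by linarith [(hκ x ⟨hx.1, hx.2.trans hz1.le⟩).2]) h.zero h1 z ⟨hz.1, le_rfl⟩
    linarith
  have := (h.sol.mono hz.1.le hz1.le le_rfl).neg.pos_of_lt hz1 (K := 4) (by norm_num)
    (by linarith) (fun x hx => by linarith [(hκ x ⟨hz.1.le.trans hx.1, hx.2⟩).2])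
    (by simp [hz0]) (by simpa using hd) 1 ⟨hz1, le_rfl⟩
  linarith

/-- Here `κ ≥ 10 > π²`. If `y` were positive inside, comparison with `sin πx` would give `-π y(1) >
0`; otherwise `neg_of_nonpos` applies. -/
theorem neg_of_ten_le (h : IsShot κ y dy) (hκ : ∀ x ∈ Icc (0 : ℝ) 1, 10 ≤ κ x ∧ κ x < 16) :
    y 1 < 0 := by
  have hpi := Real.pi_gt_three
  have hpi2 : Real.pi ^ 2 < 10 := by nlinarith [Real.pi_lt_d2]
  by_cases hpos : ∀ x ∈ Ioo (0 : ℝ) 1, 0 < y x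
  · have := h.sol.wronskian_pos one_pos (SolOn.sine Real.pi 0 zero_le_one)
      (fun x hx => by linarith [(hκ x ⟨hx.1.le, hx.2.le⟩).1]) hpos
      (fun x hx => Real.sin_pos_of_pos_of_lt_pi (by nlinarith [hx.1]) (by nlinarith [hx.2]))
    simp only [h.zero, sub_zero, mul_zero, Real.sin_zero, mul_one, Real.sin_pi, Real.cos_pi,
      zero_mul] at this
    nlinarith
  · push Not at hpos
    obtain ⟨x, hx, hyx⟩ := hpos
    exact h.neg_of_nonpos (fun x hx => ⟨by linarith [(hκ x hx).1], (hκ x hx).2⟩) hx hyx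

theorem pos (h : IsShot κ y dy) (hκ : ∀ x ∈ Icc (0 : ℝ) 1, 4 < κ x ∧ κ x < 16)
    (h1 : y 1 = 0) : ∀ x ∈ Ioo (0 : ℝ) 1, 0 < y x := by
  intro x hx
  by_contra hn
  exact (h.neg_of_nonpos hκ hx (not_lt.1 hn)).ne h1

theorem norm_le (h : IsShot κ y dy) (hκ : ∀ x ∈ Icc (0 : ℝ) 1, |κ x| ≤ 16) :
    ∀ x ∈ Icc (0 : ℝ) 1, |y x| ≤ solBound ∧ |dy x| ≤ solBound := by
  have key := norm_le_gronwallBound_of_norm_deriv_right_le (f := fun x => (y x, dy x))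
    (f' := fun x => (dy x, -(κ x) * y x)) (δ := 1) (K := 16) (ε := 0) (a := 0) (b := 1)
    (h.sol.cont.prodMk h.sol.cont')
    (fun x hx => (h.sol.deriv x hx).prodMk (h.sol.deriv' x hx))
    (by simp [h.zero, h.one, Prod.norm_def])
    (fun x hx => by
      have hk := hκ x ⟨hx.1, hx.2.le⟩
      have h1 := norm_fst_le (y x, dy x)
      have h2 := norm_snd_le (y x, dy x)
      simp only [Real.norm_eq_abs] at h1 h2
      rw [Prod.norm_def]
      refine max_le ?_ ?_
      · simp only [Real.norm_eq_abs]; linarith [abs_nonneg (dy x)]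
      · simp only [Real.norm_eq_abs, abs_mul, abs_neg, add_zero]
        exact mul_le_mul hk h1 (abs_nonneg _) (by norm_num))
  intro x hx
  have h3 := key x hx
  rw [gronwallBound_ε0] at h3
  have h4 : 1 * Real.exp (16 * (x - 0)) ≤ solBound := by
    rw [one_mul]; exact Real.exp_le_exp.2 (by linarith [hx.2])
  exact ⟨(norm_fst_le (y x, dy x)).trans (h3.trans h4),
    (norm_snd_le (y x, dy x)).trans (h3.trans h4)⟩

/-- The difference solves the equation with the forcing term `(κ₂ - κ₁) y₂`, of size at most `R *
solBound`, from zero initial data; Grönwall's inequality does the rest. It yields both continuity of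
shooting in `μ` and the quadratic remainder in `expansion`. -/
theorem abs_sub_le (h₁ : IsShot κ₁ y₁ dy₁) (h₂ : IsShot κ₂ y₂ dy₂)
    (hκ₁ : ∀ x ∈ Icc (0 : ℝ) 1, |κ₁ x| ≤ 16) (hκ₂ : ∀ x ∈ Icc (0 : ℝ) 1, |κ₂ x| ≤ 16)
    (hR : ∀ x ∈ Icc (0 : ℝ) 1, |κ₁ x - κ₂ x| ≤ R) :
    ∀ x ∈ Icc (0 : ℝ) 1, |y₁ x - y₂ x| ≤ R * solBound ^ 2 := by
  have hR0 : 0 ≤ R := (abs_nonneg _).trans (hR 0 ⟨le_rfl, zero_le_one⟩)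
  have key := norm_le_gronwallBound_of_norm_deriv_right_le
    (f := fun x => (y₁ x - y₂ x, dy₁ x - dy₂ x))
    (f' := fun x => (dy₁ x - dy₂ x, -(κ₁ x) * y₁ x - -(κ₂ x) * y₂ x)) (δ := 0) (K := 16)
    (ε := R * solBound) (a := 0) (b := 1)
    ((h₁.sol.cont.sub h₂.sol.cont).prodMk (h₁.sol.cont'.sub h₂.sol.cont'))
    (fun x hx => ((h₁.sol.deriv x hx).sub (h₂.sol.deriv x hx)).prodMk
      ((h₁.sol.deriv' x hx).sub (h₂.sol.deriv' x hx)))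
    (by simp [h₁.zero, h₁.one, h₂.zero, h₂.one])
    (fun x hx => by
      have hx' : x ∈ Icc (0 : ℝ) 1 := ⟨hx.1, hx.2.le⟩
      have hk := hκ₁ x hx'
      have h1 := norm_fst_le (y₁ x - y₂ x, dy₁ x - dy₂ x)
      have h2 := norm_snd_le (y₁ x - y₂ x, dy₁ x - dy₂ x)
      have h0 : 0 ≤ R * solBound := mul_nonneg hR0 solBound_pos.le
      simp only [Real.norm_eq_abs] at h1 h2
      rw [Prod.norm_def]
      refine max_le ?_ ?_
      · simp only [Real.norm_eq_abs]; linarith [abs_nonneg (dy₁ x - dy₂ x)]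
      · simp only [Real.norm_eq_abs]
        have e : -(κ₁ x) * y₁ x - -(κ₂ x) * y₂ x
            = -(κ₁ x) * (y₁ x - y₂ x) - (κ₁ x - κ₂ x) * y₂ x := by ring
        rw [e]
        refine (abs_sub _ _).trans ?_
        rw [abs_mul, abs_mul, abs_neg]
        exact add_le_add (mul_le_mul hk h1 (abs_nonneg _) (by norm_num))
          (mul_le_mul (hR x hx') (h₂.norm_le hκ₂ x hx').1 (abs_nonneg _) hR0))
  intro x hx
  have h3 := (norm_fst_le (y₁ x - y₂ x, dy₁ x - dy₂ x)).trans (key x hx)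
  rw [gronwallBound_of_K_ne_0 (by norm_num)] at h3
  have h4 : Real.exp (16 * (x - 0)) ≤ solBound := Real.exp_le_exp.2 (by linarith [hx.2])
  simp only [Real.norm_eq_abs, zero_mul, zero_add] at h3
  refine h3.trans ?_
  have h5 : 0 ≤ R * solBound := mul_nonneg hR0 solBound_pos.le
  have h6 : R * solBound / 16 ≤ R * solBound := by linarith
  calc R * solBound / 16 * (Real.exp (16 * (x - 0)) - 1)
      ≤ R * solBound / 16 * solBound := by
        apply mul_le_mul_of_nonneg_left (by linarith) (by linarith)
    _ ≤ R * solBound * solBound := mul_le_mul_of_nonneg_right h6 solBound_pos.le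
    _ = _ := by ring

theorem lipschitz (h : IsShot κ y dy) (hκ : ∀ x ∈ Icc (0 : ℝ) 1, |κ x| ≤ 16) {x x' : ℝ}
    (hx : x ∈ Icc (0 : ℝ) 1) (hx' : x' ∈ Icc (0 : ℝ) 1) :
    |y x - y x'| ≤ solBound * |x - x'| := by
  wlog hxx : x' ≤ x generalizing x x'
  · have := this hx' hx (not_le.1 hxx).le
    rwa [abs_sub_comm, abs_sub_comm x]
  have := norm_image_sub_le_of_norm_deriv_right_le_segment (f := y) (f' := dy) (C := solBound)
    (h.sol.cont.mono (Icc_subset_Icc hx'.1 hx.2))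
    (fun t ht => h.sol.deriv t ⟨hx'.1.trans ht.1, ht.2.trans_le hx.2⟩)
    (fun t ht => (h.norm_le hκ t ⟨hx'.1.trans ht.1, (ht.2.trans_le hx.2).le⟩).2) x ⟨hxx, le_rfl⟩
  rwa [abs_of_nonneg (sub_nonneg.2 hxx)]

theorem sq_lipschitz (h : IsShot κ y dy) (hκ : ∀ x ∈ Icc (0 : ℝ) 1, |κ x| ≤ 16) {x x' : ℝ}
    (hx : x ∈ Icc (0 : ℝ) 1) (hx' : x' ∈ Icc (0 : ℝ) 1) :
    |y x ^ 2 - y x' ^ 2| ≤ 2 * solBound ^ 2 * |x - x'| := by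
  have e : y x ^ 2 - y x' ^ 2 = (y x + y x') * (y x - y x') := by ring
  rw [e, abs_mul]
  have h1 : |y x + y x'| ≤ 2 * solBound :=
    (abs_add_le _ _).trans (by linarith [(h.norm_le hκ x hx).1, (h.norm_le hκ x' hx').1])
  calc _ ≤ 2 * solBound * (solBound * |x - x'|) :=
        mul_le_mul h1 (h.lipschitz hκ hx hx') (abs_nonneg _) (by linarith [solBound_pos])
    _ = _ := by ring

/-- Since `|y''| ≤ 16 * solBound`, the slope stays within `1/2` of its initial value `1` on an
interval of this length. -/
theorem half_le (h : IsShot κ y dy) (hκ : ∀ x ∈ Icc (0 : ℝ) 1, |κ x| ≤ 16) {x : ℝ}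
    (hx : x ∈ Icc (0 : ℝ) (1 / (32 * solBound))) : x / 2 ≤ y x := by
  have hB := one_le_solBound
  have hx1 : x ≤ 1 := hx.2.trans (by
    rw [div_le_one (by linarith)]; linarith)
  have h1 : ∀ t ∈ Icc 0 x, |dy t - 1| ≤ 1 / 2 := by
    intro t ht
    have := norm_image_sub_le_of_norm_deriv_right_le_segment (f := dy)
      (f' := fun x => -(κ x) * y x) (C := 16 * solBound)
      (h.sol.cont'.mono (Icc_subset_Icc le_rfl hx1))
      (fun t ht => h.sol.deriv' t ⟨ht.1, ht.2.trans_le hx1⟩)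
      (fun t ht => by
        have ht' : t ∈ Icc (0 : ℝ) 1 := ⟨ht.1, ht.2.le.trans hx1⟩
        simp only [Real.norm_eq_abs, abs_mul, abs_neg]
        exact mul_le_mul (hκ t ht') (h.norm_le hκ t ht').1 (abs_nonneg _) (by norm_num)) t ht
    rw [h.one, Real.norm_eq_abs, sub_zero] at this
    refine this.trans ?_
    have h2 : t ≤ 1 / (32 * solBound) := ht.2.trans hx.2
    rw [le_div_iff₀ (by linarith)] at h2
    linarith
  have := norm_image_sub_le_of_norm_deriv_right_le_segment (f := fun t => y t - t)
    (f' := fun t => dy t - 1) (C := 1 / 2) (a := 0) (b := x)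
    ((h.sol.cont.mono (Icc_subset_Icc le_rfl hx1)).sub continuousOn_id)
    (fun t ht => (h.sol.deriv t ⟨ht.1, ht.2.trans_le hx1⟩).sub (hasDerivWithinAt_id _ _))
    (fun t ht => h1 t ⟨ht.1, ht.2.le⟩) x ⟨hx.1, le_rfl⟩
  rw [h.zero, Real.norm_eq_abs] at this
  have := (abs_le.1 this).1
  linarith

theorem cont_sq (h : IsShot κ y dy) : IntervalIntegrable (fun x => y x ^ 2) volume 0 1 :=
  (h.sol.cont.pow 2).intervalIntegrable_of_Icc zero_le_one

theorem sqBound_le (h : IsShot κ y dy) (hκ : ∀ x ∈ Icc (0 : ℝ) 1, |κ x| ≤ 16) :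
    sqBound ≤ ∫ x in (0 : ℝ)..1, y x ^ 2 := by
  have hB := one_le_solBound
  set t := 1 / (32 * solBound) with ht
  have ht0 : 0 < t := by rw [ht]; exact div_pos one_pos (by linarith)
  have ht1 : t ≤ 1 := by rw [ht, div_le_one (by linarith)]; linarith
  -- On `[t/2, t]` the solution is at least `t/4`; this gives `(t/4)² · t/2 = t³/32`, the value of
  -- `sqBound`.
  have h1 : ∫ x in (t / 2)..t, (t / 4) ^ 2 ≤ ∫ x in (t / 2)..t, y x ^ 2 := by
    apply intervalIntegral.integral_mono_on (by linarith) (by simp)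
    · apply h.cont_sq.mono_set
      rw [uIcc_of_le (by linarith), uIcc_of_le zero_le_one]
      exact Icc_subset_Icc (by linarith) ht1
    · intro x hx
      have := h.half_le hκ (x := x) ⟨by linarith [hx.1], hx.2⟩
      exact pow_le_pow_left₀ (by linarith) (by linarith [hx.1]) 2
  have h2 : ∫ x in (t / 2)..t, y x ^ 2 ≤ ∫ x in (0 : ℝ)..1, y x ^ 2 :=
    intervalIntegral.integral_mono_interval (by linarith) (by linarith) ht1
      (Eventually.of_forall fun x => sq_nonneg _) h.cont_sq
  rw [intervalIntegral.integral_const, smul_eq_mul] at h1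
  refine le_trans (le_of_eq ?_) (h1.trans h2)
  rw [sqBound]; ring

/-- Two potentials at distance at most `R` have smallest eigenvalues at distance at most `R`. -/
theorem abs_eigenvalue_sub_le (hv : IsShot (fun x => l - q x) v dv)
    (hy : IsShot (fun x => m - p x) y dy)
    (hκv : ∀ x ∈ Icc (0 : ℝ) 1, 4 < l - q x ∧ l - q x < 16)
    (hκy : ∀ x ∈ Icc (0 : ℝ) 1, 4 < m - p x ∧ m - p x < 16) (hv1 : v 1 = 0) (hy1 : y 1 = 0)
    (hR : ∀ x ∈ Icc (0 : ℝ) 1, |q x - p x| ≤ R) : |l - m| ≤ R := by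
  rw [abs_le]
  constructor <;> by_contra hn <;> rw [not_le] at hn
  -- If `l < m - R`, then `l - q < m - p` everywhere, so the Wronskian of the two positive
  -- eigenfunctions would increase strictly, although it vanishes at both ends. The other case is
  -- symmetric.
  · have := hy.sol.wronskian_pos one_pos hv.sol
      (fun x hx => by linarith [(abs_le.1 (hR x ⟨hx.1.le, hx.2.le⟩)).1]) (hy.pos hκy hy1)
      (hv.pos hκv hv1)
    simp [hy.zero, hv.zero, hv1, hy1] at this
  · have := hv.sol.wronskian_pos one_pos hy.sol
      (fun x hx => by linarith [(abs_le.1 (hR x ⟨hx.1.le, hx.2.le⟩)).2]) (hv.pos hκv hv1)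
      (hy.pos hκy hy1)
    simp [hy.zero, hv.zero, hv1, hy1] at this

/-- First order perturbation of the smallest eigenvalue, with a quadratic remainder. -/
theorem expansion (hv : IsShot (fun x => l - q x) v dv)
    (hy : IsShot (fun x => m - p x) y dy)
    (hκv : ∀ x ∈ Icc (0 : ℝ) 1, 4 < l - q x ∧ l - q x < 16)
    (hκy : ∀ x ∈ Icc (0 : ℝ) 1, 4 < m - p x ∧ m - p x < 16) (hv1 : v 1 = 0) (hy1 : y 1 = 0)
    (hR : ∀ x ∈ Icc (0 : ℝ) 1, |q x - p x| ≤ R) :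
    IntervalIntegrable (fun x => (q x - p x) * v x ^ 2) volume 0 1 ∧
    |(l - m) * (∫ x in (0 : ℝ)..1, v x ^ 2) - ∫ x in (0 : ℝ)..1, (q x - p x) * v x ^ 2|
      ≤ 4 * solBound ^ 3 * R ^ 2 := by
  have hlm := hv.abs_eigenvalue_sub_le hy hκv hκy hv1 hy1 hR
  have hR0 : 0 ≤ R := (abs_nonneg _).trans hlm
  have ab : ∀ {t : ℝ}, 4 < t ∧ t < 16 → |t| ≤ 16 := fun h => abs_le.2 ⟨by linarith, by linarith⟩
  have hBv := hv.norm_le (fun x hx => ab (hκv x hx))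
  have hd := hv.abs_sub_le hy (R := 2 * R) (fun x hx => ab (hκv x hx))
    (fun x hx => ab (hκy x hx)) (fun x hx => by
      have h1 := abs_le.1 (hR x hx)
      have h2 := abs_le.1 hlm
      exact abs_le.2 ⟨by linarith, by linarith⟩)
  -- The boundary terms vanish, so `(l - q) - (m - p)` is orthogonal to `v y`. Replacing `y` by `v`
  -- costs a product of two small factors: the coefficient difference, at most `2R`, and `v - y`, at
  -- most `2R * solBound²`.
  obtain ⟨hi, hw⟩ := SolOn.wronskian zero_le_one hv.sol hy.sol
  simp only [hy.zero, hv.zero, hv1, hy1, zero_mul, mul_zero, sub_self] at hw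
  have hi2 : IntervalIntegrable (fun x => ((l - q x) - (m - p x)) * v x ^ 2) volume 0 1 := by
    apply (hv.sol.int.sub hy.sol.int).mul_continuousOn
    rw [uIcc_of_le zero_le_one]; exact hv.sol.cont.pow 2
  have hi3 : IntervalIntegrable (fun x => (q x - p x) * v x ^ 2) volume 0 1 := by
    refine ((hv.cont_sq.const_mul (l - m)).sub hi2).congr (fun x _ => ?_)
    ring
  refine ⟨hi3, ?_⟩
  have e : (l - m) * (∫ x in (0 : ℝ)..1, v x ^ 2) - ∫ x in (0 : ℝ)..1, (q x - p x) * v x ^ 2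
      = ∫ x in (0 : ℝ)..1, ((l - q x) - (m - p x)) * (v x * (v x - y x)) := by
    rw [← intervalIntegral.integral_const_mul,
      ← intervalIntegral.integral_sub (hv.cont_sq.const_mul _) hi3]
    have e2 := intervalIntegral.integral_sub ((hv.cont_sq.const_mul (l - m)).sub hi3) hi
    rw [hw, sub_zero] at e2
    rw [← e2]
    congr 1; ext x; ring
  rw [e]
  have := intervalIntegral.norm_integral_le_of_norm_le_const (a := (0 : ℝ)) (b := 1)
    (f := fun x => ((l - q x) - (m - p x)) * (v x * (v x - y x)))
    (C := 4 * solBound ^ 3 * R ^ 2) (fun x hx => by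
      rw [uIoc_of_le zero_le_one] at hx
      have hx' : x ∈ Icc (0 : ℝ) 1 := ⟨hx.1.le, hx.2⟩
      have h1 := abs_le.1 (hR x hx')
      have h2 := abs_le.1 hlm
      rw [Real.norm_eq_abs, abs_mul, abs_mul]
      calc _ ≤ 2 * R * (solBound * (2 * R * solBound ^ 2)) := by
            refine mul_le_mul (abs_le.2 ⟨by linarith, by linarith⟩) ?_ (by positivity)
              (by linarith)
            exact mul_le_mul (hBv x hx').1 (hd x hx') (abs_nonneg _) solBound_pos.le
        _ = _ := by ring)
  simpa using this

/-- Existence of a zero of `μ ↦ y_μ(1)` between sign changes. -/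
theorem exists_zero (hp : ∀ x ∈ Icc (0 : ℝ) 1, -(1 / 2) ≤ p x ∧ p x ≤ 3 / 2)
    {Y dY : ℝ → ℝ → ℝ} (hY : ∀ μ ∈ Icc (8 : ℝ) 12, IsShot (fun x => μ - p x) (Y μ) (dY μ))
    {c d : ℝ} (hc : 8 ≤ c) (hcd : c ≤ d) (hd : d ≤ 12) (h0 : 0 ≤ Y c 1) (h1 : Y d 1 ≤ 0) :
    ∃ μ ∈ Icc c d, Y μ 1 = 0 := by
  have hcont : ContinuousOn (fun μ => Y μ 1) (Icc c d) := by
    have : LipschitzOnWith (⟨solBound ^ 2, by positivity⟩) (fun μ => Y μ 1) (Icc c d) := by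
      apply LipschitzOnWith.of_dist_le_mul
      intro s hs t ht
      have hs' : s ∈ Icc (8 : ℝ) 12 := ⟨hc.trans hs.1, hs.2.trans hd⟩
      have ht' : t ∈ Icc (8 : ℝ) 12 := ⟨hc.trans ht.1, ht.2.trans hd⟩
      have := (hY s hs').abs_sub_le (hY t ht') (R := |s - t|)
        (fun x hx => abs_le.2 ⟨by linarith [(hp x hx).2, hs'.1], by linarith [(hp x hx).1, hs'.2]⟩)
        (fun x hx => abs_le.2 ⟨by linarith [(hp x hx).2, ht'.1], by linarith [(hp x hx).1, ht'.2]⟩)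
        (fun x hx => le_of_eq (by congr 1; ring)) 1 ⟨zero_le_one, le_rfl⟩
      rw [Real.dist_eq, Real.dist_eq]
      change _ ≤ solBound ^ 2 * _
      linarith
    exact this.continuousOn
  have := intermediate_value_Icc' hcd hcont
  exact this ⟨h1, h0⟩

/-- For values of `p` in `[-1/2, 3/2]` one has `8 - p < 9 = 3² < π²` and `12 - p > 10 > π²`. Thus
`[8, 12]` is a common bracket for the inputs and for their approximations, which may leave `[0, 1]`
slightly. -/
theorem sign_eight (hp : ∀ x ∈ Icc (0 : ℝ) 1, -(1 / 2) ≤ p x ∧ p x ≤ 3 / 2)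
    (h : IsShot (fun x => 8 - p x) y dy) : 0 < y 1 :=
  h.pos_of_lt_nine fun x hx => by linarith [(hp x hx).1]

theorem sign_twelve (hp : ∀ x ∈ Icc (0 : ℝ) 1, -(1 / 2) ≤ p x ∧ p x ≤ 3 / 2)
    (h : IsShot (fun x => 12 - p x) y dy) : y 1 < 0 :=
  h.neg_of_ten_le fun x hx => ⟨by linarith [(hp x hx).2], by linarith [(hp x hx).1]⟩

end IsShot

/-! ### Existence of shooting solutions by the Prüfer substitution -/

/-- The right-hand side of the angle equation is bounded uniformly in the angle, so one application
of Picard–Lindelöf covers all of `[-1, 2]`: the radius `2 (M + 2)` is the maximal time `2` times the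
bound `M + 2`. The larger interval provides two-sided derivatives at `0` and `1`. -/
theorem exists_prufer_angle {κ : ℝ → ℝ} (hκ : Continuous κ) :
    ∃ θ : ℝ → ℝ, Continuous θ ∧ θ 0 = 0 ∧ ∀ x ∈ Ioo (-1 : ℝ) 2,
      HasDerivAt θ (1 + (κ x - 1) * Real.sin (θ x) ^ 2) x := by
  obtain ⟨C, hC⟩ := (isCompact_Icc (a := (-1 : ℝ)) (b := 2)).exists_bound_of_continuousOn
    hκ.continuousOn
  set M : NNReal := ⟨|C|, abs_nonneg C⟩ with hM
  have hMb : ∀ t ∈ Icc (-1 : ℝ) 2, |κ t - 1| ≤ M + 1 := fun t ht =>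
    (abs_sub _ _).trans (by
      rw [abs_one]; exact add_le_add ((hC t ht).trans (le_abs_self C)) le_rfl)
  have hpl : IsPicardLindelof (fun t θ : ℝ => 1 + (κ t - 1) * Real.sin θ ^ 2)
      (tmin := -1) (tmax := 2) ⟨0, by norm_num, by norm_num⟩ 0 (2 * (M + 2)) 0 (M + 2)
      (2 * (M + 1)) := by
    refine ⟨fun t ht => ?_, fun x _ => ?_, fun t ht x _ => ?_, ?_⟩
    · apply LipschitzOnWith.of_dist_le_mul
      intro a _ b _
      rw [Real.dist_eq, Real.dist_eq]
      have e : 1 + (κ t - 1) * Real.sin a ^ 2 - (1 + (κ t - 1) * Real.sin b ^ 2)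
        = (κ t - 1) * ((Real.sin a + Real.sin b) * (Real.sin a - Real.sin b)) := by ring
      rw [e, abs_mul, abs_mul]
      have h1 : |Real.sin a + Real.sin b| ≤ 2 := (abs_add_le _ _).trans (by
        linarith [Real.abs_sin_le_one a, Real.abs_sin_le_one b])
      calc _ ≤ (M + 1 : ℝ) * (2 * |a - b|) := by
            refine mul_le_mul (hMb t ht) (mul_le_mul h1 (Real.abs_sin_sub_sin_le a b)
              (abs_nonneg _) (by norm_num)) (by positivity) (by positivity)
        _ = _ := by push_cast; ring
    · exact (continuous_const.add ((hκ.sub continuous_const).mul continuous_const)).continuousOn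
    · rw [Real.norm_eq_abs]
      refine (abs_add_le _ _).trans ?_
      rw [abs_mul, abs_one, abs_of_nonneg (sq_nonneg (Real.sin x))]
      have h1 := mul_le_mul (hMb t ht) (Real.sin_sq_le_one x) (sq_nonneg _) (by positivity)
      push_cast
      linarith
    · have : max ((2 : ℝ) - 0) (0 - -1) = 2 := by norm_num
      simp only [this]
      push_cast
      linarith
  obtain ⟨θ, h0, hθ⟩ := hpl.exists_eq_forall_mem_Icc_hasDerivWithinAt₀
  have hcont : ContinuousOn θ (Icc (-1) 2) := fun x hx => (hθ x hx).continuousWithinAt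
  have h12 : (-1 : ℝ) ≤ 2 := by norm_num
  refine ⟨IccExtend h12 ((Icc (-1 : ℝ) 2).domRestrict θ), ?_, ?_, ?_⟩
  · exact (continuousOn_iff_continuous_domRestrict.1 hcont).Icc_extend'
  · rw [IccExtend_of_mem _ _ (⟨by norm_num, by norm_num⟩ : (0 : ℝ) ∈ Icc (-1 : ℝ) 2)]
    exact h0
  · intro x hx
    have e : ∀ t ∈ Icc (-1 : ℝ) 2, IccExtend h12 ((Icc (-1 : ℝ) 2).domRestrict θ) t = θ t :=
      fun t ht => by rw [IccExtend_of_mem _ _ ht]; rfl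
    rw [e x ⟨hx.1.le, hx.2.le⟩]
    refine ((hθ x ⟨hx.1.le, hx.2.le⟩).hasDerivAt (Icc_mem_nhds hx.1 hx.2)).congr_of_eventuallyEq ?_
    filter_upwards [Icc_mem_nhds hx.1 hx.2] with t ht using e t ht

/-- Polar coordinates in the phase plane: once the angle is known, the logarithm `g` of the radius
is the integral of `(1 - κ) sin θ cos θ`. -/
theorem exists_solution {κ : ℝ → ℝ} (hκ : Continuous κ) :
    ∃ y dy : ℝ → ℝ, y 0 = 0 ∧ dy 0 = 1 ∧ ∀ x ∈ Ioo (-1 : ℝ) 2,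
      HasDerivAt y (dy x) x ∧ HasDerivAt dy (-(κ x) * y x) x := by
  obtain ⟨θ, hθc, hθ0, hθ⟩ := exists_prufer_angle hκ
  set F : ℝ → ℝ := fun x => (1 - κ x) * (Real.sin (θ x) * Real.cos (θ x)) with hF
  have hFc : Continuous F := (continuous_const.sub hκ).mul
    ((Real.continuous_sin.comp hθc).mul (Real.continuous_cos.comp hθc))
  set g : ℝ → ℝ := fun x => ∫ t in (0 : ℝ)..x, F t with hg
  have hgd : ∀ x, HasDerivAt g (F x) x := fun x => (hFc.integral_hasStrictDerivAt 0 x).hasDerivAt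
  have hg0 : g 0 = 0 := by simp [hg]
  refine ⟨fun x => Real.exp (g x) * Real.sin (θ x), fun x => Real.exp (g x) * Real.cos (θ x),
    by simp [hθ0], by simp [hθ0, hg0], fun x hx => ⟨?_, ?_⟩⟩
  · refine ((hgd x).exp.mul (hθ x hx).sin).congr_deriv ?_
    simp only [hF]
    ring
  · refine ((hgd x).exp.mul (hθ x hx).cos).congr_deriv ?_
    have := Real.sin_sq_add_cos_sq (θ x)
    simp only [hF]
    linear_combination (Real.exp (g x) * Real.sin (θ x) * (1 - κ x)) * this

theorem exists_shot {κ : ℝ → ℝ} (hκ : Continuous κ) :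
    ∃ y dy : ℝ → ℝ, IsShot κ y dy ∧ ContDiffOn ℝ 2 y (Icc 0 1) ∧
      ∀ x ∈ Ioo (0 : ℝ) 1, deriv (deriv y) x = -(κ x) * y x := by
  obtain ⟨y, dy, h0, h1, h⟩ := exists_solution hκ
  have hsub : Icc (0 : ℝ) 1 ⊆ Ioo (-1) 2 := fun x hx =>
    ⟨by linarith [hx.1], by linarith [hx.2]⟩
  have e1 : ∀ x ∈ Ioo (-1 : ℝ) 2, deriv y x = dy x := fun x hx => (h x hx).1.deriv
  have e2 : ∀ x ∈ Ioo (-1 : ℝ) 2, deriv dy x = -(κ x) * y x := fun x hx => (h x hx).2.deriv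
  have hy : DifferentiableOn ℝ y (Ioo (-1) 2) := fun x hx =>
    (h x hx).1.differentiableAt.differentiableWithinAt
  have hdy : DifferentiableOn ℝ dy (Ioo (-1) 2) := fun x hx =>
    (h x hx).2.differentiableAt.differentiableWithinAt
  refine ⟨y, dy, ⟨SolOn.of_hasDerivAt hκ.continuousOn zero_le_one (fun x hx => (h x (hsub hx)).1)
    (fun x hx => (h x (hsub hx)).2), h0, h1⟩, ?_, ?_⟩
  · refine ContDiffOn.mono ?_ hsub
    have c1 : ContDiffOn ℝ 1 dy (Ioo (-1) 2) := by
      rw [show (1 : WithTop ℕ∞) = 0 + 1 by norm_num,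
        contDiffOn_succ_iff_deriv_of_isOpen isOpen_Ioo]
      refine ⟨hdy, by simp, ?_⟩
      rw [contDiffOn_zero]
      exact ((hκ.neg.continuousOn).mul hy.continuousOn).congr e2
    rw [show (2 : WithTop ℕ∞) = 1 + 1 by norm_num,
      contDiffOn_succ_iff_deriv_of_isOpen isOpen_Ioo]
    exact ⟨hy, by simp, c1.congr e1⟩
  · intro x hx
    have hx' := hsub ⟨hx.1.le, hx.2.le⟩
    rw [← e2 x hx']
    apply Filter.EventuallyEq.deriv_eq
    filter_upwards [isOpen_Ioo.mem_nhds hx'] with t ht using e1 t ht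

/-! ### The smallest eigenvalue -/

theorem deriv_nonneg_of_pos_right {u : ℝ → ℝ} {d a b : ℝ} (hab : a < b)
    (h : HasDerivWithinAt u d (Ici a) a) (ha : u a = 0) (hpos : ∀ x ∈ Ioo a b, 0 < u x) :
    0 ≤ d := by
  have h1 := hasDerivWithinAt_iff_tendsto_slope.1 h
  rw [Ici_sdiff_left] at h1
  refine ge_of_tendsto h1 ?_
  filter_upwards [Ioo_mem_nhdsGT hab] with x hx
  rw [slope_def_field, ha, sub_zero]
  exact div_nonneg (hpos x hx).le (by linarith [hx.1])

theorem deriv_nonpos_of_pos_left {u : ℝ → ℝ} {d a b : ℝ} (hab : a < b)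
    (h : HasDerivWithinAt u d (Icc a b) b) (hb : u b = 0) (hpos : ∀ x ∈ Ioo a b, 0 < u x) :
    d ≤ 0 := by
  have h1 := hasDerivWithinAt_iff_tendsto_slope.1 h
  rw [Icc_sdiff_right] at h1
  have : (𝓝[Ico a b] b).NeBot := by
    rw [nhdsWithin_Ico_eq_nhdsLT hab]; infer_instance
  refine le_of_tendsto (h1.mono_left (nhdsWithin_mono _ (Subset.rfl))) ?_
  rw [nhdsWithin_Ico_eq_nhdsLT hab]
  filter_upwards [Ioo_mem_nhdsLT hab] with x hx
  rw [slope_def_field, hb, sub_zero]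
  exact div_nonpos_of_nonneg_of_nonpos (hpos x hx).le (by linarith [hx.2])

/-- The equation is given only inside the interval, with two-sided derivatives; continuity of the
second derivative within `[0,1]` carries it to the end points. -/
theorem solOn_of_contDiffOn {u κ : ℝ → ℝ} (hκ : ContinuousOn κ (Icc 0 1))
    (hu : ContDiffOn ℝ 2 u (Icc 0 1))
    (h : ∀ x ∈ Ioo (0 : ℝ) 1, deriv (deriv u) x = -(κ x) * u x) :
    SolOn κ 0 1 u (derivWithin u (Icc 0 1)) := by
  have hU : UniqueDiffOn ℝ (Icc (0 : ℝ) 1) := uniqueDiffOn_Icc one_pos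
  rw [show (2 : WithTop ℕ∞) = 1 + 1 by norm_num, contDiffOn_succ_iff_derivWithin hU] at hu
  obtain ⟨hd, -, hu1⟩ := hu
  have hd2 : DifferentiableOn ℝ (derivWithin u (Icc 0 1)) (Icc 0 1) :=
    hu1.differentiableOn one_ne_zero
  have hc2 : ContinuousOn (derivWithin (derivWithin u (Icc 0 1)) (Icc 0 1)) (Icc 0 1) :=
    hu1.continuousOn_derivWithin hU le_rfl
  have heq : EqOn (derivWithin (derivWithin u (Icc 0 1)) (Icc 0 1)) (fun x => -(κ x) * u x)
      (Icc 0 1) := by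
    refine EqOn.of_subset_closure (s := Ioo 0 1) ?_ hc2 (hκ.neg.mul hd.continuousOn)
      Ioo_subset_Icc_self (by rw [closure_Ioo zero_ne_one])
    intro x hx
    have hx' : Icc (0 : ℝ) 1 ∈ 𝓝 x := Icc_mem_nhds hx.1 hx.2
    simp only
    rw [← h x hx, derivWithin_of_mem_nhds hx']
    apply Filter.EventuallyEq.deriv_eq
    filter_upwards [isOpen_Ioo.mem_nhds hx] with t ht
    exact derivWithin_of_mem_nhds (Icc_mem_nhds ht.1 ht.2)
  have hnhds : ∀ x ∈ Ico (0 : ℝ) 1, Icc (0 : ℝ) 1 ∈ 𝓝[≥] x := fun x hx =>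
    mem_of_superset (Icc_mem_nhdsGE hx.2) (Icc_subset_Icc hx.1 le_rfl)
  refine ⟨hκ.intervalIntegrable_of_Icc zero_le_one, hd.continuousOn, hd2.continuousOn, ?_, ?_⟩
  · intro x hx
    exact ((hd x ⟨hx.1, hx.2.le⟩).hasDerivWithinAt).mono_of_mem_nhdsWithin (hnhds x hx)
  · intro x hx
    rw [← show _ = -(κ x) * u x from heq ⟨hx.1, hx.2.le⟩]
    exact ((hd2 x ⟨hx.1, hx.2.le⟩).hasDerivWithinAt).mono_of_mem_nhdsWithin (hnhds x hx)

/-- No eigenvalue is smaller than one with an eigenfunction that is positive on `(0,1)`. -/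
theorem le_of_isEigenvalue {q v dv : ℝ → ℝ} {l l' : ℝ} (hq : ContinuousOn q (Icc 0 1))
    (hv : SolOn (fun x => l - q x) 0 1 v dv) (hv0 : v 0 = 0) (hv1 : v 1 = 0)
    (hpos : ∀ x ∈ Ioo (0 : ℝ) 1, 0 < v x) (h : IsEigenvalue q l') : l ≤ l' := by
  by_contra hl
  rw [not_le] at hl
  obtain ⟨u, hu, hu0, hu1, ⟨x₀, hx₀, hne⟩, hode⟩ := h
  wlog hx₀p : 0 < u x₀ generalizing u
  · refine this (fun x => -u x) hu.neg (by simp [hu0]) (by simp [hu1]) ?_ (by simpa using hne) ?_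
    · intro x hx
      have e : deriv (fun x => -u x) = fun x => -deriv u x := by ext x; simp
      have e2 : deriv (fun x => -deriv u x) x = -deriv (deriv u) x := by simp
      rw [e, e2]
      linarith [hode x hx]
    · have : u x₀ < 0 := lt_of_le_of_ne (not_lt.1 hx₀p) hne
      linarith
  have hsol : SolOn (fun x => l' - q x) 0 1 u (derivWithin u (Icc 0 1)) :=
    solOn_of_contDiffOn (continuousOn_const.sub hq) hu
      (fun x hx => by linarith [hode x hx])
  have hx₀m : x₀ ∈ Icc (0 : ℝ) 1 := ⟨hx₀.1.le, hx₀.2.le⟩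
  have hnear : ∀ᶠ x in 𝓝 x₀, 0 < u x :=
    ((hsol.cont.continuousAt (Icc_mem_nhds hx₀.1 hx₀.2))).eventually (lt_mem_nhds hx₀p)
  obtain ⟨b, hb, hub, hbp⟩ := exists_first_zero
    (hsol.cont.mono (Icc_subset_Icc hx₀.1.le le_rfl))
    (hnear.filter_mono nhdsWithin_le_nhds) hx₀.2 hu1.le
  -- The left end of the nodal interval around `x₀` is `-a'`, found as the first zero of the
  -- reflected function.
  obtain ⟨a', ha', hua, hap⟩ := exists_first_zero (y := fun x => u (-x)) (a := -x₀) (b := 0)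
    (hsol.cont.comp continuousOn_neg (fun x hx =>
      ⟨by linarith [hx.2], by linarith [hx.1, hx₀.2]⟩))
    ((((continuous_neg.tendsto' (-x₀) x₀ (neg_neg _)).eventually hnear)).filter_mono
      nhdsWithin_le_nhds) (by linarith [hx₀.1]) (by simp [hu0])
  have ha0 : 0 ≤ -a' := by linarith [ha'.2]
  have hax : -a' < x₀ := by linarith [ha'.1]
  have hab : -a' < b := hax.trans hb.1
  have hupos : ∀ x ∈ Ioo (-a') b, 0 < u x := by
    intro x hx
    rcases lt_trichotomy x x₀ with h | h | h
    · have := hap (-x) ⟨by linarith, by linarith [hx.1]⟩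
      simpa using this
    · rwa [h]
    · exact hbp x ⟨h, hx.2⟩
  have hv' : ∀ x ∈ Icc (0 : ℝ) 1, 0 ≤ v x := by
    intro x hx
    rcases eq_or_lt_of_le hx.1 with rfl | h1
    · rw [hv0]
    rcases eq_or_lt_of_le hx.2 with rfl | h2
    · rw [hv1]
    exact (hpos x ⟨h1, h2⟩).le
  -- Since `l' < l`, the quantity `v u' - v' u` increases strictly over the nodal interval. But `u`
  -- vanishes at its ends, with `u' ≥ 0` on the left and `u' ≤ 0` on the right, while `v ≥ 0`.
  have h1 := SolOn.wronskian_pos hab (hv.mono ha0 hab.le hb.2) (hsol.mono ha0 hab.le hb.2)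
    (fun x _ => by linarith)
    (fun x hx => hpos x ⟨ha0.trans_lt hx.1, hx.2.trans_le hb.2⟩) hupos
  have hda := deriv_nonneg_of_pos_right hab (hsol.deriv (-a') ⟨ha0, hab.trans_le hb.2⟩) hua hupos
  have hub' : HasDerivWithinAt u (derivWithin u (Icc 0 1) b) (Icc (-a') b) b :=
    (((hu.differentiableOn two_ne_zero) b ⟨ha0.trans hab.le, hb.2⟩).hasDerivWithinAt).mono
      (Icc_subset_Icc ha0 hb.2)
  have hdb := deriv_nonpos_of_pos_left hab hub' hub hupos
  have h2 := mul_nonneg (hv' (-a') ⟨ha0, hab.le.trans hb.2⟩) hda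
  have h3 := mul_nonpos_of_nonneg_of_nonpos (hv' b ⟨ha0.trans hab.le, hb.2⟩) hdb
  simp only [hub, hua, mul_zero, sub_zero] at h1
  linarith

theorem classQ_continuousOn {q : ℝ → ℝ} (hq : q ∈ classQ) : ContinuousOn q (Icc 0 1) :=
  hq.1.continuousOn

theorem continuous_comp_projIcc {q : ℝ → ℝ} (hq : ContinuousOn q (Icc 0 1)) :
    Continuous fun x : ℝ => q (projIcc (0 : ℝ) 1 zero_le_one x) :=
  hq.comp_continuous (continuous_subtype_val.comp continuous_projIcc)
    (fun x => (projIcc (0 : ℝ) 1 zero_le_one x).2)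

/-- The smallest eigenvalue is attained by shooting. -/
theorem exists_eigenpair {q : ℝ → ℝ} (hq : q ∈ classQ) :
    IsLeast {l | IsEigenvalue q l} (smallestEigenvalue q) ∧ smallestEigenvalue q ∈ Icc (8 : ℝ) 12 ∧
    ∃ v dv : ℝ → ℝ, IsShot (fun x => smallestEigenvalue q - q x) v dv ∧ v 1 = 0 := by
  -- `exists_shot` needs a coefficient that is continuous on the whole line; projecting the argument
  -- to `[0,1]` changes nothing there.
  set qe : ℝ → ℝ := fun x => q (projIcc (0 : ℝ) 1 zero_le_one x) with hqe
  have hqec : Continuous qe := continuous_comp_projIcc (classQ_continuousOn hq)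
  have hqeq : ∀ x ∈ Icc (0 : ℝ) 1, qe x = q x := fun x hx => by
    simp only [hqe]; rw [projIcc_of_mem _ hx]
  choose Y dY hY hY2 hYode using fun μ : ℝ => exists_shot (κ := fun x => μ - qe x) (by fun_prop)
  have hp : ∀ x ∈ Icc (0 : ℝ) 1, -(1 / 2) ≤ qe x ∧ qe x ≤ 3 / 2 := fun x hx => by
    have := hq.2.1 x hx
    rw [hqeq x hx]
    exact ⟨by linarith [this.1], by linarith [this.2]⟩
  obtain ⟨l, hl, hl0⟩ := IsShot.exists_zero hp (fun μ _ => hY μ) (c := 8) (d := 12) le_rfl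
    (by norm_num) le_rfl (IsShot.sign_eight hp (hY 8)).le (IsShot.sign_twelve hp (hY 12)).le
  have hκ : ∀ x ∈ Icc (0 : ℝ) 1, 4 < l - qe x ∧ l - qe x < 16 := fun x hx =>
    ⟨by linarith [(hp x hx).2, hl.1], by linarith [(hp x hx).1, hl.2]⟩
  have hpos := (hY l).pos hκ hl0
  have hsol : SolOn (fun x => l - q x) 0 1 (Y l) (dY l) :=
    (hY l).sol.congr zero_le_one fun x hx => by rw [hqeq x ⟨hx.1, hx.2.le⟩]
  have hleast : IsLeast {l | IsEigenvalue q l} l := by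
    refine ⟨⟨Y l, hY2 l, (hY l).zero, hl0, ⟨1 / 2, by norm_num, (hpos _ (by norm_num)).ne'⟩, ?_⟩, ?_⟩
    · intro x hx
      rw [hYode l x hx, hqeq x ⟨hx.1.le, hx.2.le⟩]
      ring
    · intro l' hl'
      exact le_of_isEigenvalue (classQ_continuousOn hq) hsol (hY l).zero hl0 hpos hl'
  have : smallestEigenvalue q = l := hleast.csInf_eq
  rw [this]
  exact ⟨hleast, hl, Y l, dY l, ⟨hsol, (hY l).zero, (hY l).one⟩, hl0⟩

/-! ### Averaging over random signs -/

/-- The sign `-1` or `1` encoded by a Boolean. -/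
noncomputable def sgn (b : Bool) : ℝ := cond b (-1) 1

theorem sgn_sq (b : Bool) : sgn b ^ 2 = 1 := by cases b <;> simp [sgn]

theorem abs_sgn (b : Bool) : |sgn b| = 1 := by cases b <;> simp [sgn]

theorem sgn_xor (a b : Bool) : sgn (xor a b) = sgn a * sgn b := by
  cases a <;> cases b <;> simp [sgn]

theorem sgn_not (a : Bool) : sgn (!a) = -sgn a := by cases a <;> simp [sgn]

section Signs

variable {ι : Type*} [Fintype ι] [DecidableEq ι]

/-- Independent signs are orthonormal. In the induction, pairing `ρ` with the pattern flipped at `j`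
cancels the cross term with `b j`. -/
theorem sum_sq_signs (I : Finset ι) (b : ι → ℝ) (c : ℝ) :
    ∑ ρ : ι → Bool, (c + ∑ i ∈ I, b i * sgn (ρ i)) ^ 2 =
      2 ^ Fintype.card ι * (c ^ 2 + ∑ i ∈ I, b i ^ 2) := by
  induction I using Finset.induction_on with
  | empty => simp
  | insert j I hj ih =>
    have hinv : Function.Involutive (fun ρ : ι → Bool => Function.update ρ j (!(ρ j))) := by
      intro ρ; ext i; by_cases h : i = j <;> simp [h]
    set flip := hinv.toPerm with hflip
    have hf : ∀ ρ, flip ρ = Function.update ρ j (!(ρ j)) := fun ρ => rfl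
    have e := Equiv.sum_comp flip
      (fun ρ : ι → Bool => (c + ∑ i ∈ insert j I, b i * sgn (ρ i)) ^ 2)
    have e2 : ∀ ρ : ι → Bool, (c + ∑ i ∈ insert j I, b i * sgn (ρ i)) ^ 2 +
        (c + ∑ i ∈ insert j I, b i * sgn (flip ρ i)) ^ 2 =
        2 * (c + ∑ i ∈ I, b i * sgn (ρ i)) ^ 2 + 2 * b j ^ 2 := by
      intro ρ
      rw [Finset.sum_insert hj, Finset.sum_insert hj]
      have h1 : ∑ i ∈ I, b i * sgn (flip ρ i) = ∑ i ∈ I, b i * sgn (ρ i) := by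
        refine Finset.sum_congr rfl fun i hi => ?_
        have : i ≠ j := fun h => hj (h ▸ hi)
        simp [hf, this]
      have h2 : sgn (flip ρ j) = -sgn (ρ j) := by
        simp [hf, sgn_not]
      rw [h1, h2]
      linear_combination 2 * b j ^ 2 * sgn_sq (ρ j)
    have e3 := Finset.sum_congr (rfl : (Finset.univ : Finset (ι → Bool)) = _) fun ρ _ => e2 ρ
    rw [Finset.sum_add_distrib, Finset.sum_add_distrib, ← Finset.mul_sum, ih] at e3
    simp only [Finset.sum_const, Finset.card_univ, Fintype.card_fun, Fintype.card_bool,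
      nsmul_eq_mul, Nat.cast_pow, Nat.cast_ofNat] at e3
    rw [Finset.sum_insert hj]
    linarith

/-- Multiply by `ρ` the signs that have not been seen. -/
def flipUnseen (seen : (ι → Bool) → Finset ι) (ρ σ : ι → Bool) : ι → Bool :=
  fun i => if i ∈ seen σ then σ i else xor (σ i) (ρ i)

/-- An adaptive method that sees at most half of the signs has a large mean square error. -/
theorem sum_sq_error_ge {seen : (ι → Bool) → Finset ι} {out L : (ι → Bool) → ℝ}
    (hcons : ∀ σ τ, (∀ i ∈ seen σ, τ i = σ i) → seen τ = seen σ ∧ out τ = out σ)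
    {a : ι → ℝ} {a₀ L₀ δ : ℝ} (ha₀ : 0 ≤ a₀) (ha : ∀ i, a₀ ≤ a i)
    (hL : ∀ σ, |L σ - (L₀ + ∑ i, a i * sgn (σ i))| ≤ δ) :
    (Finset.univ.filter fun σ => 2 * (seen σ).card ≤ Fintype.card ι).card *
      (Fintype.card ι / 4 * a₀ ^ 2 - δ ^ 2) ≤ ∑ σ, (L σ - out σ) ^ 2 := by
  set n := Fintype.card ι with hn
  set G := Finset.univ.filter fun σ => 2 * (seen σ).card ≤ n with hG
  set f : (ι → Bool) → ℝ := fun σ => if σ ∈ G then (L σ - out σ) ^ 2 else 0 with hf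
  have hfle : ∑ σ, f σ ≤ ∑ σ, (L σ - out σ) ^ 2 := by
    refine Finset.sum_le_sum fun σ _ => ?_
    simp only [hf]; split_ifs
    · exact le_rfl
    · exact sq_nonneg _
  refine le_trans ?_ hfle
  have hflip : ∀ ρ σ, seen (flipUnseen seen ρ σ) = seen σ ∧ out (flipUnseen seen ρ σ) = out σ :=
    fun ρ σ => hcons _ _ fun i hi => by simp [flipUnseen, hi]
  -- Changing unseen signs does not alter what is seen, so the flip is an involution. The sum over
  -- `σ` may therefore be averaged over `ρ`, and for fixed `σ` the output is then fixed while the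
  -- unseen signs are random.
  have hinv : ∀ ρ, Function.Involutive (flipUnseen seen ρ) := by
    intro ρ σ
    ext i
    have := (hflip ρ σ).1
    by_cases hi : i ∈ seen σ
    · simp [flipUnseen, this, hi]
    · rw [flipUnseen, this, if_neg hi, flipUnseen, if_neg hi]; simp
  have hsum : ∀ ρ, ∑ σ, f (flipUnseen seen ρ σ) = ∑ σ, f σ := fun ρ =>
    Equiv.sum_comp (hinv ρ).toPerm f
  have key : ∀ σ ∈ G, (2 : ℝ) ^ n * (n / 4 * a₀ ^ 2 - δ ^ 2) ≤
      ∑ ρ, f (flipUnseen seen ρ σ) := by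
    intro σ hσ
    have hσ' : 2 * (seen σ).card ≤ n := (Finset.mem_filter.1 hσ).2
    set I := (seen σ)ᶜ with hI
    set c := L₀ + ∑ i ∈ seen σ, a i * sgn (σ i) - out σ with hc
    have h1 : ∀ ρ, (c + ∑ i ∈ I, (a i * sgn (σ i)) * sgn (ρ i)) ^ 2 / 2 - δ ^ 2 ≤
        f (flipUnseen seen ρ σ) := by
      intro ρ
      have hm : flipUnseen seen ρ σ ∈ G := by
        rw [hG, Finset.mem_filter, (hflip ρ σ).1]; exact ⟨Finset.mem_univ _, hσ'⟩
      simp only [hf, if_pos hm, (hflip ρ σ).2]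
      have h2 := hL (flipUnseen seen ρ σ)
      have h3 : ∑ i, a i * sgn (flipUnseen seen ρ σ i) =
          ∑ i ∈ seen σ, a i * sgn (σ i) + ∑ i ∈ I, (a i * sgn (σ i)) * sgn (ρ i) := by
        rw [← Finset.sum_add_sum_compl (seen σ)]
        congr 1
        · refine Finset.sum_congr rfl fun i hi => ?_
          simp [flipUnseen, hi]
        · refine Finset.sum_congr rfl fun i hi => ?_
          rw [Finset.mem_compl] at hi
          simp [flipUnseen, hi, sgn_xor, mul_assoc]
      rw [h3] at h2
      set X := c + ∑ i ∈ I, (a i * sgn (σ i)) * sgn (ρ i) with hX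
      set e := L (flipUnseen seen ρ σ) - (L₀ + (∑ i ∈ seen σ, a i * sgn (σ i) +
        ∑ i ∈ I, (a i * sgn (σ i)) * sgn (ρ i))) with he
      have h4 : L (flipUnseen seen ρ σ) - out σ = X + e := by rw [hX, he, hc]; ring
      rw [h4]
      have h5 : e ^ 2 ≤ δ ^ 2 := sq_le_sq' (abs_le.1 h2).1 (abs_le.1 h2).2
      -- The difference of `(X + e)²` and `X²/2 - e²` is `(X + 2e)²/2`.
      nlinarith [sq_nonneg (X + 2 * e)]
    refine le_trans ?_ (Finset.sum_le_sum fun ρ _ => h1 ρ)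
    rw [Finset.sum_sub_distrib, ← Finset.sum_div, sum_sq_signs]
    simp only [Finset.sum_const, Finset.card_univ, Fintype.card_fun, Fintype.card_bool,
      nsmul_eq_mul, Nat.cast_pow, Nat.cast_ofNat, ← hn]
    have h6 : (n / 2 : ℝ) * a₀ ^ 2 ≤ ∑ i ∈ I, (a i * sgn (σ i)) ^ 2 := by
      have h7 : I.card • a₀ ^ 2 ≤ ∑ i ∈ I, (a i * sgn (σ i)) ^ 2 := by
        refine Finset.card_nsmul_le_sum _ _ _ fun i _ => ?_
        rw [mul_pow, sgn_sq, mul_one]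
        exact pow_le_pow_left₀ ha₀ (ha i) 2
      refine le_trans ?_ h7
      rw [nsmul_eq_mul]
      refine mul_le_mul_of_nonneg_right ?_ (sq_nonneg _)
      have h8 : I.card + (seen σ).card = n := by rw [hI, Finset.card_compl_add_card]
      have h9 : n ≤ 2 * I.card := by omega
      have h9' : (n : ℝ) ≤ 2 * I.card := by exact_mod_cast h9
      linarith
    have h10 : (0 : ℝ) < 2 ^ n := by positivity
    have h11 : n / 4 * a₀ ^ 2 - δ ^ 2 ≤
        (c ^ 2 + ∑ i ∈ I, (a i * sgn (σ i)) ^ 2) / 2 - δ ^ 2 := by nlinarith [sq_nonneg c]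
    calc _ ≤ 2 ^ n * ((c ^ 2 + ∑ i ∈ I, (a i * sgn (σ i)) ^ 2) / 2 - δ ^ 2) :=
          mul_le_mul_of_nonneg_left h11 h10.le
      _ = _ := by ring
  have hdouble : (2 : ℝ) ^ n * ∑ σ, f σ = ∑ σ, ∑ ρ, f (flipUnseen seen ρ σ) := by
    rw [Finset.sum_comm, Finset.sum_congr rfl fun ρ _ => hsum ρ]
    simp [hn]
  have hG2 : (2 : ℝ) ^ n * (G.card * (n / 4 * a₀ ^ 2 - δ ^ 2)) ≤
      ∑ σ, ∑ ρ, f (flipUnseen seen ρ σ) := by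
    calc _ = G.card • ((2 : ℝ) ^ n * (n / 4 * a₀ ^ 2 - δ ^ 2)) := by rw [nsmul_eq_mul]; ring
      _ ≤ ∑ σ ∈ G, ∑ ρ, f (flipUnseen seen ρ σ) := Finset.card_nsmul_le_sum _ _ _ key
      _ ≤ _ := Finset.sum_le_univ_sum_of_nonneg fun σ => Finset.sum_nonneg fun ρ _ => by
          simp only [hf]; split_ifs
          · exact sq_nonneg _
          · exact le_rfl
  rw [← hdouble] at hG2
  exact le_of_mul_le_mul_left hG2 (by positivity)

/-- The randomized version: methods that see few signs on average have a large error for some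
sign pattern. -/
theorem exists_large_error {Ω : Type*} [MeasurableSpace Ω] (P : Measure Ω) [IsProbabilityMeasure P]
    [Nonempty ι]
    {cnt : (ι → Bool) → Ω → ℝ≥0∞} {out : (ι → Bool) → Ω → ℝ}
    {seen : Ω → (ι → Bool) → Finset ι} {L : (ι → Bool) → ℝ}
    (hcm : ∀ σ, Measurable (cnt σ)) (hom : ∀ σ, Measurable (out σ))
    (hcard : ∀ σ ω, ((seen ω σ).card : ℝ≥0∞) ≤ cnt σ ω)
    (hcons : ∀ ω σ τ, (∀ i ∈ seen ω σ, τ i = σ i) → seen ω τ = seen ω σ ∧ out τ ω = out σ ω)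
    {a : ι → ℝ} {a₀ L₀ δ : ℝ} (ha₀ : 0 ≤ a₀) (ha : ∀ i, a₀ ≤ a i)
    (hL : ∀ σ, |L σ - (L₀ + ∑ i, a i * sgn (σ i))| ≤ δ)
    (hint : ∀ σ, ∫⁻ ω, cnt σ ω ∂P ≤ ENNReal.ofReal (Fintype.card ι / 4)) :
    ∃ σ, ENNReal.ofReal ((Fintype.card ι / 4 * a₀ ^ 2 - δ ^ 2) / 2) ≤
      ∫⁻ ω, ENNReal.ofReal ((L σ - out σ ω) ^ 2) ∂P := by
  set n := Fintype.card ι with hn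
  have hn0 : 0 < n := Fintype.card_pos
  set D : ℝ := n / 4 * a₀ ^ 2 - δ ^ 2 with hD
  rcases le_or_gt D 0 with hD0 | hD0
  · refine ⟨fun _ => true, ?_⟩
    rw [ENNReal.ofReal_of_nonpos (by linarith)]; exact zero_le
  -- Markov's inequality for `2 cnt`, whose mean is at most `n/2`. The event is expressed by `cnt`,
  -- as the seen set is not assumed measurable in `ω`.
  have hmarkov : ∀ σ, ENNReal.ofReal (1 / 2) ≤ P {ω | 2 * cnt σ ω < n} := by
    intro σ
    have h1 := mul_meas_ge_le_lintegral₀ (μ := P) ((hcm σ).const_mul 2).aemeasurable (n : ℝ≥0∞)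
    rw [lintegral_const_mul _ (hcm σ)] at h1
    have h2 : (n : ℝ≥0∞) * P {ω | (n : ℝ≥0∞) ≤ 2 * cnt σ ω} ≤ n * ENNReal.ofReal (1 / 2) := by
      refine h1.trans ((mul_le_mul_right (hint σ) 2).trans (le_of_eq ?_))
      rw [← ENNReal.ofReal_natCast, show (2 : ℝ≥0∞) = ENNReal.ofReal 2 by simp,
        ← ENNReal.ofReal_mul (by norm_num), ← ENNReal.ofReal_mul (by positivity)]
      congr 1; ring
    have h3 : P {ω | (n : ℝ≥0∞) ≤ 2 * cnt σ ω} ≤ ENNReal.ofReal (1 / 2) :=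
      (ENNReal.mul_le_mul_iff_right (by simpa using hn0.ne') (by simp)).1 h2
    have hms : MeasurableSet {ω | (n : ℝ≥0∞) ≤ 2 * cnt σ ω} :=
      measurableSet_le measurable_const ((hcm σ).const_mul 2)
    have h4 : {ω | 2 * cnt σ ω < n} = {ω | (n : ℝ≥0∞) ≤ 2 * cnt σ ω}ᶜ := by
      ext ω; simp
    rw [h4, prob_compl_eq_one_sub hms]
    calc ENNReal.ofReal (1 / 2) = 1 - ENNReal.ofReal (1 / 2) := by
          rw [← ENNReal.ofReal_one, ← ENNReal.ofReal_sub _ (by norm_num)]; norm_num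
      _ ≤ _ := tsub_le_tsub_left h3 1
  by_contra hno
  push Not at hno
  have hms : ∀ σ, MeasurableSet {ω | 2 * cnt σ ω < n} := fun σ =>
    measurableSet_lt ((hcm σ).const_mul 2) measurable_const
  -- For fixed `ω` the method is deterministic, so the averaging bound over sign patterns applies;
  -- integrating over `ω` and comparing the two finite sums then produces one bad pattern.
  have hpt : ∀ ω, ∑ σ, ENNReal.ofReal D * ({ω | 2 * cnt σ ω < n} : Set Ω).indicator 1 ω ≤
      ∑ σ, ENNReal.ofReal ((L σ - out σ ω) ^ 2) := by
    intro ω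
    have h1 := sum_sq_error_ge (hcons ω) ha₀ ha hL
    rw [← ENNReal.ofReal_sum_of_nonneg fun σ _ => sq_nonneg _]
    refine le_trans ?_ (ENNReal.ofReal_le_ofReal h1)
    rw [ENNReal.ofReal_mul (by positivity), ← Finset.mul_sum, mul_comm, ENNReal.ofReal_natCast]
    refine mul_le_mul_left ?_ _
    classical
    rw [Finset.card_filter, Nat.cast_sum]
    refine Finset.sum_le_sum fun σ _ => ?_
    by_cases hσ : 2 * cnt σ ω < n
    · have h2 : 2 * (seen ω σ).card ≤ n := by
        have : (2 : ℝ≥0∞) * (seen ω σ).card < n :=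
          lt_of_le_of_lt (mul_le_mul_right (hcard σ ω) 2) hσ
        exact_mod_cast this.le
      simp [hσ, hn ▸ h2]
    · simp [hσ]
  have h1 : ∑ σ : ι → Bool, ENNReal.ofReal (D / 2) ≤
      ∑ σ, ∫⁻ ω, ENNReal.ofReal ((L σ - out σ ω) ^ 2) ∂P := by
    rw [← lintegral_finsetSum _ fun σ _ => by
      exact ((measurable_const.sub (hom σ)).pow_const 2).ennreal_ofReal]
    refine le_trans ?_ (lintegral_mono hpt)
    rw [lintegral_finsetSum _ fun σ _ => (measurable_one.indicator (hms σ)).const_mul _]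
    refine Finset.sum_le_sum fun σ _ => ?_
    rw [lintegral_const_mul _ (measurable_one.indicator (hms σ)), lintegral_indicator_one (hms σ),
      show D / 2 = D * (1 / 2) by ring, ENNReal.ofReal_mul hD0.le]
    exact mul_le_mul_right (hmarkov σ) _
  have h2 : ∑ σ, ∫⁻ ω, ENNReal.ofReal ((L σ - out σ ω) ^ 2) ∂P <
      ∑ σ : ι → Bool, ENNReal.ofReal (D / 2) := by
    refine ENNReal.sum_lt_sum_of_nonempty Finset.univ_nonempty fun σ _ => hno σ
  exact absurd h1 (not_le.2 h2)

end Signs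

/-! ### Fooling potentials -/

/-- A twice continuously differentiable bump function with its derivatives. -/
theorem exists_bump : ∃ (F₀ F₁ F₂ : ℝ → ℝ) (M : ℝ), 1 ≤ M ∧ Continuous F₂ ∧
    (∀ x, HasDerivAt F₀ (F₁ x) x) ∧ (∀ x, HasDerivAt F₁ (F₂ x) x) ∧
    (∀ x, |F₀ x| ≤ M ∧ |F₁ x| ≤ M ∧ |F₂ x| ≤ M) ∧
    (∀ x, 2 < |x| → F₀ x = 0 ∧ F₁ x = 0 ∧ F₂ x = 0) ∧ (∀ x, 0 ≤ F₀ x) ∧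
    ∀ x, |x| ≤ 1 → F₀ x = 1 := by
  let B : ContDiffBump (0 : ℝ) := ⟨1, 2, one_pos, one_lt_two⟩
  have hB : ContDiff ℝ 2 B := B.contDiff
  have hB1 : ContDiff ℝ 1 (deriv B) := by
    rw [show (2 : WithTop ℕ∞) = 1 + 1 by norm_num, contDiff_succ_iff_deriv] at hB
    exact hB.2.2
  have hB2 : Continuous (deriv (deriv B)) := hB1.continuous_deriv le_rfl
  have hc0 : HasCompactSupport B := B.hasCompactSupport
  have hc1 : HasCompactSupport (deriv B) := hc0.deriv
  have hc2 : HasCompactSupport (deriv (deriv B)) := hc1.deriv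
  obtain ⟨M₀, hM₀⟩ := hB.continuous.bounded_above_of_compact_support hc0
  obtain ⟨M₁, hM₁⟩ := hB1.continuous.bounded_above_of_compact_support hc1
  obtain ⟨M₂, hM₂⟩ := hB2.bounded_above_of_compact_support hc2
  have hts : ∀ x : ℝ, 2 < |x| → x ∉ tsupport B := by
    intro x hx
    rw [B.tsupport_eq, Metric.mem_closedBall, Real.dist_eq, sub_zero, not_le]
    exact hx
  have h1 : tsupport (deriv B) ⊆ tsupport B :=
    closure_minimal support_deriv_subset (isClosed_tsupport _)
  have h2 : tsupport (deriv (deriv B)) ⊆ tsupport (deriv B) :=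
    closure_minimal support_deriv_subset (isClosed_tsupport _)
  refine ⟨B, deriv B, deriv (deriv B), max 1 (max M₀ (max M₁ M₂)), le_max_left _ _, hB2,
    fun x => ((hB.differentiable two_ne_zero) x).hasDerivAt,
    fun x => ((hB1.differentiable one_ne_zero) x).hasDerivAt, fun x => ⟨?_, ?_, ?_⟩,
    fun x hx => ⟨?_, ?_, ?_⟩, fun x => B.nonneg, fun x hx => ?_⟩
  · exact (hM₀ x).trans ((le_max_left _ _).trans (le_max_right _ _))
  · exact (hM₁ x).trans ((le_max_left _ _).trans ((le_max_right _ _).trans (le_max_right _ _)))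
  · exact (hM₂ x).trans ((le_max_right _ _).trans ((le_max_right _ _).trans (le_max_right _ _)))
  · exact image_eq_zero_of_notMem_tsupport (hts x hx)
  · exact image_eq_zero_of_notMem_tsupport fun h => hts x hx (h1 h)
  · exact image_eq_zero_of_notMem_tsupport fun h => hts x hx (h1 (h2 h))
  · exact B.one_of_mem_closedBall (by
      rw [Metric.mem_closedBall, Real.dist_eq, sub_zero]; exact hx)

/-- The centres of `N` bumps in `[1/4, 3/4]`. -/
noncomputable def centre {N : ℕ} (i : Fin N) : ℝ := 1 / 4 + (2 * i + 1) / (4 * N)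

/-- The point `x` in the coordinates of the bump with index `i`. -/
noncomputable def bumpCoord {N : ℕ} (i : Fin N) (x : ℝ) : ℝ := 16 * N * (x - centre i)

/-- Neighbouring centres are `8` apart in bump coordinates and bumps have radius `2`. Hence one
sample point carries information on at most one sign. -/
theorem eq_of_local_le {N : ℕ} {i j : Fin N} {x : ℝ} (hi : |bumpCoord i x| ≤ 2)
    (hj : |bumpCoord j x| ≤ 2) : i = j := by
  have hN : (0 : ℝ) < N := by exact_mod_cast i.pos
  have e : bumpCoord j x - bumpCoord i x = 8 * ((i : ℝ) - j) := by
    simp only [bumpCoord, centre]; field_simp; ring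
  have h1 : |8 * ((i : ℝ) - j)| ≤ 4 := by
    rw [← e]; exact (abs_sub _ _).trans (by linarith)
  rw [abs_le] at h1
  have h2 : ((i : ℕ) : ℝ) < (j : ℕ) + 1 := by linarith
  have h3 : ((j : ℕ) : ℝ) < (i : ℕ) + 1 := by linarith
  have h2' : (i : ℕ) < j + 1 := by exact_mod_cast h2
  have h3' : (j : ℕ) < i + 1 := by exact_mod_cast h3
  exact Fin.ext (by omega)

theorem abs_sum_local_le {N : ℕ} {F : ℝ → ℝ} {M : ℝ} (hM : ∀ x, |F x| ≤ M)
    (hF : ∀ x, 2 < |x| → F x = 0) (σ : Fin N → Bool) (x : ℝ) :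
    |∑ i, sgn (σ i) * F (bumpCoord i x)| ≤ M := by
  by_cases h : ∃ i : Fin N, |bumpCoord i x| ≤ 2
  · obtain ⟨i, hi⟩ := h
    rw [Finset.sum_eq_single i]
    · rw [abs_mul, abs_sgn, one_mul]; exact hM _
    · intro j _ hj
      rw [hF _ (not_le.1 fun h => hj (eq_of_local_le h hi)), mul_zero]
    · simp
  · push Not at h
    rw [Finset.sum_eq_zero fun i _ => by rw [hF _ (h i), mul_zero], abs_zero]
    exact (abs_nonneg _).trans (hM 0)

theorem hasDerivAt_sum_local {N : ℕ} {F F' : ℝ → ℝ} (h : ∀ x, HasDerivAt F (F' x) x)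
    (σ : Fin N → Bool) (x : ℝ) :
    HasDerivAt (fun x => ∑ i, sgn (σ i) * F (bumpCoord i x))
      (16 * N * ∑ i, sgn (σ i) * F' (bumpCoord i x)) x := by
  rw [Finset.mul_sum]
  apply HasDerivAt.fun_sum
  intro i _
  have h0 : HasDerivAt (bumpCoord i) (16 * N : ℝ) x :=
    (((hasDerivAt_id x).sub_const (centre i)).const_mul (16 * N : ℝ)).congr_deriv (mul_one _)
  exact (((h _).comp x h0).const_mul (sgn (σ i))).congr_deriv (by ring)

/-- The perturbation of the constant potential `1/2` with signs `σ`. -/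
noncomputable def fool (F : ℝ → ℝ) (M : ℝ) {N : ℕ} (σ : Fin N → Bool) (x : ℝ) : ℝ :=
  1 / 2 + 1 / (2 * M * (16 * N) ^ 2) * ∑ i, sgn (σ i) * F (bumpCoord i x)

/-- Each derivative costs a factor `16 N`, and the amplitude absorbs two of them. As the supports
are disjoint, the bounds do not grow with the number of bumps. -/
theorem fool_mem_classQ {F₀ F₁ F₂ : ℝ → ℝ} {M : ℝ} (hM1 : 1 ≤ M) (hF₂ : Continuous F₂)
    (h0 : ∀ x, HasDerivAt F₀ (F₁ x) x) (h1 : ∀ x, HasDerivAt F₁ (F₂ x) x)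
    (hM : ∀ x, |F₀ x| ≤ M ∧ |F₁ x| ≤ M ∧ |F₂ x| ≤ M)
    (hz : ∀ x, 2 < |x| → F₀ x = 0 ∧ F₁ x = 0 ∧ F₂ x = 0) {N : ℕ} (hN : 0 < N)
    (σ : Fin N → Bool) :
    fool F₀ M σ ∈ classQ ∧ ∀ x, |fool F₀ M σ x - 1 / 2| ≤ 1 / (2 * (16 * N) ^ 2) := by
  have hN' : (1 : ℝ) ≤ N := by exact_mod_cast hN
  set s : ℝ := 16 * N with hs
  have hs1 : 1 ≤ s := by rw [hs]; linarith
  set S₀ := fun x => ∑ i, sgn (σ i) * F₀ (bumpCoord i x)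
  set S₁ := fun x => ∑ i, sgn (σ i) * F₁ (bumpCoord i x)
  set S₂ := fun x => ∑ i, sgn (σ i) * F₂ (bumpCoord i x)
  have b0 : ∀ x, |S₀ x| ≤ M := abs_sum_local_le (fun x => (hM x).1) (fun x hx => (hz x hx).1) σ
  have b1 : ∀ x, |S₁ x| ≤ M :=
    abs_sum_local_le (fun x => (hM x).2.1) (fun x hx => (hz x hx).2.1) σ
  have b2 : ∀ x, |S₂ x| ≤ M :=
    abs_sum_local_le (fun x => (hM x).2.2) (fun x hx => (hz x hx).2.2) σ
  have d0 : ∀ x, HasDerivAt (fool F₀ M σ) (1 / (2 * M * s) * S₁ x) x := fun x => by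
    refine (((hasDerivAt_sum_local h0 σ x).const_mul (1 / (2 * M * s ^ 2))).const_add
      (1 / 2)).congr_deriv ?_
    simp only [S₁, ← hs]
    have : s ≠ 0 := by linarith
    have : M ≠ 0 := by linarith
    field_simp
  have d1 : ∀ x, HasDerivAt (fun x => 1 / (2 * M * s) * S₁ x) (1 / (2 * M) * S₂ x) x := fun x => by
    refine ((hasDerivAt_sum_local h1 σ x).const_mul (1 / (2 * M * s))).congr_deriv ?_
    simp only [S₂, ← hs]
    have : s ≠ 0 := by linarith
    have : M ≠ 0 := by linarith
    field_simp
  have hd0 : deriv (fool F₀ M σ) = fun x => 1 / (2 * M * s) * S₁ x := funext fun x => (d0 x).deriv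
  have hd1 : deriv (fun x => 1 / (2 * M * s) * S₁ x) = fun x => 1 / (2 * M) * S₂ x :=
    funext fun x => (d1 x).deriv
  have hS₂ : Continuous S₂ := continuous_finsetSum _ fun i _ =>
    continuous_const.mul (hF₂.comp (continuous_const.mul (continuous_id.sub continuous_const)))
  have hC1 : ContDiff ℝ 1 (fun x => 1 / (2 * M * s) * S₁ x) := by
    rw [contDiff_one_iff_deriv, hd1]
    exact ⟨fun x => (d1 x).differentiableAt, continuous_const.mul hS₂⟩
  have hC2 : ContDiff ℝ 2 (fool F₀ M σ) := by
    rw [show (2 : WithTop ℕ∞) = 1 + 1 by norm_num, contDiff_succ_iff_deriv, hd0]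
    exact ⟨fun x => (d0 x).differentiableAt, by simp, hC1⟩
  have bound : ∀ (t : ℝ) (S : ℝ), 1 ≤ t → |S| ≤ M → |1 / (2 * M * t) * S| ≤ 1 / (2 * t) := by
    intro t S ht hS
    rw [abs_mul, abs_of_nonneg (by positivity)]
    calc _ ≤ 1 / (2 * M * t) * M := mul_le_mul_of_nonneg_left hS (by positivity)
      _ = _ := by field_simp
  have hdev : ∀ x, |fool F₀ M σ x - 1 / 2| ≤ 1 / (2 * s ^ 2) := by
    intro x
    have : fool F₀ M σ x - 1 / 2 = 1 / (2 * M * s ^ 2) * S₀ x := by rw [fool]; ring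
    rw [this]
    exact bound _ _ (one_le_pow₀ hs1) (b0 x)
  have half : ∀ t : ℝ, 1 ≤ t → 1 / (2 * t) ≤ 1 / 2 := fun t ht =>
    one_div_le_one_div_of_le two_pos (by linarith)
  have hrange : ∀ x, fool F₀ M σ x ∈ Icc (0 : ℝ) 1 := fun x => by
    have := abs_le.1 ((hdev x).trans (half _ (one_le_pow₀ hs1)))
    exact ⟨by linarith, by linarith⟩
  refine ⟨⟨hC2.contDiffOn, fun x _ => hrange x, ?_⟩, hdev⟩
  intro i hi x hx
  rw [iteratedDerivWithin_eq_iteratedDeriv (uniqueDiffOn_Icc one_pos)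
    (hC2.contDiffAt.of_le (by exact_mod_cast hi)) hx]
  interval_cases i
  · rw [iteratedDeriv_zero, abs_of_nonneg (hrange x).1]; exact (hrange x).2
  · rw [iteratedDeriv_one, hd0]
    exact (bound _ _ hs1 (b1 x)).trans ((half _ hs1).trans (by norm_num))
  · rw [iteratedDeriv_succ, iteratedDeriv_one, hd0, hd1]
    have := bound 1 _ le_rfl (b2 x)
    rw [mul_one] at this
    exact this.trans (by norm_num)

/-- The shooting solution for a constant potential with smallest eigenvalue. -/
theorem isShot_sine : IsShot (fun x : ℝ => (Real.pi ^ 2 + 1 / 2) - (fun _ => (1 / 2 : ℝ)) x)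
    (fun x => Real.sin (Real.pi * x) / Real.pi) (fun x => Real.cos (Real.pi * x)) := by
  have hpi := Real.pi_pos.ne'
  refine ⟨SolOn.of_hasDerivAt (by fun_prop) zero_le_one (fun x _ => ?_) (fun x _ => ?_), by simp,
    by simp⟩
  · have h0 : HasDerivAt (fun x : ℝ => Real.pi * x) Real.pi x := by
      simpa using (hasDerivAt_id x).const_mul Real.pi
    exact (h0.sin.div_const Real.pi).congr_deriv (by field_simp)
  · have h0 : HasDerivAt (fun x : ℝ => Real.pi * x) Real.pi x := by
      simpa using (hasDerivAt_id x).const_mul Real.pi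
    exact h0.cos.congr_deriv (by field_simp; ring)

theorem one_le_eight_mul_sin {x : ℝ} (h1 : 1 / 4 ≤ x) (h2 : x ≤ 3 / 4) :
    1 / 8 ≤ Real.sin (Real.pi * x) / Real.pi := by
  have hpi := Real.pi_pos
  have hpi4 := Real.pi_le_four
  have key : ∀ t : ℝ, 1 / 4 ≤ t → t ≤ 1 / 2 → 1 / 2 ≤ Real.sin (Real.pi * t) := by
    intro t ht1 ht2
    have := Real.mul_le_sin (x := Real.pi * t) (by nlinarith) (by nlinarith)
    refine le_trans ?_ this
    have : 2 / Real.pi * (Real.pi * t) = 2 * t := by field_simp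
    linarith
  have h : 1 / 2 ≤ Real.sin (Real.pi * x) := by
    rcases le_total x (1 / 2) with h | h
    · exact key x h1 h
    · have := key (1 - x) (by linarith) (by linarith)
      rwa [mul_sub, mul_one, Real.sin_pi_sub] at this
  rw [le_div_iff₀ hpi]; linarith

/-- The smallest eigenvalues of the fooling potentials are nearly linear in the signs. -/
theorem fool_eigenvalue {F₀ F₁ F₂ : ℝ → ℝ} {M : ℝ} (hM1 : 1 ≤ M) (hF₂ : Continuous F₂)
    (h0 : ∀ x, HasDerivAt F₀ (F₁ x) x) (h1 : ∀ x, HasDerivAt F₁ (F₂ x) x)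
    (hM : ∀ x, |F₀ x| ≤ M ∧ |F₁ x| ≤ M ∧ |F₂ x| ≤ M)
    (hz : ∀ x, 2 < |x| → F₀ x = 0 ∧ F₁ x = 0 ∧ F₂ x = 0)
    (hpos : ∀ x, 0 ≤ F₀ x) (hone : ∀ x, |x| ≤ 1 → F₀ x = 1) {N : ℕ} (hN : 0 < N) :
    ∃ a : Fin N → ℝ, (∀ i, 1 / (64 * M * (16 * N) ^ 3) ≤ a i) ∧ ∀ σ : Fin N → Bool,
      |smallestEigenvalue (fool F₀ M σ) - ((Real.pi ^ 2 + 1 / 2) + ∑ i, a i * sgn (σ i))| ≤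
        solBound ^ 3 / sqBound / (16 * N) ^ 4 := by
  have hN' : (1 : ℝ) ≤ N := by exact_mod_cast hN
  set s : ℝ := 16 * N with hs
  have hs1 : 1 ≤ s := by rw [hs]; linarith
  set v : ℝ → ℝ := fun x => Real.sin (Real.pi * x) / Real.pi with hv
  have hvc : Continuous v := by fun_prop
  have hpi3 := Real.pi_gt_three
  have hpi2 : Real.pi ^ 2 < 10 := by nlinarith [Real.pi_lt_d2]
  have hpi9 : 9 < Real.pi ^ 2 := by nlinarith
  have hF₀c : Continuous F₀ := continuous_iff_continuousAt.2 fun x => (h0 x).continuousAt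
  have hκv : ∀ x ∈ Icc (0 : ℝ) 1, 4 < (Real.pi ^ 2 + 1 / 2) - (fun _ => (1 / 2 : ℝ)) x ∧
      (Real.pi ^ 2 + 1 / 2) - (fun _ => (1 / 2 : ℝ)) x < 16 := fun x _ => by
    constructor <;> simp only <;> linarith
  set S := ∫ x in (0 : ℝ)..1, v x ^ 2 with hS
  have hSlow : sqBound ≤ S := isShot_sine.sqBound_le fun x hx =>
    abs_le.2 ⟨by linarith [(hκv x hx).1], (hκv x hx).2.le⟩
  have hSpos : 0 < S := sqBound_pos.trans_le hSlow
  have hv1 : ∀ x, v x ^ 2 ≤ 1 := fun x => by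
    rw [hv]; simp only [div_pow]
    rw [div_le_one (by positivity)]
    linarith [Real.sin_sq_le_one (Real.pi * x)]
  have hSle : S ≤ 1 := by
    have : S ≤ ∫ x in (0 : ℝ)..1, (1 : ℝ) :=
      intervalIntegral.integral_mono_on zero_le_one ((hvc.pow 2).intervalIntegrable _ _)
        (by simp) fun x _ => hv1 x
    simpa using this
  set c : ℝ := 1 / (2 * M * s ^ 2) with hc
  have hc0 : 0 < c := by rw [hc]; positivity
  have hloc : ∀ i : Fin N, Continuous (fun x => F₀ (bumpCoord i x)) := fun i =>
    hF₀c.comp (continuous_const.mul (continuous_id.sub continuous_const))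
  have hlc : ∀ i : Fin N, Continuous (fun x => F₀ (bumpCoord i x) * v x ^ 2) := fun i =>
    (hloc i).mul (hvc.pow 2)
  set I : Fin N → ℝ := fun i => ∫ x in (0 : ℝ)..1, F₀ (bumpCoord i x) * v x ^ 2 with hI
  -- The first order effect of bump `i`: its integral against `v²`, divided by `∫ v²`.
  refine ⟨fun i => c * I i / S, ?_, ?_⟩
  · intro i
    have hi1 : ((i : ℕ) : ℝ) + 1 ≤ N := by exact_mod_cast i.2
    have hi0 : (0 : ℝ) ≤ (i : ℕ) := Nat.cast_nonneg _
    have hNp : (0 : ℝ) < N := by linarith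
    have hcl : 1 / 4 + 1 / s ≤ centre i := by
      rw [centre, hs, add_le_add_iff_left, div_le_div_iff₀ (by positivity) (by positivity)]
      nlinarith
    have hcu : centre i ≤ 3 / 4 - 1 / s := by
      have : (2 * (i : ℕ) + 1 : ℝ) / (4 * N) ≤ 1 / 2 - 1 / s := by
        rw [hs, div_le_iff₀ (by positivity)]
        have : (1 / 2 - 1 / (16 * (N : ℝ))) * (4 * N) = 2 * N - 1 / 4 := by field_simp; ring
        rw [this]; linarith
      rw [centre]; linarith
    have hsp : 0 < 1 / s := by positivity
    -- The bump equals `1` on an interval of length `2/s`, where `v² ≥ 1/64`; so `I i ≥ 1/(32 s)`.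
    have h2 : ∫ x in (centre i - 1 / s)..(centre i + 1 / s), (1 / 64 : ℝ) ≤
        ∫ x in (centre i - 1 / s)..(centre i + 1 / s), F₀ (bumpCoord i x) * v x ^ 2 := by
      apply intervalIntegral.integral_mono_on (by linarith) (by simp)
        ((hlc i).intervalIntegrable _ _)
      intro x hx
      have hl : |bumpCoord i x| ≤ 1 := by
        rw [bumpCoord, ← hs, abs_mul, abs_of_pos (by linarith : 0 < s)]
        have : |x - centre i| ≤ 1 / s := abs_le.2 ⟨by linarith [hx.1], by linarith [hx.2]⟩
        calc s * |x - centre i| ≤ s * (1 / s) := mul_le_mul_of_nonneg_left this (by linarith)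
          _ = 1 := by field_simp
      rw [hone _ hl, one_mul]
      have : 1 / 8 ≤ v x := one_le_eight_mul_sin (by linarith [hx.1]) (by linarith [hx.2])
      nlinarith
    have h3 : ∫ x in (centre i - 1 / s)..(centre i + 1 / s), F₀ (bumpCoord i x) * v x ^ 2 ≤ I i :=
      intervalIntegral.integral_mono_interval (by linarith) (by linarith) (by linarith)
        (Eventually.of_forall fun x => mul_nonneg (hpos _) (sq_nonneg _))
        ((hlc i).intervalIntegrable _ _)
    rw [intervalIntegral.integral_const, smul_eq_mul] at h2
    have h4 : 1 / (32 * s) ≤ I i := by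
      refine le_trans (le_of_eq ?_) (h2.trans h3)
      field_simp; ring
    have h5 : 0 < I i := lt_of_lt_of_le (by positivity) h4
    calc 1 / (64 * M * s ^ 3) = c * (1 / (32 * s)) := by rw [hc]; field_simp; ring
      _ ≤ c * I i := mul_le_mul_of_nonneg_left h4 hc0.le
      _ ≤ c * I i / S := by
        rw [le_div_iff₀ hSpos]
        exact mul_le_of_le_one_right (by positivity) hSle
  · intro σ
    obtain ⟨hmem, hdev⟩ := fool_mem_classQ hM1 hF₂ h0 h1 hM hz hN σ
    obtain ⟨-, hm, y, dy, hy, hy1⟩ := exists_eigenpair hmem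
    obtain ⟨-, hexp⟩ := isShot_sine.expansion hy hκv
      (fun x hx => by
        have := hmem.2.1 x hx
        exact ⟨by linarith [this.2, hm.1], by linarith [this.1, hm.2]⟩) (by simp) hy1
      (R := 1 / (2 * s ^ 2)) (fun x _ => by rw [abs_sub_comm]; exact hdev x)
    have e1 : ∫ x in (0 : ℝ)..1, (1 / 2 - fool F₀ M σ x) * v x ^ 2 =
        -(c * ∑ i, sgn (σ i) * I i) := by
      have : ∀ x, (1 / 2 - fool F₀ M σ x) * v x ^ 2 =
          ∑ i, -(c * sgn (σ i)) * (F₀ (bumpCoord i x) * v x ^ 2) := by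
        intro x
        rw [fool, ← hs, ← hc, Finset.mul_sum, sub_add_cancel_left, ← Finset.sum_neg_distrib,
          Finset.sum_mul]
        exact Finset.sum_congr rfl fun i _ => by ring
      simp_rw [this]
      rw [intervalIntegral.integral_finsetSum fun i _ =>
        ((hlc i).intervalIntegrable _ _).const_mul _, Finset.mul_sum, ← Finset.sum_neg_distrib]
      refine Finset.sum_congr rfl fun i _ => ?_
      rw [intervalIntegral.integral_const_mul]
      simp only [hI]; ring
    set m := smallestEigenvalue (fool F₀ M σ)
    have e2 : (∑ i, c * I i / S * sgn (σ i)) * S = c * ∑ i, sgn (σ i) * I i := by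
      rw [Finset.sum_mul, Finset.mul_sum]
      refine Finset.sum_congr rfl fun i _ => ?_
      field_simp
    have e3 : (Real.pi ^ 2 + 1 / 2 - m) * S - -(c * ∑ i, sgn (σ i) * I i) =
        -(m - (Real.pi ^ 2 + 1 / 2 + ∑ i, c * I i / S * sgn (σ i))) * S := by
      rw [← e2]; ring
    change |(Real.pi ^ 2 + 1 / 2 - m) * S -
      ∫ x in (0 : ℝ)..1, (1 / 2 - fool F₀ M σ x) * v x ^ 2| ≤ _ at hexp
    rw [e1, e3, abs_mul, abs_neg, abs_of_pos hSpos] at hexp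
    have hB := solBound_pos
    calc _ ≤ 4 * solBound ^ 3 * (1 / (2 * s ^ 2)) ^ 2 / S := by rwa [le_div_iff₀ hSpos]
      _ ≤ 4 * solBound ^ 3 * (1 / (2 * s ^ 2)) ^ 2 / sqBound :=
        div_le_div_of_nonneg_left (by positivity) sqBound_pos hSlow
      _ = _ := by have := sqBound_pos.ne'; field_simp; ring

/-! ### The lower bound for methods with a trace of sample points -/

theorem fool_eq_of_agree {F : ℝ → ℝ} (hF : ∀ x, 2 < |x| → F x = 0) {M : ℝ} {N : ℕ}
    {σ τ : Fin N → Bool} {x : ℝ} (h : ∀ i, |bumpCoord i x| ≤ 2 → τ i = σ i) :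
    fool F M σ x = fool F M τ x := by
  unfold fool
  congr 2
  refine Finset.sum_congr rfl fun i _ => ?_
  by_cases hi : |bumpCoord i x| ≤ 2
  · rw [h i hi]
  · rw [hF _ (not_le.1 hi), mul_zero, mul_zero]

/-- Choosing for each seen bump a sample point inside it is injective. Since traces grow, a single
step `K` serves for the whole finite set. -/
theorem card_seen_le {N : ℕ} {T : ℕ → List ℝ} (hT : ∀ k, T k ⊆ T (k + 1)) {n : ℝ≥0∞}
    (hn : ∀ k, ((T k).length : ℝ≥0∞) ≤ n) (S : Finset (Fin N))
    (hS : ∀ i ∈ S, ∃ k, ∃ t ∈ T k, |bumpCoord i t| ≤ 2) : (S.card : ℝ≥0∞) ≤ n := by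
  classical
  have hmono : ∀ k l, k ≤ l → T k ⊆ T l := fun k l hkl => by
    induction hkl with
    | refl => exact List.Subset.refl _
    | step _ ih => exact List.Subset.trans ih (hT _)
  have hS' : ∀ i : Fin N, ∃ k, i ∈ S → ∃ t ∈ T k, |bumpCoord i t| ≤ 2 := fun i => by
    by_cases h : i ∈ S
    · obtain ⟨k, hk⟩ := hS i h; exact ⟨k, fun _ => hk⟩
    · exact ⟨0, fun h' => absurd h' h⟩
  choose k hk using hS'
  set K := S.sup k
  have hK : ∀ i : Fin N, ∃ t, i ∈ S → t ∈ T K ∧ |bumpCoord i t| ≤ 2 := fun i => by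
    by_cases h : i ∈ S
    · obtain ⟨t, ht, ht'⟩ := hk i h
      exact ⟨t, fun _ => ⟨hmono _ _ (Finset.le_sup h) ht, ht'⟩⟩
    · exact ⟨0, fun h' => absurd h' h⟩
  choose t ht using hK
  have : S.card ≤ (T K).toFinset.card := by
    refine Finset.card_le_card_of_injOn t (fun i hi => ?_) (fun i hi j hj hij => ?_)
    · exact List.mem_toFinset.2 (ht i hi).1
    · exact eq_of_local_le (ht i hi).2 (hij ▸ (ht j hj).2)
  refine le_trans ?_ (hn K)
  exact_mod_cast this.trans (List.toFinset_card_le _)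

/-- The main term has order `N · (N^(-3))² = N^(-5)`, the squared linearization error only `N^(-8)`.
-/
theorem error_constant_ge {M E : ℝ} (hM : 1 ≤ M) :
    ∃ c R : ℝ, 0 < c ∧ 0 < R ∧ ∀ N : ℝ, 1 ≤ N → R ≤ N →
      c / N ^ 5 ≤ (N / 4 * (1 / (64 * M * (16 * N) ^ 3)) ^ 2 - (E / (16 * N) ^ 4) ^ 2) / 2 := by
  set k₁ : ℝ := 1 / (4 * 64 ^ 2 * 16 ^ 6 * M ^ 2) with hk₁
  set k₂ : ℝ := E ^ 2 / 16 ^ 8 with hk₂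
  have h1 : 0 < k₁ := by rw [hk₁]; positivity
  have h2 : 0 ≤ k₂ := by rw [hk₂]; positivity
  refine ⟨k₁ / 4, 2 * k₂ / k₁ + 1, by positivity, by positivity, fun N hN hR => ?_⟩
  have e : (N / 4 * (1 / (64 * M * (16 * N) ^ 3)) ^ 2 - (E / (16 * N) ^ 4) ^ 2) / 2 =
      (k₁ - k₂ / N ^ 3) / N ^ 5 / 2 := by
    rw [hk₁, hk₂]
    have : M ≠ 0 := by linarith
    have : N ≠ 0 := by linarith
    field_simp
  have h3 : k₂ / N ^ 3 ≤ k₁ / 2 := by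
    rw [div_le_iff₀ (by positivity)]
    have h4 : 2 * k₂ / k₁ ≤ N := by linarith
    rw [div_le_iff₀ h1] at h4
    have h5 : N ≤ N ^ 3 := le_self_pow₀ hN (by norm_num)
    nlinarith
  rw [e, div_right_comm _ (N ^ 5) 2]
  exact div_le_div_of_nonneg_right (by linarith) (by positivity)

/-- A randomized method together with the lists of points at which it has sampled. -/
structure TraceMethod where
  Ω : Type
  mΩ : MeasurableSpace Ω
  P : Measure Ω
  isProb : IsProbabilityMeasure P
  cnt : (ℝ → ℝ) → Ω → ℝ≥0∞
  out : (ℝ → ℝ) → Ω → ℝ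
  trace : (ℝ → ℝ) → Ω → ℕ → List ℝ
  measurable_cnt : ∀ q ∈ classQ, Measurable (cnt q)
  measurable_out : ∀ q ∈ classQ, Measurable (out q)
  length_le : ∀ q ω k, ((trace q ω k).length : ℝ≥0∞) ≤ cnt q ω
  subset : ∀ q ω k, trace q ω k ⊆ trace q ω (k + 1)
  agree : ∀ q q' ω, (∀ k, ∀ t ∈ trace q ω k, q t = q' t) →
    (∀ k, trace q' ω k = trace q ω k) ∧ out q' ω = out q ω

theorem exists_lower_bound : ∃ α ε₀ : ℝ, 0 < α ∧ 0 < ε₀ ∧ ∀ ε : ℝ, 0 < ε → ε < ε₀ →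
    ∀ A : TraceMethod,
      (∀ q ∈ classQ, @lintegral A.Ω A.mΩ A.P (fun ω =>
        ENNReal.ofReal ((smallestEigenvalue q - A.out q ω) ^ 2)) ≤ ENNReal.ofReal (ε ^ 2)) →
      ∃ q ∈ classQ, ENNReal.ofReal (α * ε ^ (-(2 / 5) : ℝ)) ≤
        @lintegral A.Ω A.mΩ A.P (fun ω => A.cnt q ω) := by
  classical
  obtain ⟨F₀, F₁, F₂, M, hM1, hF₂, h0, h1, hM, hz, hpos, hone⟩ := exists_bump
  obtain ⟨c, R, hc, hR, hcR⟩ := error_constant_ge (E := solBound ^ 3 / sqBound) hM1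
  -- With `N` the floor of `β ε^(-2/5)` one gets `c / N^5 ≥ 2 ε² > ε²`, a contradiction to the error
  -- bound. The factor `1/8` in the constant is the `1/4` of the sign argument and a loss of `2` for
  -- the floor.
  set β : ℝ := (c / 2) ^ (1 / 5 : ℝ) with hβ
  have hβ0 : 0 < β := Real.rpow_pos_of_pos (by positivity) _
  have hβ5 : β ^ 5 = c / 2 := by
    rw [hβ, ← Real.rpow_natCast, ← Real.rpow_mul (by positivity)]; norm_num
  refine ⟨β / 8, Real.sqrt (c / 2 / (R + 2) ^ 5), by positivity,
    Real.sqrt_pos.2 (by positivity), ?_⟩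
  intro ε hε hε0 ⟨Ω, _, P, _, cnt, out, T, hcm, hom, hlen, hsub, hcons⟩ herr
  dsimp only at herr ⊢
  set e : ℝ := ε ^ (-(2 / 5) : ℝ) with he
  have he0 : 0 < e := Real.rpow_pos_of_pos hε _
  have he5 : e ^ 5 = (ε ^ 2)⁻¹ := by
    rw [he, ← Real.rpow_natCast, ← Real.rpow_mul hε.le,
      show (-(2 / 5) : ℝ) * ((5 : ℕ) : ℝ) = -((2 : ℕ) : ℝ) by norm_num, Real.rpow_neg hε.le,
      Real.rpow_natCast]
  have hX5 : (β * e) ^ 5 = c / 2 / ε ^ 2 := by rw [mul_pow, hβ5, he5]; ring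
  have hXR : R + 2 ≤ β * e := by
    refine le_of_lt (lt_of_pow_lt_pow_left₀ 5 (by positivity) ?_)
    rw [hX5, lt_div_iff₀ (by positivity)]
    have := (Real.lt_sqrt hε.le).1 hε0
    rw [lt_div_iff₀ (by positivity)] at this
    linarith
  set N : ℕ := ⌊β * e⌋₊ with hN
  have hNle : (N : ℝ) ≤ β * e := Nat.floor_le (by positivity)
  have hNge : β * e - 1 < N := Nat.sub_one_lt_floor _
  have hNR : R ≤ N := by linarith
  have hN1 : (1 : ℝ) ≤ N := by linarith
  have hNpos : 0 < N := by exact_mod_cast (by linarith : (0 : ℝ) < N)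
  have : Nonempty (Fin N) := ⟨⟨0, hNpos⟩⟩
  by_contra hno
  push Not at hno
  obtain ⟨a, ha, hL⟩ := fool_eigenvalue hM1 hF₂ h0 h1 hM hz hpos hone hNpos
  have hmem : ∀ σ : Fin N → Bool, fool F₀ M σ ∈ classQ := fun σ =>
    (fool_mem_classQ hM1 hF₂ h0 h1 hM hz hNpos σ).1
  obtain ⟨σ, hσ⟩ := exists_large_error P (cnt := fun σ => cnt (fool F₀ M σ))
    (out := fun σ => out (fool F₀ M σ))
    (seen := fun ω σ => Finset.univ.filter fun i => ∃ k, ∃ t ∈ T (fool F₀ M σ) ω k,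
      |bumpCoord i t| ≤ 2)
    (L := fun σ => smallestEigenvalue (fool F₀ M σ))
    (fun σ => hcm _ (hmem σ)) (fun σ => hom _ (hmem σ))
    (fun σ ω => card_seen_le (hsub _ ω) (hlen _ ω) _ (fun i hi => (Finset.mem_filter.1 hi).2))
    (fun ω σ τ h => by
      have := hcons (fool F₀ M σ) (fool F₀ M τ) ω (fun k t ht =>
        fool_eq_of_agree (fun x hx => (hz x hx).1) fun i hi =>
          h i (Finset.mem_filter.2 ⟨Finset.mem_univ _, k, t, ht, hi⟩))
      refine ⟨?_, this.2⟩
      simp only [this.1])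
    (by positivity) ha hL
    (fun σ => by
      refine (hno _ (hmem σ)).le.trans (ENNReal.ofReal_le_ofReal ?_)
      rw [Fintype.card_fin]
      linarith)
  have h2 := hσ.trans (herr _ (hmem σ))
  rw [ENNReal.ofReal_le_ofReal_iff (by positivity), Fintype.card_fin] at h2
  have h3 := (hcR N hN1 hNR).trans h2
  have h4 : (N : ℝ) ^ 5 ≤ c / 2 / ε ^ 2 := by
    rw [← hX5]; exact pow_le_pow_left₀ (by positivity) hNle 5
  rw [le_div_iff₀ (by positivity)] at h4
  rw [div_le_iff₀ (by positivity)] at h3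
  linarith

theorem lintegral_le_of_rpow_le {Ω : Type*} [MeasurableSpace Ω] {P : Measure Ω} {f : Ω → ℝ≥0∞}
    {ε : ℝ} (hε : 0 < ε) (h : (∫⁻ ω, f ω ∂P) ^ (1 / 2 : ℝ) ≤ ENNReal.ofReal ε) :
    ∫⁻ ω, f ω ∂P ≤ ENNReal.ofReal (ε ^ 2) := by
  have := ENNReal.rpow_le_rpow h (by norm_num : (0 : ℝ) ≤ 2)
  rw [← ENNReal.rpow_mul] at this
  norm_num at this
  rwa [ENNReal.ofReal_pow hε.le]

/-! ### Lower bound for the information complexity -/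

namespace RandAlg

theorem hist_eq_of_agree (A : RandAlg) {q q' : ℝ → ℝ} {ω : A.Ω}
    (h : ∀ k, ∀ t ∈ (A.hist q ω k).map (fun p => (p.1 : ℝ)), q t = q' t) (k : ℕ) :
    A.hist q' ω k = A.hist q ω k := by
  induction k with
  | zero => rfl
  | succ k ih =>
    rw [hist, hist, ih]
    by_cases hd : A.isDone ω (A.hist q ω k) = true
    · rw [if_pos hd, if_pos hd]
    · rw [if_neg hd, if_neg hd]
      have : q (A.point ω (A.hist q ω k)) = q' (A.point ω (A.hist q ω k)) := by
        refine h (k + 1) _ ?_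
        rw [hist, if_neg hd]
        simp
      rw [this]

/-- A randomized algorithm with its sample points. -/
noncomputable def toTraceMethod (A : RandAlg) (hA : A.IsMeasurable) : TraceMethod where
  Ω := A.Ω
  mΩ := A.mΩ
  P := A.P
  isProb := A.isProb
  cnt := A.count
  out := A.output
  trace q ω k := (A.hist q ω k).map fun p => (p.1 : ℝ)
  measurable_cnt q hq := (hA q hq).2.1
  measurable_out q hq := (hA q hq).2.2
  length_le q ω k := by
    rw [List.length_map]
    exact le_iSup (fun k => ((A.hist q ω k).length : ℝ≥0∞)) k
  subset q ω k := by
    rw [show A.hist q ω (k + 1) = _ from rfl, hist]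
    split_ifs
    · exact List.Subset.refl _
    · rw [List.map_append]; exact List.subset_append_left _ _
  agree q q' ω h := by
    have e := funext (A.hist_eq_of_agree h)
    refine ⟨fun k => by rw [e], ?_⟩
    have key : ∀ H, A.hist q' ω = H → A.output q' ω = (open Classical in
        if h : ∃ k, A.isDone ω (H k) = true then A.out ω (H (Nat.find h)) else 0) := by
      rintro _ rfl; rfl
    rw [key _ e]; rfl

theorem lintegral_sq_le (A : RandAlg) {ε : ℝ} (hε : 0 < ε) (herr : A.error ≤ ENNReal.ofReal ε)
    {q : ℝ → ℝ} (hq : q ∈ classQ) :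
    @lintegral A.Ω A.mΩ A.P (fun ω => ENNReal.ofReal ((smallestEigenvalue q - A.output q ω) ^ 2))
      ≤ ENNReal.ofReal (ε ^ 2) := by
  let _ := A.mΩ
  exact lintegral_le_of_rpow_le hε (le_trans (le_iSup₂
    (f := fun q (_ : q ∈ classQ) => (∫⁻ ω, ENNReal.ofReal
      ((smallestEigenvalue q - A.output q ω) ^ 2) ∂A.P) ^ (1 / 2 : ℝ)) q hq) herr)

theorem le_card (A : RandAlg) {q : ℝ → ℝ} (hq : q ∈ classQ) :
    @lintegral A.Ω A.mΩ A.P (fun ω => A.count q ω) ≤ A.card :=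
  le_iSup₂ (f := fun q (_ : q ∈ classQ) => @lintegral A.Ω A.mΩ A.P (fun ω => A.count q ω)) q hq

end RandAlg

/-! ### Lower bound for programs -/

namespace RandProgram

/-- Selection by a random natural number: the program counter, the number of draws, or an index
register used for indirect addressing. Countability of the index set gives joint measurability. -/
theorem measurable_of_pc {Ω β : Type*} [MeasurableSpace Ω] [MeasurableSpace β] {p : Ω → ℕ}
    (hp : Measurable p) {f : ℕ → Ω → β} (hf : ∀ n, Measurable (f n)) :
    Measurable fun ω => f (p ω) ω := by
  have h : Measurable (Function.uncurry f) := measurable_from_prod_countable_right hf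
  exact h.comp (hp.prodMk measurable_id)

theorem measurable_update {Ω β : Type*} [MeasurableSpace Ω] [MeasurableSpace β]
    {r : Ω → ℕ → β} (hr : Measurable r) {d : Ω → ℕ} (hd : Measurable d) {v : Ω → β}
    (hv : Measurable v) : Measurable fun ω => Function.update (r ω) (d ω) (v ω) := by
  refine measurable_pi_iff.2 fun i => ?_
  simp only [Function.update_apply]
  exact Measurable.ite (measurableSet_eq_fun measurable_const hd) hv ((measurable_pi_apply i).comp hr)

/-- All parts of a random configuration are random variables. -/
structure MeasurableConfig {Ω : Type*} [MeasurableSpace Ω] (s : Ω → Config) : Prop where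
  pc : Measurable fun ω => (s ω).pc
  reg : Measurable fun ω => (s ω).reg
  idx : Measurable fun ω => (s ω).idx
  draws : Measurable fun ω => (s ω).draws
  queries : Measurable fun ω => (s ω).queries

theorem measurable_elemFun (f : ElemFun) : Measurable f.eval := by
  cases f
  · exact measurable_id.abs
  · exact Real.continuous_sqrt.measurable
  · exact Real.measurable_exp
  · exact Real.measurable_log
  · exact Real.measurable_sin
  · exact Real.measurable_cos
  · exact Real.measurable_arctan

theorem measurable_arithOp {Ω : Type*} [MeasurableSpace Ω] (o : ArithOp) {x y : Ω → ℝ}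
    (hx : Measurable x) (hy : Measurable y) : Measurable fun ω => o.eval (x ω) (y ω) := by
  cases o
  · exact hx.add hy
  · exact hx.sub hy
  · exact hx.mul hy
  · exact hx.div hy

theorem MeasurableConfig.exec {Ω : Type*} [MeasurableSpace Ω] {s : Ω → Config}
    (h : MeasurableConfig s) {q : ℝ → ℝ}
    (hq : Measurable fun x : ℝ => q (projIcc (0 : ℝ) 1 zero_le_one x)) {ξ : ℕ → Ω → ℝ}
    (hξ : ∀ k, Measurable (ξ k)) (i : Instr) :
    MeasurableConfig fun ω => i.exec q (fun k => ξ k ω) (s ω) := by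
  obtain ⟨hpc, hreg, hidx, hdr, hqu⟩ := h
  have hr : ∀ a, Measurable fun ω => (s ω).reg a := fun a => (measurable_pi_apply a).comp hreg
  have hj : ∀ a, Measurable fun ω => (s ω).idx a := fun a => (measurable_pi_apply a).comp hidx
  have hpc1 : Measurable fun ω => (s ω).pc + 1 := hpc.add_const 1
  have hqu1 : Measurable fun ω => (s ω).queries + 1 := hqu.add_const 1
  have hdr1 : Measurable fun ω => (s ω).draws + 1 := hdr.add_const 1
  have upd : ∀ (d : ℕ) (v : Ω → ℝ), Measurable v →
      Measurable fun ω => Function.update (s ω).reg d (v ω) := fun d v hv =>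
    measurable_update hreg measurable_const hv
  have updj : ∀ (d : ℕ) (v : Ω → ℕ), Measurable v →
      Measurable fun ω => Function.update (s ω).idx d (v ω) := fun d v hv =>
    measurable_update hidx measurable_const hv
  cases i with
  | const d x => exact ⟨hpc1, upd _ _ measurable_const, hidx, hdr, hqu⟩
  | copy d a => exact ⟨hpc1, upd _ _ (hr a), hidx, hdr, hqu⟩
  | arith o d a b => exact ⟨hpc1, upd _ _ (measurable_arithOp o (hr a) (hr b)), hidx, hdr, hqu⟩
  | elem f d a => exact ⟨hpc1, upd _ _ ((measurable_elemFun f).comp (hr a)), hidx, hdr, hqu⟩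
  | query d a => exact ⟨hpc1, upd _ _ (hq.comp (hr a)), hidx, hdr, hqu1⟩
  | rand d => exact ⟨hpc1, upd _ _ (measurable_of_pc hdr hξ), hidx, hdr1, hqu⟩
  | load d k =>
    exact ⟨hpc1, upd _ _ (measurable_of_pc (hj k) (f := fun n ω => (s ω).reg n) hr), hidx, hdr, hqu⟩
  | store k a => exact ⟨hpc1, measurable_update hreg (hj k) (hr a), hidx, hdr, hqu⟩
  | idxConst k n => exact ⟨hpc1, hreg, updj _ _ measurable_const, hdr, hqu⟩
  | idxAdd k l m => exact ⟨hpc1, hreg, updj _ _ ((hj l).add (hj m)), hdr, hqu⟩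
  | idxSub k l m => exact ⟨hpc1, hreg, updj _ _ ((hj l).sub (hj m)), hdr, hqu⟩
  | jumpLE a b p =>
    exact ⟨Measurable.ite (measurableSet_le (hr a) (hr b)) measurable_const hpc1, hreg, hidx, hdr,
      hqu⟩
  | jumpIdxLE k l p =>
    exact ⟨Measurable.ite (measurableSet_le (hj k) (hj l)) measurable_const hpc1, hreg, hidx, hdr,
      hqu⟩

theorem measurableConfig_run (A : RandProgram) {q : ℝ → ℝ}
    (hq : Measurable fun x : ℝ => q (projIcc (0 : ℝ) 1 zero_le_one x)) (k : ℕ) :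
    @MeasurableConfig A.Ω A.mΩ fun ω => A.run q ω k := by
  let _ := A.mΩ
  induction k with
  | zero => exact ⟨measurable_const, measurable_const, measurable_const, measurable_const,
      measurable_const⟩
  | succ k ih =>
    have key : ∀ n : ℕ, MeasurableConfig fun ω => match A.code[n]? with
        | some i => Instr.exec q (fun k => A.ξ k ω) (A.run q ω k) i
        | none => A.run q ω k := by
      intro n
      cases A.code[n]? with
      | none => exact ih
      | some i => exact ih.exec hq A.measurable_ξ i
    exact ⟨measurable_of_pc ih.pc fun n => (key n).pc, measurable_of_pc ih.pc fun n => (key n).reg,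
      measurable_of_pc ih.pc fun n => (key n).idx, measurable_of_pc ih.pc fun n => (key n).draws,
      measurable_of_pc ih.pc fun n => (key n).queries⟩

theorem run_eq_of_halted (A : RandProgram) {q : ℝ → ℝ} {ω : A.Ω} {k l : ℕ} (hkl : k ≤ l)
    (h : A.HaltedAt q ω k) : A.run q ω l = A.run q ω k := by
  induction hkl with
  | refl => rfl
  | @step l _ ih =>
    rw [run, ih, step]
    have : A.code[(A.run q ω k).pc]? = none := List.getElem?_eq_none h
    rw [this]

theorem output_eq_of_halted (A : RandProgram) {q : ℝ → ℝ} {ω : A.Ω} {k : ℕ}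
    (h : A.HaltedAt q ω k) : A.output q ω = (A.run q ω k).reg 0 := by
  classical
  have h' : ∃ k, A.HaltedAt q ω k := ⟨k, h⟩
  rw [output, dif_pos h', A.run_eq_of_halted (Nat.find_le h) (Nat.find_spec h')]

/-- The output is the pointwise limit of the outputs truncated at step `k`: these are eventually
constant on halting runs and zero on the others. -/
theorem measurable_output (A : RandProgram) {q : ℝ → ℝ}
    (hq : Measurable fun x : ℝ => q (projIcc (0 : ℝ) 1 zero_le_one x)) :
    @Measurable A.Ω ℝ A.mΩ _ (A.output q) := by
  classical
  let _ := A.mΩ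
  refine measurable_of_tendsto_metrizable (f := fun k ω =>
    if A.HaltedAt q ω k then (A.run q ω k).reg 0 else 0) (fun k => ?_) ?_
  · have h := A.measurableConfig_run hq k
    exact Measurable.ite (measurableSet_le measurable_const h.pc)
      ((measurable_pi_apply 0).comp h.reg) measurable_const
  · rw [tendsto_pi_nhds]
    intro ω
    refine tendsto_const_nhds.congr' ?_
    by_cases h : ∃ k, A.HaltedAt q ω k
    · obtain ⟨k, hk⟩ := h
      filter_upwards [eventually_ge_atTop k] with l hl
      have hl' : A.HaltedAt q ω l := by
        unfold HaltedAt; rw [A.run_eq_of_halted hl hk]; exact hk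
      rw [if_pos hl', A.output_eq_of_halted hl']
    · refine Eventually.of_forall fun l => ?_
      dsimp only
      rw [if_neg fun hl => h ⟨l, hl⟩, output, dif_neg h]

/-- The points at which a program has evaluated `q` in its first `k` steps. -/
noncomputable def queried (A : RandProgram) (q : ℝ → ℝ) (ω : A.Ω) : ℕ → List ℝ
  | 0 => []
  | k + 1 =>
    match A.code[(A.run q ω k).pc]? with
    | some (.query _ a) =>
      A.queried q ω k ++ [(projIcc (0 : ℝ) 1 zero_le_one ((A.run q ω k).reg a) : ℝ)]
    | _ => A.queried q ω k

theorem length_queried (A : RandProgram) (q : ℝ → ℝ) (ω : A.Ω) (k : ℕ) :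
    (A.queried q ω k).length = (A.run q ω k).queries := by
  induction k with
  | zero => rfl
  | succ k ih =>
    rw [queried, run, step]
    cases A.code[(A.run q ω k).pc]? with
    | none => exact ih
    | some i => cases i <;> simp [Instr.exec, ih]

theorem queried_subset (A : RandProgram) (q : ℝ → ℝ) (ω : A.Ω) (k : ℕ) :
    A.queried q ω k ⊆ A.queried q ω (k + 1) := by
  rw [show A.queried q ω (k + 1) = _ from rfl, queried]
  split
  · exact List.subset_append_left _ _
  · exact List.Subset.refl _

theorem run_eq_of_agree (A : RandProgram) {q q' : ℝ → ℝ} {ω : A.Ω}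
    (h : ∀ k, ∀ t ∈ A.queried q ω k, q t = q' t) (k : ℕ) :
    A.run q' ω k = A.run q ω k ∧ A.queried q' ω k = A.queried q ω k := by
  induction k with
  | zero => exact ⟨rfl, rfl⟩
  | succ k ih =>
    have hk := h (k + 1)
    rw [queried] at hk
    rw [run, run, queried, queried, step, step, ih.1, ih.2]
    cases hi : A.code[(A.run q ω k).pc]? with
    | none => exact ⟨rfl, rfl⟩
    | some i =>
      cases i <;> refine ⟨?_, rfl⟩ <;> try rfl
      rw [hi] at hk
      have := hk _ (List.mem_append_right _ (List.mem_singleton_self _))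
      simp only [Instr.exec, this]

/-- A program with its sample points. -/
noncomputable def toTraceMethod (A : RandProgram) : TraceMethod where
  Ω := A.Ω
  mΩ := A.mΩ
  P := A.P
  isProb := A.isProb
  cnt := A.count
  out := A.output
  trace := A.queried
  measurable_cnt q hq := by
    let _ := A.mΩ
    exact Measurable.iSup fun k => measurable_from_top.comp (A.measurableConfig_run
      (continuous_comp_projIcc (classQ_continuousOn hq)).measurable k).queries
  measurable_out q hq :=
    A.measurable_output (continuous_comp_projIcc (classQ_continuousOn hq)).measurable
  length_le q ω k := by
    rw [A.length_queried]
    exact le_iSup (fun k => ((A.run q ω k).queries : ℝ≥0∞)) k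
  subset := A.queried_subset
  agree q q' ω h := by
    have e : A.run q' ω = A.run q ω := funext fun k => (A.run_eq_of_agree h k).1
    refine ⟨fun k => (A.run_eq_of_agree h k).2, ?_⟩
    have e' : ∀ k, A.HaltedAt q' ω k ↔ A.HaltedAt q ω k := fun k => by
      unfold HaltedAt; rw [e]
    by_cases hk : ∃ k, A.HaltedAt q ω k
    · obtain ⟨k, hk⟩ := hk
      rw [A.output_eq_of_halted hk, A.output_eq_of_halted ((e' k).2 hk), e]
    · rw [output, output, dif_neg hk, dif_neg fun ⟨k, hk'⟩ => hk ⟨k, (e' k).1 hk'⟩]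

theorem lintegral_sq_le (A : RandProgram) {ε : ℝ} (hε : 0 < ε) (herr : A.error ≤ ENNReal.ofReal ε)
    {q : ℝ → ℝ} (hq : q ∈ classQ) :
    @lintegral A.Ω A.mΩ A.P (fun ω => ENNReal.ofReal ((smallestEigenvalue q - A.output q ω) ^ 2))
      ≤ ENNReal.ofReal (ε ^ 2) := by
  let _ := A.mΩ
  exact lintegral_le_of_rpow_le hε (le_trans (le_iSup₂
    (f := fun q (_ : q ∈ classQ) => (∫⁻ ω, ENNReal.ofReal
      ((smallestEigenvalue q - A.output q ω) ^ 2) ∂A.P) ^ (1 / 2 : ℝ)) q hq) herr)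

/-- Drop the other operations and bound the first moment by the second (Hölder's inequality with the
constant `1`). No measurability of `opCount` is needed. -/
theorem le_cost (A : RandProgram) (c : ℝ) {q : ℝ → ℝ} (hq : q ∈ classQ) :
    ENNReal.ofReal c * @lintegral A.Ω A.mΩ A.P (fun ω => A.count q ω) ≤ A.cost c := by
  let _ := A.mΩ
  have := A.isProb
  have hm : Measurable (A.count q) := A.toTraceMethod.measurable_cnt q hq
  refine le_trans ?_ (le_iSup₂ (f := fun q (_ : q ∈ classQ) => (∫⁻ ω,
    (ENNReal.ofReal c * A.count q ω + A.opCount q ω) ^ 2 ∂A.P) ^ (1 / 2 : ℝ)) q hq)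
  have h1 := ENNReal.lintegral_mul_le_Lp_mul_Lq A.P (p := 2) (q := 2)
    (Real.holderConjugate_iff.2 ⟨by norm_num, by norm_num⟩)
    (hm.const_mul (ENNReal.ofReal c)).aemeasurable (measurable_const (a := (1 : ℝ≥0∞))).aemeasurable
  simp only [Pi.mul_apply, mul_one, ENNReal.one_rpow, lintegral_const, measure_univ] at h1
  rw [lintegral_const_mul _ hm] at h1
  refine h1.trans (ENNReal.rpow_le_rpow (lintegral_mono fun ω => ?_) (by norm_num))
  rw [ENNReal.rpow_ofNat]
  exact pow_le_pow_left₀ zero_le le_self_add 2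

end RandProgram

/-! ### Exact solution for step potentials -/

namespace SolOn

variable {κ κ₁ κ₂ y₁ dy₁ y₂ dy₂ : ℝ → ℝ} {a b c : ℝ}

/-- Two solutions on adjacent intervals that match at the common end point. -/
theorem glue (hab : a ≤ b) (hbc : b ≤ c) (h₁ : SolOn κ a b y₁ dy₁) (h₂ : SolOn κ b c y₂ dy₂)
    (hy : y₁ b = y₂ b) (hdy : dy₁ b = dy₂ b) :
    SolOn κ a c (fun x => if x < b then y₁ x else y₂ x) (fun x => if x < b then dy₁ x else dy₂ x) := by
  have hcont : ∀ {f g : ℝ → ℝ}, ContinuousOn f (Icc a b) → ContinuousOn g (Icc b c) → f b = g b →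
      ContinuousOn (fun x => if x < b then f x else g x) (Icc a c) := by
    intro f g hf hg hfg
    rw [← Icc_union_Icc_eq_Icc hab hbc]
    refine ContinuousOn.union_of_isClosed ?_ ?_ isClosed_Icc isClosed_Icc
    · refine hf.congr fun x hx => ?_
      rcases eq_or_lt_of_le hx.2 with rfl | h
      · simp [hfg]
      · simp [h]
    · exact hg.congr fun x hx => by simp [not_lt.2 hx.1]
  have hder : ∀ {f g f' g' : ℝ → ℝ}, (∀ x ∈ Ico a b, HasDerivWithinAt f (f' x) (Ici x) x) →
      (∀ x ∈ Ico b c, HasDerivWithinAt g (g' x) (Ici x) x) → ∀ x ∈ Ico a c,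
      HasDerivWithinAt (fun x => if x < b then f x else g x) (if x < b then f' x else g' x)
        (Ici x) x := by
    intro f g f' g' hf hg x hx
    by_cases h : x < b
    · rw [if_pos h]
      refine (hf x ⟨hx.1, h⟩).congr_of_eventuallyEq ?_ (by simp [h])
      filter_upwards [mem_nhdsWithin_of_mem_nhds (Iio_mem_nhds h)] with t ht
      exact if_pos ht
    · rw [if_neg h]
      refine (hg x ⟨not_lt.1 h, hx.2⟩).congr (fun t ht => ?_) (by simp [h])
      exact if_neg (not_lt.2 ((not_lt.1 h).trans ht))
  refine ⟨h₁.int.trans h₂.int, hcont h₁.cont h₂.cont hy, hcont h₁.cont' h₂.cont' hdy,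
    hder h₁.deriv h₂.deriv, fun x hx => ?_⟩
  refine (hder h₁.deriv' h₂.deriv' x hx).congr_deriv ?_
  split_ifs <;> rfl

/-- The solution for a constant coefficient. -/
theorem const_coeff {w : ℝ} (hw : w ≠ 0) (Y D : ℝ) (hab : a ≤ b) :
    SolOn (fun _ => w ^ 2) a b
      (fun x => Y * Real.cos (w * (x - a)) + D * Real.sin (w * (x - a)) / w)
      (fun x => D * Real.cos (w * (x - a)) - Y * (w * Real.sin (w * (x - a)))) := by
  have h0 : ∀ x, HasDerivAt (fun x : ℝ => w * (x - a)) w x := fun x => by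
    simpa using ((hasDerivAt_id x).sub_const a).const_mul w
  apply of_hasDerivAt continuousOn_const hab
  · intro x _
    exact (((h0 x).cos.const_mul Y).add (((h0 x).sin.const_mul D).div_const w)).congr_deriv
      (by field_simp; ring)
  · intro x _
    exact (((h0 x).cos.const_mul D).sub (((h0 x).sin.const_mul w).const_mul Y)).congr_deriv
      (by field_simp; ring)

end SolOn

/-- One step of the exact solution: coefficient `κ = w²`, step size `τ`. -/
noncomputable def cellStep (τ κ : ℝ) (u : ℝ × ℝ) : ℝ × ℝ :=
  (u.1 * Real.cos (√κ * τ) + u.2 * Real.sin (√κ * τ) / √κ,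
    u.2 * Real.cos (√κ * τ) - u.1 * (√κ * Real.sin (√κ * τ)))

/-- The solution and its derivative after `l` steps with potential values `P`. -/
noncomputable def cellIter (τ : ℝ) (P : ℕ → ℝ) (μ : ℝ) : ℕ → ℝ × ℝ
  | 0 => (0, 1)
  | l + 1 => cellStep τ (μ - P l) (cellIter τ P μ l)

/-- The step function with values `P` on `m` cells of `[0,1]`. -/
noncomputable def stepFun (m : ℕ) (P : ℕ → ℝ) (x : ℝ) : ℝ := P (min ⌊(m : ℝ) * x⌋₊ (m - 1))

theorem stepFun_eq {m : ℕ} {P : ℕ → ℝ} {l : ℕ} (hl : l < m) {x : ℝ}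
    (hx : x ∈ Ico ((l : ℝ) / m) ((l + 1 : ℕ) / m)) : stepFun m P x = P l := by
  have hm : (0 : ℝ) < m := by exact_mod_cast (Nat.zero_le l).trans_lt hl
  have h1 : (l : ℝ) ≤ m * x := by
    have := hx.1; rw [div_le_iff₀ hm] at this; linarith
  have h2 : (m : ℝ) * x < l + 1 := by
    have := hx.2; rw [lt_div_iff₀ hm] at this; push_cast at this; linarith
  have h3 : ⌊(m : ℝ) * x⌋₊ = l := by
    rw [Nat.floor_eq_iff ((Nat.cast_nonneg l).trans h1)]; exact ⟨h1, h2⟩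
  rw [stepFun, h3, min_eq_left (by omega)]

/-- On every cell the coefficient is a positive constant, so gluing the trigonometric solutions of
`SolOn.const_coeff` shows that `cellIter` computes the shooting solution exactly. -/
theorem exists_solOn_stepFun {m : ℕ} {P : ℕ → ℝ} {μ : ℝ}
    (hP : ∀ l < m, P l < μ) {l : ℕ} (hl : l ≤ m) :
    ∃ y dy, SolOn (fun x => μ - stepFun m P x) 0 (l / m) y dy ∧ y 0 = 0 ∧ dy 0 = 1 ∧
      y (l / m) = (cellIter (1 / m) P μ l).1 ∧ dy (l / m) = (cellIter (1 / m) P μ l).2 := by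
  induction l with
  | zero =>
    refine ⟨fun _ => 0, fun _ => 1, ⟨by simp, continuousOn_const, continuousOn_const, ?_, ?_⟩,
      rfl, rfl, rfl, rfl⟩ <;> simp
  | succ l ih =>
    obtain ⟨y, dy, hy, hy0, hdy0, hyl, hdyl⟩ := ih (by omega)
    have hm : (0 : ℝ) < m := by exact_mod_cast (Nat.zero_le l).trans_lt hl
    have hκ : 0 < μ - P l := sub_pos.2 (hP l hl)
    have hw : √(μ - P l) ≠ 0 := (Real.sqrt_pos.2 hκ).ne'
    have hll : (l : ℝ) / m ≤ (l + 1 : ℕ) / m :=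
      div_le_div_of_nonneg_right (by push_cast; linarith) hm.le
    have h0l : (0 : ℝ) ≤ l / m := by positivity
    have hc := (SolOn.const_coeff hw (cellIter (1 / m) P μ l).1 (cellIter (1 / m) P μ l).2 hll)
    rw [Real.sq_sqrt hκ.le] at hc
    have hc' := hc.congr (κ₂ := fun x => μ - stepFun m P x) hll fun x hx => by rw [stepFun_eq hl hx]
    have hg := SolOn.glue h0l hll hy hc' (by simp [hyl]) (by simp [hdyl])
    have hnlt : ¬ (((l + 1 : ℕ) : ℝ) / m < l / m) := not_lt.2 hll
    have hdiff : ((l + 1 : ℕ) : ℝ) / m - l / m = 1 / m := by push_cast; ring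
    refine ⟨_, _, hg, ?_, ?_, ?_, ?_⟩
    -- For `l = 0` the gluing point is `0` itself, which belongs to the second branch.
    · rcases eq_or_lt_of_le h0l with h | h
      · rw [if_neg (by rw [← h]; exact lt_irrefl _), ← h]
        simp only [sub_self, mul_zero, Real.cos_zero, Real.sin_zero, mul_one, zero_div, add_zero]
        rw [← hyl, ← h, hy0]
      · rw [if_pos h, hy0]
    · rcases eq_or_lt_of_le h0l with h | h
      · rw [if_neg (by rw [← h]; exact lt_irrefl _), ← h]
        simp only [sub_self, mul_zero, Real.cos_zero, Real.sin_zero, mul_one, sub_zero]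
        rw [← hdyl, ← h, hdy0]
      · rw [if_pos h, hdy0]
    · rw [if_neg hnlt, hdiff]; rfl
    · rw [if_neg hnlt, hdiff]; rfl

theorem exists_shot_stepFun {m : ℕ} (hm : 0 < m) {P : ℕ → ℝ} {μ : ℝ} (hP : ∀ l < m, P l < μ) :
    ∃ y dy, IsShot (fun x => μ - stepFun m P x) y dy ∧ y 1 = (cellIter (1 / m) P μ m).1 := by
  obtain ⟨y, dy, h, h0, h1, h2, -⟩ := exists_solOn_stepFun hP le_rfl
  have e : (m : ℝ) / m = 1 := div_self (by exact_mod_cast hm.ne')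
  rw [e] at h h2
  exact ⟨y, dy, ⟨h, h0, h1⟩, h2⟩

/-! ### Bisection -/

/-- Bisection on `[8,12]` with the sign of `G`. -/
noncomputable def bisect (G : ℝ → ℝ) : ℕ → ℝ
  | 0 => 10
  | j + 1 => bisect G j + 2 / 2 ^ (j + 1) * (G (bisect G j) / |G (bisect G j)|)

/-- The quotient `G / |G|` is the sign, obtained without a comparison, so that the program needs no
jump. The convention `0 / 0 = 0` makes an exact zero a fixed point, which is the first alternative
of the invariant. -/
theorem bisect_spec {G : ℝ → ℝ} (h8 : 0 ≤ G 8) (h12 : G 12 ≤ 0) (j : ℕ) :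
    8 ≤ bisect G j - 2 / 2 ^ j ∧ bisect G j + 2 / 2 ^ j ≤ 12 ∧
      (G (bisect G j) = 0 ∨ (0 ≤ G (bisect G j - 2 / 2 ^ j) ∧ G (bisect G j + 2 / 2 ^ j) ≤ 0)) := by
  induction j with
  | zero =>
    have e1 : bisect G 0 - 2 / 2 ^ 0 = 8 := by rw [bisect]; norm_num
    have e2 : bisect G 0 + 2 / 2 ^ 0 = 12 := by rw [bisect]; norm_num
    rw [e1, e2]
    exact ⟨le_rfl, le_rfl, Or.inr ⟨h8, h12⟩⟩
  | succ j ih =>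
    obtain ⟨hl, hr, h⟩ := ih
    have hw : (2 : ℝ) / 2 ^ j = 2 / 2 ^ (j + 1) + 2 / 2 ^ (j + 1) := by
      rw [pow_succ]; field_simp; ring
    have hw0 : (0 : ℝ) < 2 / 2 ^ (j + 1) := by positivity
    rw [hw] at hl hr h
    rw [bisect]
    set x := bisect G j
    set w : ℝ := 2 / 2 ^ (j + 1)
    rcases lt_trichotomy (G x) 0 with hG | hG | hG
    · rw [abs_of_neg hG, div_neg, div_self hG.ne]
      refine ⟨by linarith, by linarith, Or.inr ?_⟩
      rcases h with h | h
      · exact absurd h hG.ne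
      · refine ⟨?_, ?_⟩
        · rw [show x + w * -1 - w = x - (w + w) by ring]; exact h.1
        · rw [show x + w * -1 + w = x by ring]; exact hG.le
    · rw [hG, zero_div, mul_zero, add_zero]
      exact ⟨by linarith, by linarith, Or.inl hG⟩
    · rw [abs_of_pos hG, div_self hG.ne']
      refine ⟨by linarith, by linarith, Or.inr ?_⟩
      rcases h with h | h
      · exact absurd h hG.ne'
      · refine ⟨?_, ?_⟩
        · rw [show x + w * 1 - w = x by ring]; exact hG.le
        · rw [show x + w * 1 + w = x + (w + w) by ring]; exact h.2

/-- The output of the bisection for a step potential. -/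
noncomputable def stepEigenvalue (m : ℕ) (P : ℕ → ℝ) (J : ℕ) : ℝ :=
  bisect (fun μ => (cellIter (1 / m) P μ m).1) J

theorem stepFun_bound {m : ℕ} (hm : 0 < m) {P : ℕ → ℝ}
    (hP : ∀ l < m, -(1 / 2) ≤ P l ∧ P l ≤ 3 / 2) (x : ℝ) :
    -(1 / 2) ≤ stepFun m P x ∧ stepFun m P x ≤ 3 / 2 :=
  hP _ (lt_of_le_of_lt (min_le_right _ _) (by omega))

/-- The bracket left by bisection contains a parameter `μ` for which shooting hits zero exactly.
Perturbation theory is then applied to `μ`, and the bisection error is added afterwards. -/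
theorem exists_near_stepEigenvalue {m : ℕ} (hm : 0 < m) {P : ℕ → ℝ}
    (hP : ∀ l < m, -(1 / 2) ≤ P l ∧ P l ≤ 3 / 2) (J : ℕ) :
    ∃ μ ∈ Icc (8 : ℝ) 12, |stepEigenvalue m P J - μ| ≤ 2 / 2 ^ J ∧
      ∃ y dy, IsShot (fun x => μ - stepFun m P x) y dy ∧ y 1 = 0 := by
  have hex : ∀ μ : ℝ, ∃ y dy, μ ∈ Icc (8 : ℝ) 12 →
      (IsShot (fun x => μ - stepFun m P x) y dy ∧ y 1 = (cellIter (1 / m) P μ m).1) := by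
    intro μ
    by_cases hμ : μ ∈ Icc (8 : ℝ) 12
    · obtain ⟨y, dy, h⟩ := exists_shot_stepFun hm (P := P) (μ := μ)
        fun l hl => by linarith [(hP l hl).2, hμ.1]
      exact ⟨y, dy, fun _ => h⟩
    · exact ⟨0, 0, fun h => absurd h hμ⟩
  choose Y dY hY using hex
  have hb : ∀ x ∈ Icc (0 : ℝ) 1, -(1 / 2) ≤ stepFun m P x ∧ stepFun m P x ≤ 3 / 2 :=
    fun x _ => stepFun_bound hm hP x
  set G : ℝ → ℝ := fun μ => (cellIter (1 / m) P μ m).1 with hG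
  have hGY : ∀ μ ∈ Icc (8 : ℝ) 12, G μ = Y μ 1 := fun μ hμ => (hY μ hμ).2.symm
  have m8 : (8 : ℝ) ∈ Icc (8 : ℝ) 12 := ⟨le_rfl, by norm_num⟩
  have m12 : (12 : ℝ) ∈ Icc (8 : ℝ) 12 := ⟨by norm_num, le_rfl⟩
  have h8 : 0 ≤ G 8 := by rw [hGY 8 m8]; exact (IsShot.sign_eight hb (hY 8 m8).1).le
  have h12 : G 12 ≤ 0 := by rw [hGY 12 m12]; exact (IsShot.sign_twelve hb (hY 12 m12).1).le
  obtain ⟨hl, hr, h⟩ := bisect_spec h8 h12 J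
  have hw : (0 : ℝ) ≤ 2 / 2 ^ J := by positivity
  have hS : stepEigenvalue m P J = bisect G J := rfl
  rw [hS]
  set x := bisect G J
  have hxm : x ∈ Icc (8 : ℝ) 12 := ⟨by linarith, by linarith⟩
  rcases h with h | h
  · exact ⟨x, hxm, by simpa using hw, Y x, dY x, (hY x hxm).1, by rw [← hGY x hxm, h]⟩
  · have ml : x - 2 / 2 ^ J ∈ Icc (8 : ℝ) 12 := ⟨hl, by linarith⟩
    have mr : x + 2 / 2 ^ J ∈ Icc (8 : ℝ) 12 := ⟨by linarith, hr⟩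
    obtain ⟨μ, hμ, hμ0⟩ := IsShot.exists_zero hb (fun μ hμ => (hY μ hμ).1) hl (by linarith) hr
      (by rw [← hGY _ ml]; exact h.1) (by rw [← hGY _ mr]; exact h.2)
    have hμm : μ ∈ Icc (8 : ℝ) 12 := ⟨hl.trans hμ.1, hμ.2.trans hr⟩
    exact ⟨μ, hμm, abs_le.2 ⟨by linarith [hμ.2], by linarith [hμ.1]⟩, Y μ, dY μ, (hY μ hμm).1, hμ0⟩

/-! ### Smoothness of the inputs -/

theorem classQ_bounds {q : ℝ → ℝ} (hq : q ∈ classQ) :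
    (∀ x ∈ Ioo (0 : ℝ) 1, HasDerivAt q (derivWithin q (Icc 0 1) x) x) ∧
    (∀ x ∈ Icc (0 : ℝ) 1, |derivWithin q (Icc 0 1) x| ≤ 1) ∧
    ∀ x ∈ Icc (0 : ℝ) 1, ∀ y ∈ Icc (0 : ℝ) 1,
      |derivWithin q (Icc 0 1) x - derivWithin q (Icc 0 1) y| ≤ |x - y| := by
  have hU : UniqueDiffOn ℝ (Icc (0 : ℝ) 1) := uniqueDiffOn_Icc one_pos
  obtain ⟨hC, -, hb⟩ := hq
  have hC' := hC
  rw [show (2 : WithTop ℕ∞) = 1 + 1 by norm_num, contDiffOn_succ_iff_derivWithin hU] at hC'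
  obtain ⟨hd, -, hd1⟩ := hC'
  refine ⟨fun x hx => ?_, fun x hx => ?_, fun x hx y hy => ?_⟩
  · exact ((hd x ⟨hx.1.le, hx.2.le⟩).hasDerivWithinAt).hasDerivAt (Icc_mem_nhds hx.1 hx.2)
  · have := hb 1 one_le_two x hx
    rwa [iteratedDerivWithin_one] at this
  · have := (convex_Icc (0 : ℝ) 1).norm_image_sub_le_of_norm_derivWithin_le (C := 1)
      (hd1.differentiableOn one_ne_zero) (fun z hz => ?_) hy hx
    · simpa using this
    · have := hb 2 le_rfl z hz
      rwa [iteratedDerivWithin_succ, iteratedDerivWithin_one] at this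

/-- The deviation of `q` from a line of slope `β`. -/
def offLine (q : ℝ → ℝ) (β x : ℝ) : ℝ := q x - β * x

theorem classQ_lipschitz {q : ℝ → ℝ} (hq : q ∈ classQ) {x y : ℝ} (hx : x ∈ Icc (0 : ℝ) 1)
    (hy : y ∈ Icc (0 : ℝ) 1) : |q x - q y| ≤ |x - y| := by
  have := (convex_Icc (0 : ℝ) 1).norm_image_sub_le_of_norm_derivWithin_le (C := 1)
    (hq.1.differentiableOn two_ne_zero) (classQ_bounds hq).2.1 hy hx
  simpa using this

/-- The secant slope equals `q'(c)` for some `c` in the cell, and `q'` is Lipschitz with constant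
`1`; so the derivative of the deviation is at most `b - a`. -/
theorem offLine_sub_le {q : ℝ → ℝ} (hq : q ∈ classQ) {a b : ℝ} (ha : 0 ≤ a) (hab : a < b)
    (hb : b ≤ 1) {x y : ℝ} (hx : x ∈ Icc a b) (hy : y ∈ Icc a b) :
    |offLine q ((q b - q a) / (b - a)) x - offLine q ((q b - q a) / (b - a)) y| ≤
      (b - a) ^ 2 := by
  obtain ⟨h1, h2, h3⟩ := classQ_bounds hq
  have hsub : Icc a b ⊆ Icc (0 : ℝ) 1 := Icc_subset_Icc ha hb
  have hcont := (classQ_continuousOn hq).mono hsub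
  have hd : ∀ x ∈ Ioo a b, HasDerivAt q (derivWithin q (Icc 0 1) x) x := fun x hx =>
    h1 x ⟨ha.trans_lt hx.1, hx.2.trans_le hb⟩
  obtain ⟨c, hc, hβ⟩ := exists_hasDerivAt_eq_slope q _ hab hcont hd
  rw [← hβ]
  have key := (convex_Icc a b).norm_image_sub_le_of_norm_hasDerivWithin_le
    (f := offLine q (derivWithin q (Icc 0 1) c))
    (f' := fun t => derivWithin q (Icc 0 1) t - derivWithin q (Icc 0 1) c) (C := b - a)
    (fun t ht => by
      have := ((hq.1.differentiableOn two_ne_zero t (hsub ht)).hasDerivWithinAt.mono hsub).sub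
        ((hasDerivWithinAt_id t (Icc a b)).const_mul (derivWithin q (Icc 0 1) c))
      rw [mul_one] at this
      exact this)
    (fun t ht => (h3 t (hsub ht) c (hsub ⟨hc.1.le, hc.2.le⟩)).trans
      (abs_le.2 ⟨by linarith [ht.1, hc.2], by linarith [ht.2, hc.1]⟩)) hy hx
  refine key.trans ?_
  rw [sq]
  exact mul_le_mul_of_nonneg_left (abs_le.2 ⟨by linarith [hx.1, hy.2], by linarith [hx.2, hy.1]⟩)
    (by linarith)

theorem continuousOn_offLine {q : ℝ → ℝ} (hq : q ∈ classQ) (β : ℝ) :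
    ContinuousOn (offLine q β) (Icc 0 1) :=
  (classQ_continuousOn hq).sub (continuousOn_const.mul continuousOn_id)

/-! ### The random step potential -/

/-- Difference of `q` over the cell with index `i`. -/
noncomputable def cellDiff (q : ℝ → ℝ) (n i : ℕ) : ℝ := q ((i + 1) / n) - q (i / n)

/-- The value at the left end of the cell of the line with the secant slope through the sample. -/
noncomputable def cellLeft (q : ℝ → ℝ) (n i : ℕ) (s : ℝ) : ℝ :=
  q ((i + s) / n) - s * cellDiff q n i

/-- Values of a piecewise linear function at the midpoints of `k` subcells per cell. -/
noncomputable def cellPot (k : ℕ) (A B : ℕ → ℝ) (l : ℕ) : ℝ :=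
  A (l / k) + B (l / k) * ((((l % k : ℕ) : ℝ) + 1 / 2) / k)

theorem cell_mem {n : ℕ} (hn : 0 < n) (i : ℕ) {s : ℝ} (hs : s ∈ Icc (0 : ℝ) 1) :
    (i + s) / n ∈ Icc ((i : ℝ) / n) ((i + 1) / n) := by
  have hn' : (0 : ℝ) < n := by exact_mod_cast hn
  exact ⟨div_le_div_of_nonneg_right (by linarith [hs.1]) hn'.le,
    div_le_div_of_nonneg_right (by linarith [hs.2]) hn'.le⟩

theorem cell_le {n : ℕ} (hn : 0 < n) {i : ℕ} (hi : i < n) :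
    (0 : ℝ) ≤ i / n ∧ (i : ℝ) / n < (i + 1) / n ∧
    ((i : ℝ) + 1) / n ≤ 1 := by
  have hn' : (0 : ℝ) < n := by exact_mod_cast hn
  have hi' : (i : ℝ) + 1 ≤ n := by exact_mod_cast hi
  exact ⟨by positivity, div_lt_div_of_pos_right (by linarith) hn', by rwa [div_le_one hn']⟩

theorem abs_cellDiff_le {q : ℝ → ℝ} (hq : q ∈ classQ) {n : ℕ} (hn : 0 < n) {i : ℕ}
    (hi : i < n) : |cellDiff q n i| ≤ 1 / n := by
  obtain ⟨h0, h1, h2⟩ := cell_le hn hi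
  refine (classQ_lipschitz hq ⟨h0.trans h1.le, h2⟩ ⟨h0, h1.le.trans h2⟩).trans (le_of_eq ?_)
  rw [abs_of_pos (by linarith)]; ring

theorem abs_offLine_le {q : ℝ → ℝ} (hq : q ∈ classQ) {n : ℕ} (hn : 0 < n)
    {i : ℕ} (hi : i < n) {x y : ℝ}
    (hx : x ∈ Icc ((i : ℝ) / n) ((i + 1) / n)) (hy : y ∈ Icc ((i : ℝ) / n) ((i + 1) / n)) :
    |offLine q (n * cellDiff q n i) x - offLine q (n * cellDiff q n i) y| ≤ 1 / n ^ 2 := by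
  obtain ⟨h0, h1, h2⟩ := cell_le hn hi
  have hn' : (0 : ℝ) < n := by exact_mod_cast hn
  have := offLine_sub_le hq h0 h1 h2 hx hy
  have e : ((i : ℝ) + 1) / n - i / n = 1 / n := by ring
  rw [e, div_div_eq_mul_div, div_one, mul_comm, div_pow, one_pow] at this
  exact this

theorem subcell_mem {n k : ℕ} (hn : 0 < n) (hk : 0 < k) {l : ℕ} {x : ℝ}
    (hx : x ∈ Icc ((l : ℝ) / (n * k : ℕ)) ((l + 1 : ℕ) / (n * k : ℕ))) :
    x ∈ Icc (((l / k : ℕ) : ℝ) / n) (((l / k : ℕ) + 1) / n) := by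
  have hn' : (0 : ℝ) < n := by exact_mod_cast hn
  have hk' : (0 : ℝ) < k := by exact_mod_cast hk
  have h1 : l / k * k ≤ l := Nat.div_mul_le_self l k
  have h2 : l + 1 ≤ (l / k + 1) * k := Nat.lt_div_mul_add hk |>.trans_eq (by ring)
  have h1' : ((l / k : ℕ) : ℝ) * k ≤ l := by exact_mod_cast h1
  have h2' : (l : ℝ) + 1 ≤ ((l / k : ℕ) + 1) * k := by exact_mod_cast h2
  push_cast at hx
  constructor
  · refine le_trans ?_ hx.1
    rw [div_le_div_iff₀ hn' (by positivity)]; nlinarith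
  · refine hx.2.trans ?_
    rw [div_le_div_iff₀ (by positivity) hn']; nlinarith

/-- Decomposition of the error of the step potential on a subcell. -/
theorem sub_cellPot (q : ℝ → ℝ) {n k : ℕ} (hn : 0 < n) (hk : 0 < k) {s : ℕ → ℝ} {l : ℕ} (x : ℝ) :
    q x - cellPot k (fun i => cellLeft q n i (s i)) (cellDiff q n) l =
      (offLine q (n * cellDiff q n (l / k)) x -
        offLine q (n * cellDiff q n (l / k)) (((l / k : ℕ) + s (l / k)) / n)) +
      n * cellDiff q n (l / k) * (x - (l + 1 / 2) / (n * k : ℕ)) := by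
  have hn' : (n : ℝ) ≠ 0 := by exact_mod_cast hn.ne'
  have hk' : (k : ℝ) ≠ 0 := by exact_mod_cast hk.ne'
  have hl : (l : ℝ) = k * ((l / k : ℕ) : ℝ) + ((l % k : ℕ) : ℝ) := by
    exact_mod_cast (Nat.div_add_mod l k).symm
  rw [cellPot, cellLeft, offLine, offLine, hl]
  push_cast
  field_simp
  ring

/-- The first term is the deviation of `q` from the line in the cell, the second the replacement of
a line of slope at most `1` by its value at the midpoint of the subcell. -/
theorem abs_sub_cellPot_le {q : ℝ → ℝ} (hq : q ∈ classQ) {n k : ℕ} (hn : 0 < n)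
    (hk : 0 < k) {s : ℕ → ℝ} (hs : ∀ i, s i ∈ Icc (0 : ℝ) 1) {l : ℕ} (hl : l < n * k)
    {x : ℝ} (hx : x ∈ Icc ((l : ℝ) / (n * k : ℕ)) ((l + 1 : ℕ) / (n * k : ℕ))) :
    |q x - cellPot k (fun i => cellLeft q n i (s i)) (cellDiff q n) l| ≤
      1 / n ^ 2 + 1 / (n * k : ℕ) := by
  have hn' : (0 : ℝ) < n := by exact_mod_cast hn
  have hm' : (0 : ℝ) < (n * k : ℕ) := by exact_mod_cast Nat.mul_pos hn hk
  have hi : l / k < n := Nat.div_lt_of_lt_mul (by rwa [mul_comm])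
  rw [sub_cellPot q hn hk (s := s)]
  refine (abs_add_le _ _).trans (add_le_add ?_ ?_)
  · exact abs_offLine_le hq hn hi (subcell_mem hn hk hx) (cell_mem hn _ (hs _))
  · have h1 := abs_cellDiff_le hq hn hi
    rw [le_div_iff₀ hn'] at h1
    rw [abs_mul, abs_mul, abs_of_pos hn']
    have h2 : |x - (l + 1 / 2) / (n * k : ℕ)| ≤ 1 / (n * k : ℕ) := by
      have e1 : ((l : ℝ) + 1 / 2) / (n * k : ℕ) = l / (n * k : ℕ) + 1 / 2 * (1 / (n * k : ℕ)) := by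
        ring
      have e2 : ((l + 1 : ℕ) : ℝ) / (n * k : ℕ) = l / (n * k : ℕ) + 1 / (n * k : ℕ) := by
        push_cast; ring
      have h3 : (0 : ℝ) < 1 / (n * k : ℕ) := by positivity
      rw [e2] at hx
      rw [e1]
      exact abs_le.2 ⟨by linarith [hx.1], by linarith [hx.2]⟩
    calc _ ≤ 1 * (1 / ((n * k : ℕ) : ℝ)) :=
          mul_le_mul (by linarith) h2 (abs_nonneg _) zero_le_one
      _ = _ := one_mul _

/-- For `n ≥ 4` both error terms are at most `1/4`, so the approximation stays in the range for
which `[8, 12]` is a bracket. -/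
theorem cellPot_bound {q : ℝ → ℝ} (hq : q ∈ classQ) {n k : ℕ} (hn : 0 < n)
    (hk : 0 < k) (hn2 : 4 ≤ n) {s : ℕ → ℝ} (hs : ∀ i, s i ∈ Icc (0 : ℝ) 1) {l : ℕ}
    (hl : l < n * k) :
    -(1 / 2) ≤ cellPot k (fun i => cellLeft q n i (s i)) (cellDiff q n) l ∧
      cellPot k (fun i => cellLeft q n i (s i)) (cellDiff q n) l ≤ 3 / 2 := by
  have hn4 : (4 : ℝ) ≤ n := by exact_mod_cast hn2
  have hk1 : (1 : ℝ) ≤ k := by exact_mod_cast hk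
  have hm' : (0 : ℝ) < (n * k : ℕ) := by exact_mod_cast Nat.mul_pos hn hk
  have hll : (l : ℝ) / (n * k : ℕ) ≤ (l + 1 : ℕ) / (n * k : ℕ) :=
    div_le_div_of_nonneg_right (by push_cast; linarith) hm'.le
  have h := abs_sub_cellPot_le hq hn hk hs hl (x := l / (n * k : ℕ)) ⟨le_rfl, hll⟩
  have h1 : (1 : ℝ) / n ^ 2 ≤ 1 / 4 := one_div_le_one_div_of_le (by norm_num) (by nlinarith)
  have h2 : (1 : ℝ) / (n * k : ℕ) ≤ 1 / 4 :=
    one_div_le_one_div_of_le (by norm_num) (by push_cast; nlinarith)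
  have h3 := hq.2.1 (l / (n * k : ℕ)) ⟨by positivity, by
    rw [div_le_one hm']; exact_mod_cast hl.le⟩
  have h4 := abs_le.1 (h.trans (add_le_add h1 h2))
  exact ⟨by linarith [h3.1], by linarith [h3.2]⟩

theorem abs_sub_stepFun_le {q : ℝ → ℝ} (hq : q ∈ classQ) {n k : ℕ} (hn : 0 < n)
    (hk : 0 < k) {s : ℕ → ℝ} (hs : ∀ i, s i ∈ Icc (0 : ℝ) 1) {x : ℝ}
    (hx : x ∈ Icc (0 : ℝ) 1) :
    |q x - stepFun (n * k) (cellPot k (fun i => cellLeft q n i (s i)) (cellDiff q n)) x| ≤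
      1 / n ^ 2 + 1 / (n * k : ℕ) := by
  have hm : 0 < n * k := Nat.mul_pos hn hk
  have hm' : (0 : ℝ) < (n * k : ℕ) := by exact_mod_cast hm
  have hmx : 0 ≤ ((n * k : ℕ) : ℝ) * x := mul_nonneg hm'.le hx.1
  refine abs_sub_cellPot_le hq hn hk hs (lt_of_le_of_lt (min_le_right _ _) (by omega)) ⟨?_, ?_⟩
  · rw [div_le_iff₀ hm', mul_comm x]
    refine le_trans ?_ (Nat.floor_le hmx)
    exact_mod_cast min_le_left _ _
  · rw [le_div_iff₀ hm', mul_comm x]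
    rcases le_total ⌊((n * k : ℕ) : ℝ) * x⌋₊ (n * k - 1) with h | h
    · rw [min_eq_left h]; push_cast; exact (Nat.lt_floor_add_one _).le
    · rw [min_eq_right h, Nat.sub_add_cancel hm]
      exact mul_le_of_le_one_right hm'.le hx.2

/-! ### Errors of the cells -/

theorem intervalIntegrable_of_unit {f : ℝ → ℝ} (hf : ContinuousOn f (Icc 0 1)) {a b : ℝ}
    (ha : 0 ≤ a) (hab : a ≤ b) (hb : b ≤ 1) : IntervalIntegrable f volume a b :=
  (hf.mono (Icc_subset_Icc ha hb)).intervalIntegrable_of_Icc hab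

/-- The contribution of a cell to the first order error with weight `w`. -/
noncomputable def cellErr (q w : ℝ → ℝ) (n i : ℕ) (s : ℝ) : ℝ :=
  (∫ x in (i / n : ℝ)..((i + 1) / n), offLine q (n * cellDiff q n i) x * w x) -
    offLine q (n * cellDiff q n i) ((i + s) / n) * ∫ x in (i / n : ℝ)..((i + 1) / n), w x

theorem cellErr_eq {q w : ℝ → ℝ} (hq : q ∈ classQ) (hw : ContinuousOn w (Icc 0 1)) {n i : ℕ}
    (hn : 0 < n) (hi : i < n) (s : ℝ) :
    cellErr q w n i s = ∫ x in (i / n : ℝ)..((i + 1) / n), (offLine q (n * cellDiff q n i) x -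
      offLine q (n * cellDiff q n i) ((i + s) / n)) * w x := by
  obtain ⟨h0, h1, h2⟩ := cell_le hn hi
  rw [cellErr, ← intervalIntegral.integral_const_mul, ← intervalIntegral.integral_sub]
  · simp only [sub_mul]
  · exact intervalIntegrable_of_unit ((continuousOn_offLine hq _).mul hw) h0 h1.le h2
  · exact (intervalIntegrable_of_unit hw h0 h1.le h2).const_mul _

theorem abs_cellErr_le {q w : ℝ → ℝ} (hq : q ∈ classQ) (hw : ContinuousOn w (Icc 0 1)) {b : ℝ}
    (hb : ∀ x ∈ Icc (0 : ℝ) 1, |w x| ≤ b) {n i : ℕ} (hn : 0 < n) (hi : i < n) {s : ℝ}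
    (hs : s ∈ Icc (0 : ℝ) 1) : |cellErr q w n i s| ≤ b / n ^ 3 := by
  obtain ⟨h0, h1, h2⟩ := cell_le hn hi
  rw [cellErr_eq hq hw hn hi]
  have := intervalIntegral.norm_integral_le_of_norm_le_const (a := (i / n : ℝ)) (b := (i + 1) / n)
    (f := fun x => (offLine q (n * cellDiff q n i) x -
      offLine q (n * cellDiff q n i) ((i + s) / n)) * w x) (C := 1 / n ^ 2 * b) (fun x hx => by
      rw [uIoc_of_le h1.le] at hx
      rw [Real.norm_eq_abs, abs_mul]
      exact mul_le_mul (abs_offLine_le hq hn hi ⟨hx.1.le, hx.2⟩ (cell_mem hn i hs))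
        (hb x ⟨h0.trans hx.1.le, hx.2.trans h2⟩) (abs_nonneg _) (by positivity))
  refine this.trans (le_of_eq ?_)
  have e : ((i : ℝ) + 1) / n - i / n = 1 / n := by ring
  rw [e, abs_of_nonneg (by positivity)]
  ring

theorem continuousOn_cellErr {q w : ℝ → ℝ} (hq : q ∈ classQ) {n i : ℕ} (hn : 0 < n) (hi : i < n) :
    ContinuousOn (cellErr q w n i) (Icc 0 1) := by
  obtain ⟨h0, -, h2⟩ := cell_le hn hi
  refine continuousOn_const.sub (ContinuousOn.mul ?_ continuousOn_const)
  refine (continuousOn_offLine hq _).comp (by fun_prop) fun s hs => ?_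
  have := cell_mem hn i hs
  exact ⟨h0.trans this.1, this.2.trans h2⟩

/-- For a constant weight a uniform sample is unbiased. Only the variation of `w` over the cell, at
most `L/n`, contributes to the mean; this gains one power of `n` over `abs_cellErr_le`. -/
theorem abs_integral_cellErr_le {q w : ℝ → ℝ} (hq : q ∈ classQ) (hw : ContinuousOn w (Icc 0 1))
    {L : ℝ} (hL : ∀ x ∈ Icc (0 : ℝ) 1, ∀ y ∈ Icc (0 : ℝ) 1, |w x - w y| ≤ L * |x - y|) {n i : ℕ}
    (hn : 0 < n) (hi : i < n) : |∫ s in (0 : ℝ)..1, cellErr q w n i s| ≤ L / n ^ 4 := by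
  obtain ⟨h0, h1, h2⟩ := cell_le hn hi
  have hn' : (0 : ℝ) < n := by exact_mod_cast hn
  have hL0 : 0 ≤ L := by
    have := (abs_nonneg _).trans (hL 0 ⟨le_rfl, zero_le_one⟩ 1 ⟨zero_le_one, le_rfl⟩)
    simpa using this
  set g := offLine q (n * cellDiff q n i) with hg
  have hgc : ContinuousOn g (Icc 0 1) := continuousOn_offLine hq _
  have e : ((i : ℝ) + 1) / n - i / n = 1 / n := by ring
  set c := w (i / n)
  have hgt : ContinuousOn (fun s : ℝ => g ((i + s) / n)) (Icc 0 1) := by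
    refine hgc.comp (by fun_prop) fun s hs => ?_
    have := cell_mem hn i hs
    exact ⟨h0.trans this.1, this.2.trans h2⟩
  have hmean : ∫ s in (0 : ℝ)..1, ((∫ x in (i / n : ℝ)..((i + 1) / n), g x) -
      g ((i + s) / n) * (1 / n)) = 0 := by
    rw [intervalIntegral.integral_sub (by simp)
      ((intervalIntegrable_of_unit hgt le_rfl zero_le_one le_rfl).mul_const _),
      intervalIntegral.integral_mul_const]
    have h3 := intervalIntegral.integral_comp_add_div (a := 0) (b := 1) g hn'.ne' (i / n : ℝ)
    have h4 : ∀ s : ℝ, (i / n : ℝ) + s / n = (i + s) / n := fun s => by ring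
    simp only [h4, add_zero, smul_eq_mul] at h3
    rw [h3]
    simp only [intervalIntegral.integral_const, sub_zero, one_smul]
    field_simp
    simp
  have hsplit : ∀ s ∈ Icc (0 : ℝ) 1, cellErr q w n i s - c * ((∫ x in (i / n : ℝ)..((i + 1) / n), g x) -
      g ((i + s) / n) * (1 / n)) =
      ∫ x in (i / n : ℝ)..((i + 1) / n), (g x - g ((i + s) / n)) * (w x - c) := by
    intro s _
    have i1 : IntervalIntegrable (fun x => g x * w x) volume (i / n) ((i + 1) / n) :=
      intervalIntegrable_of_unit (hgc.mul hw) h0 h1.le h2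
    have i2 : IntervalIntegrable (fun x => g ((i + s) / n) * w x) volume (i / n) ((i + 1) / n) :=
      (intervalIntegrable_of_unit hw h0 h1.le h2).const_mul _
    have i3 : IntervalIntegrable (fun x => c * g x) volume (i / n) ((i + 1) / n) :=
      (intervalIntegrable_of_unit hgc h0 h1.le h2).const_mul _
    have i4 : IntervalIntegrable (fun _ => c * g ((i + s) / n)) volume (i / n : ℝ) ((i + 1) / n) :=
      _root_.intervalIntegrable_const
    have i5 : IntervalIntegrable (fun x => g x * w x - g ((i + s) / n) * w x) volume
        (i / n) ((i + 1) / n) := i1.sub i2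
    have i6 : IntervalIntegrable (fun x => c * g x - c * g ((i + s) / n)) volume
        (i / n) ((i + 1) / n) := i3.sub i4
    have e5 : ∀ x, (g x - g ((i + s) / n)) * (w x - c) =
        (g x * w x - g ((i + s) / n) * w x) - (c * g x - c * g ((i + s) / n)) := fun x => by ring
    simp only [e5]
    rw [intervalIntegral.integral_sub i5 i6, intervalIntegral.integral_sub i1 i2,
      intervalIntegral.integral_sub i3 i4,
      intervalIntegral.integral_const_mul, intervalIntegral.integral_const_mul,
      intervalIntegral.integral_const, e, cellErr, smul_eq_mul]
    ring
  have hi1 : IntervalIntegrable (cellErr q w n i) volume 0 1 :=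
    intervalIntegrable_of_unit (continuousOn_cellErr hq hn hi) le_rfl zero_le_one le_rfl
  have hi2 : IntervalIntegrable (fun s : ℝ => c * ((∫ x in (i / n : ℝ)..((i + 1) / n), g x) -
      g ((i + s) / n) * (1 / n))) volume 0 1 :=
    intervalIntegrable_of_unit (continuousOn_const.mul (continuousOn_const.sub
      (hgt.mul continuousOn_const))) le_rfl zero_le_one le_rfl
  have h5 : ∫ s in (0 : ℝ)..1, cellErr q w n i s = ∫ s in (0 : ℝ)..1, (cellErr q w n i s -
      c * ((∫ x in (i / n : ℝ)..((i + 1) / n), g x) - g ((i + s) / n) * (1 / n))) := by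
    rw [intervalIntegral.integral_sub hi1 hi2, intervalIntegral.integral_const_mul, hmean,
      mul_zero, sub_zero]
  rw [h5]
  have := intervalIntegral.norm_integral_le_of_norm_le_const (a := (0 : ℝ)) (b := 1)
    (f := fun s => cellErr q w n i s -
      c * ((∫ x in (i / n : ℝ)..((i + 1) / n), g x) - g ((i + s) / n) * (1 / n)))
    (C := L / n ^ 4) (fun s hs => by
      rw [uIoc_of_le zero_le_one] at hs
      have hs' : s ∈ Icc (0 : ℝ) 1 := ⟨hs.1.le, hs.2⟩
      rw [hsplit s hs']
      have h6 := intervalIntegral.norm_integral_le_of_norm_le_const (a := (i / n : ℝ))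
        (b := (i + 1) / n) (f := fun x => (g x - g ((i + s) / n)) * (w x - c))
        (C := 1 / n ^ 2 * (L * (1 / n))) (fun x hx => by
          rw [uIoc_of_le h1.le] at hx
          rw [Real.norm_eq_abs, abs_mul]
          refine mul_le_mul (abs_offLine_le hq hn hi ⟨hx.1.le, hx.2⟩ (cell_mem hn i hs')) ?_
            (abs_nonneg _) (by positivity)
          refine (hL x ⟨h0.trans hx.1.le, hx.2.trans h2⟩ _ ⟨h0, h1.le.trans h2⟩).trans ?_
          refine mul_le_mul_of_nonneg_left ?_ hL0
          rw [abs_of_pos (by linarith [hx.1])]; linarith [hx.2])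
      refine h6.trans (le_of_eq ?_)
      rw [e, abs_of_nonneg (by positivity)]; ring)
  simpa using this

theorem sum_range_mul_eq {n k : ℕ} (hk : 0 < k) (F : ℕ → ℕ → ℝ) :
    ∑ l ∈ Finset.range (n * k), F (l / k) l =
      ∑ i ∈ Finset.range n, ∑ j ∈ Finset.range k, F i (i * k + j) := by
  induction n with
  | zero => simp
  | succ n ih =>
    rw [Finset.sum_range_succ, ← ih, Nat.succ_mul, Finset.sum_range_add]
    congr 1
    refine Finset.sum_congr rfl fun j hj => ?_
    rw [Nat.add_comm (n * k), Nat.add_mul_div_right _ _ hk,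
      Nat.div_eq_of_lt (Finset.mem_range.1 hj), zero_add]

/-- The first order error is the sum of the errors of the cells up to `O(m⁻²)`. -/
theorem integral_sub_stepFun {q w : ℝ → ℝ} (hq : q ∈ classQ) (hw : ContinuousOn w (Icc 0 1))
    {L : ℝ} (hL : ∀ x ∈ Icc (0 : ℝ) 1, ∀ y ∈ Icc (0 : ℝ) 1, |w x - w y| ≤ L * |x - y|)
    {n k : ℕ} (hn : 0 < n) (hk : 0 < k) {s : ℕ → ℝ}
    (hint : IntervalIntegrable (fun x => (q x - stepFun (n * k)
      (cellPot k (fun i => cellLeft q n i (s i)) (cellDiff q n)) x) * w x) volume 0 1) :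
    |(∫ x in (0 : ℝ)..1, (q x - stepFun (n * k)
      (cellPot k (fun i => cellLeft q n i (s i)) (cellDiff q n)) x) * w x) -
      ∑ i ∈ Finset.range n, cellErr q w n i (s i)| ≤ L / (n * k : ℕ) ^ 2 := by
  set m := n * k with hm
  have hm0 : 0 < m := Nat.mul_pos hn hk
  have hm' : (0 : ℝ) < m := by exact_mod_cast hm0
  have hn' : (0 : ℝ) < n := by exact_mod_cast hn
  have hk' : (0 : ℝ) < k := by exact_mod_cast hk
  have hL0 : 0 ≤ L := by
    have := (abs_nonneg _).trans (hL 0 ⟨le_rfl, zero_le_one⟩ 1 ⟨zero_le_one, le_rfl⟩)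
    simpa using this
  set P := cellPot k (fun i => cellLeft q n i (s i)) (cellDiff q n) with hP
  set G : ℕ → ℝ → ℝ := fun i x => (offLine q (n * cellDiff q n i) x -
      offLine q (n * cellDiff q n i) ((i + s i) / n)) * w x with hG
  have hGc : ∀ i, ContinuousOn (G i) (Icc 0 1) := fun i =>
    ((continuousOn_offLine hq _).sub continuousOn_const).mul hw
  set z : ℕ → ℝ := fun l => (l + 1 / 2) / m with hz
  set H : ℕ → ℝ → ℝ := fun l x => n * cellDiff q n (l / k) * (x - z l) * w x with hH
  have hHc : ∀ l, ContinuousOn (H l) (Icc 0 1) := fun l => by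
    simp only [hH]; exact ContinuousOn.mul (by fun_prop) hw
  set a : ℕ → ℝ := fun l => l / m with ha
  have ha0 : ∀ l, 0 ≤ a l := fun l => by simp only [ha]; positivity
  have hastep : ∀ l, a (l + 1) - a l = 1 / m := fun l => by simp only [ha]; push_cast; ring
  have hale : ∀ l, a l ≤ a (l + 1) := fun l => by
    have := hastep l
    have : (0 : ℝ) < 1 / m := by positivity
    linarith
  have ha1 : ∀ l < m, a (l + 1) ≤ 1 := fun l hl => by
    simp only [ha]; rw [div_le_one hm']; exact_mod_cast hl
  have hsum0 : ∑ l ∈ Finset.range m, ∫ x in a l..a (l + 1), (q x - stepFun m P x) * w x =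
      ∫ x in (0 : ℝ)..1, (q x - stepFun m P x) * w x := by
    rw [intervalIntegral.sum_integral_adjacent_intervals]
    · simp only [ha, Nat.cast_zero, zero_div, div_self hm'.ne']
    · intro l hl
      refine hint.mono_set ?_
      rw [uIcc_of_le (hale l), uIcc_of_le zero_le_one]
      exact Icc_subset_Icc (ha0 l) (ha1 l hl)
  have hcell : ∀ l < m, ∫ x in a l..a (l + 1), (q x - stepFun m P x) * w x =
      (∫ x in a l..a (l + 1), G (l / k) x) + ∫ x in a l..a (l + 1), H l x := by
    intro l hl
    rw [← intervalIntegral.integral_add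
      (intervalIntegrable_of_unit (hGc _) (ha0 l) (hale l) (ha1 l hl))
      (intervalIntegrable_of_unit (hHc _) (ha0 l) (hale l) (ha1 l hl))]
    -- At the right end point of a cell `stepFun` may already have the next value, so the integrands
    -- are compared on the open cell.
    rw [intervalIntegral.integral_of_le (hale l), intervalIntegral.integral_of_le (hale l),
      integral_Ioc_eq_integral_Ioo, integral_Ioc_eq_integral_Ioo]
    refine setIntegral_congr_fun measurableSet_Ioo fun x hx => ?_
    simp only [hG, hH, hz]
    rw [stepFun_eq hl ⟨hx.1.le, hx.2⟩, hP, sub_cellPot q hn hk]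
    ring
  have hcoarse : ∑ l ∈ Finset.range m, ∫ x in a l..a (l + 1), G (l / k) x =
      ∑ i ∈ Finset.range n, cellErr q w n i (s i) := by
    rw [hm, sum_range_mul_eq hk (fun i l => ∫ x in a l..a (l + 1), G i x)]
    refine Finset.sum_congr rfl fun i hi => ?_
    have hi' := Finset.mem_range.1 hi
    rw [cellErr_eq hq hw hn hi']
    have := intervalIntegral.sum_integral_adjacent_intervals (f := G i) (μ := volume)
      (a := fun j => a (i * k + j)) (n := k) (fun j hj => by
        have : i * k + j < m := by
          calc i * k + j < i * k + k := by omega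
            _ = (i + 1) * k := by ring
            _ ≤ n * k := Nat.mul_le_mul_right k hi'
        exact intervalIntegrable_of_unit (hGc i) (ha0 _) (hale _) (ha1 _ this))
    have e1 : a (i * k) = i / n := by simp only [ha, hm]; push_cast; field_simp
    have e2 : a (i * k + k) = (i + 1) / n := by simp only [ha, hm]; push_cast; field_simp
    simp only [add_zero, e1, e2] at this
    exact this
  have hfine : ∀ l ∈ Finset.range m, |∫ x in a l..a (l + 1), H l x| ≤ L / m ^ 3 := by
    intro l hl
    have hl' := Finset.mem_range.1 hl
    have hi : l / k < n := Nat.div_lt_of_lt_mul (by rw [mul_comm]; exact hl')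
    have hβ := abs_cellDiff_le hq hn hi
    rw [le_div_iff₀ hn'] at hβ
    have hzl : z l = a l + 1 / 2 * (1 / m) := by simp only [hz, ha]; ring
    have h1m : (0 : ℝ) < 1 / m := by positivity
    have hst := hastep l
    have hzm : z l ∈ Icc (0 : ℝ) 1 := by
      have := ha0 l; have := ha1 l hl'
      exact ⟨by linarith, by linarith⟩
    -- `x - z l` is odd about the midpoint of the subcell, so only the variation of `w` remains.
    -- Each subcell contributes `L/m³`, and `m` of them give `L/m²`.
    have hodd : ∫ x in a l..a (l + 1), n * cellDiff q n (l / k) * (x - z l) * w (z l) = 0 := by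
      have e3 : ∀ x, n * cellDiff q n (l / k) * (x - z l) * w (z l) =
          (n * cellDiff q n (l / k) * w (z l)) * (x - z l) := fun x => by ring
      simp only [e3]
      rw [intervalIntegral.integral_const_mul, intervalIntegral.integral_sub (by simp) (by simp),
        integral_id, intervalIntegral.integral_const, smul_eq_mul, hzl]
      have : a (l + 1) = a l + 1 / m := by linarith
      rw [this]; ring
    have e4 : ∫ x in a l..a (l + 1), H l x =
        ∫ x in a l..a (l + 1), n * cellDiff q n (l / k) * (x - z l) * (w x - w (z l)) := by
      have := intervalIntegral.integral_sub (μ := volume)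
        (intervalIntegrable_of_unit (hHc l) (ha0 l) (hale l) (ha1 l hl'))
        (intervalIntegrable_of_unit (f := fun x => n * cellDiff q n (l / k) * (x - z l) * w (z l))
          (by fun_prop) (ha0 l) (hale l) (ha1 l hl'))
      rw [hodd, sub_zero] at this
      rw [← this]
      simp only [hH, mul_sub]
    rw [e4]
    have := intervalIntegral.norm_integral_le_of_norm_le_const (a := a l) (b := a (l + 1))
      (f := fun x => n * cellDiff q n (l / k) * (x - z l) * (w x - w (z l)))
      (C := 1 * (1 / m) * (L * (1 / m))) (fun x hx => by
        rw [uIoc_of_le (hale l)] at hx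
        have h2 : |x - z l| ≤ 1 / m := abs_le.2 ⟨by linarith [hx.1], by linarith [hx.2]⟩
        rw [Real.norm_eq_abs, abs_mul, abs_mul, abs_mul, abs_of_pos hn']
        refine mul_le_mul (mul_le_mul (by linarith) h2 (abs_nonneg _) zero_le_one) ?_
          (abs_nonneg _) (by positivity)
        refine (hL x ⟨(ha0 l).trans hx.1.le, hx.2.trans (ha1 l hl')⟩ _ hzm).trans ?_
        exact mul_le_mul_of_nonneg_left h2 hL0)
    refine this.trans (le_of_eq ?_)
    rw [hst, abs_of_pos h1m]; ring
  have e6 : (∫ x in (0 : ℝ)..1, (q x - stepFun m P x) * w x) -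
      ∑ i ∈ Finset.range n, cellErr q w n i (s i) =
      ∑ l ∈ Finset.range m, ∫ x in a l..a (l + 1), H l x := by
    rw [← hsum0, Finset.sum_congr rfl fun l hl => hcell l (Finset.mem_range.1 hl),
      Finset.sum_add_distrib, hcoarse]
    ring
  rw [e6]
  refine (Finset.abs_sum_le_sum_abs _ _).trans ((Finset.sum_le_sum hfine).trans (le_of_eq ?_))
  rw [Finset.sum_const, Finset.card_range, nsmul_eq_mul]
  field_simp

/-! ### Mean squares of independent sums -/

/-- Second moment is variance plus squared mean: by independence the variances add up to at most `n
a²`, while the means may add coherently to `n b`. -/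
theorem lintegral_sq_sum_le {n : ℕ} {X : Fin n → unitInterval → ℝ} (hX : ∀ i, Continuous (X i))
    {a b : ℝ} (ha : ∀ i s, |X i s| ≤ a) (hb : ∀ i, |∫ s, X i s| ≤ b) :
    ∫⁻ ω, ENNReal.ofReal ((∑ i, X i (ω i)) ^ 2)
      ∂(Measure.pi fun _ : Fin n => (volume : Measure unitInterval)) ≤
      ENNReal.ofReal (n * a ^ 2 + (n * b) ^ 2) := by
  set P := Measure.pi fun _ : Fin n => (volume : Measure unitInterval) with hP
  have hmem : ∀ i, MemLp (X i) 2 (volume : Measure unitInterval) := fun i =>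
    MemLp.of_bound (hX i).aestronglyMeasurable a (Eventually.of_forall fun s => ha i s)
  have hcomp : ∀ i, MemLp (fun ω : Fin n → unitInterval => X i (ω i)) 2 P := fun i =>
    (hmem i).comp_measurePreserving (measurePreserving_eval _ i)
  have hsum : MemLp (∑ i, fun ω : Fin n → unitInterval => X i (ω i)) 2 P :=
    memLp_finsetSum' _ fun i _ => hcomp i
  have hsum' : MemLp (fun ω : Fin n → unitInterval => ∑ i, X i (ω i)) 2 P := by
    convert hsum using 1; ext ω; simp
  have hvar : ∀ i, ProbabilityTheory.variance (X i) volume ≤ a ^ 2 := by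
    intro i
    refine (ProbabilityTheory.variance_le_expectation_sq (hX i).aestronglyMeasurable).trans ?_
    have : ∫ s, (X i ^ 2) s ≤ ∫ _ : unitInterval, a ^ 2 := by
      refine integral_mono (hmem i).integrable_sq (integrable_const _) fun s => ?_
      exact sq_le_sq' (abs_le.1 (ha i s)).1 (abs_le.1 (ha i s)).2
    simpa using this
  have hV := ProbabilityTheory.variance_sum_pi (μ := fun _ : Fin n => (volume : Measure unitInterval))
    hmem
  rw [ProbabilityTheory.variance_eq_sub hsum] at hV
  have hE : ∫ ω, (∑ i, fun ω : Fin n → unitInterval => X i (ω i)) ω ∂P = ∑ i, ∫ s, X i s := by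
    simp only [Finset.sum_apply]
    rw [integral_finsetSum _ fun i _ => (hcomp i).integrable one_le_two]
    exact Finset.sum_congr rfl fun i _ => integral_comp_eval (hX i).aestronglyMeasurable
  rw [hE] at hV
  have h1 : ∑ i, ProbabilityTheory.variance (X i) volume ≤ n * a ^ 2 := by
    refine (Finset.sum_le_sum fun i _ => hvar i).trans (le_of_eq ?_)
    simp
  have h2 : (∑ i, ∫ s, X i s) ^ 2 ≤ (n * b) ^ 2 := by
    refine sq_le_sq' ?_ ?_
    · rw [← neg_le_neg_iff, neg_neg, ← Finset.sum_neg_distrib]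
      refine (Finset.sum_le_sum fun i _ => (neg_le_abs _).trans (hb i)).trans (le_of_eq ?_)
      simp
    · refine (Finset.sum_le_sum fun i _ => (le_abs_self _).trans (hb i)).trans (le_of_eq ?_)
      simp
  rw [← ofReal_integral_eq_lintegral_ofReal hsum'.integrable_sq
    (Eventually.of_forall fun ω => sq_nonneg _)]
  refine ENNReal.ofReal_le_ofReal ?_
  have e : ∫ ω, (∑ i, X i (ω i)) ^ 2 ∂P =
      ∫ ω, ((∑ i, fun ω : Fin n → unitInterval => X i (ω i)) ^ 2) ω ∂P := by
    congr 1; ext ω; simp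
  rw [e]
  linarith

/-! ### The mean square error of the sampled eigenvalue -/

/-- The eigenvalue computed from samples of `q` in `n` cells, with `k` subcells per cell and `J`
bisection steps. -/
noncomputable def sampledEigenvalue (n k J : ℕ) (q : ℝ → ℝ) (s : ℕ → ℝ) : ℝ :=
  stepEigenvalue (n * k) (cellPot k (fun i => cellLeft q n i (s i)) (cellDiff q n)) J

/-- A point of the cube as a sequence, continued by zero. -/
noncomputable def sampleSeq {n : ℕ} (ω : Fin n → unitInterval) (i : ℕ) : ℝ :=
  if h : i < n then ω ⟨i, h⟩ else 0

theorem sampleSeq_mem {n : ℕ} (ω : Fin n → unitInterval) (i : ℕ) :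
    sampleSeq ω i ∈ Icc (0 : ℝ) 1 := by
  unfold sampleSeq
  split_ifs with h
  · exact (ω ⟨i, h⟩).2
  · exact ⟨le_rfl, zero_le_one⟩

theorem measurable_sampleSeq {n : ℕ} (i : ℕ) :
    Measurable fun ω : Fin n → unitInterval => sampleSeq ω i := by
  unfold sampleSeq
  split_ifs with h
  · exact measurable_subtype_coe.comp (measurable_pi_apply _)
  · exact measurable_const

theorem integral_unitInterval (f : ℝ → ℝ) :
    ∫ s : unitInterval, f s = ∫ s in (0 : ℝ)..1, f s := by
  rw [intervalIntegral.integral_of_le zero_le_one, ← integral_Icc_eq_integral_Ioc]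
  exact integral_subtype measurableSet_Icc f

/-- `N^4` cells with `N` subcells balance all errors at `N^(-10)`: the random first order part, the
midpoint rule, the quadratic remainder, and bisection by the hypothesis on `J`. The condition `2 ≤
N` provides the four cells required by `cellPot_bound`. -/
theorem exists_sampledEigenvalue_bound : ∃ C : ℝ, 0 < C ∧ ∀ N J : ℕ, 2 ≤ N → N ^ 10 ≤ 2 ^ J →
    ∀ q ∈ classQ, ∫⁻ ω, ENNReal.ofReal
      ((smallestEigenvalue q - sampledEigenvalue (N ^ 4) N J q (sampleSeq ω)) ^ 2)
      ∂(Measure.pi fun _ : Fin (N ^ 4) => (volume : Measure unitInterval)) ≤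
      ENNReal.ofReal ((C / N ^ 10) ^ 2) := by
  have hB := solBound_pos
  have hS := sqBound_pos
  set B := solBound with hBdef
  set E := (2 * B ^ 2 + 16 * B ^ 3) / sqBound + 2 with hE
  have hE0 : 0 < E := by positivity
  set D := 2 * (B ^ 4 + 4 * B ^ 4) / sqBound ^ 2 + 2 * E ^ 2 with hD
  have hD0 : 0 < D := by positivity
  refine ⟨√D, Real.sqrt_pos.2 hD0, fun N J hN hJ q hq => ?_⟩
  have hN0 : 0 < N := by omega
  have hN' : (1 : ℝ) ≤ N := by exact_mod_cast hN0
  have hNpos : (0 : ℝ) < N := by linarith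
  have hn : 0 < N ^ 4 := by positivity
  have hn4 : 4 ≤ N ^ 4 := by
    calc 4 ≤ 2 ^ 4 := by norm_num
      _ ≤ N ^ 4 := Nat.pow_le_pow_left hN 4
  obtain ⟨-, hl, v, dv, hv, hv1⟩ := exists_eigenpair hq
  set l := smallestEigenvalue q
  have hκv : ∀ x ∈ Icc (0 : ℝ) 1, 4 < l - q x ∧ l - q x < 16 := fun x hx => by
    have := hq.2.1 x hx
    exact ⟨by linarith [hl.1, this.2], by linarith [hl.2, this.1]⟩
  have hκv' : ∀ x ∈ Icc (0 : ℝ) 1, |l - q x| ≤ 16 := fun x hx =>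
    abs_le.2 ⟨by linarith [(hκv x hx).1], (hκv x hx).2.le⟩
  set w : ℝ → ℝ := fun x => v x ^ 2 with hw
  have hwL : ∀ x ∈ Icc (0 : ℝ) 1, ∀ y ∈ Icc (0 : ℝ) 1, |w x - w y| ≤ 2 * B ^ 2 * |x - y| :=
    fun x hx y hy => hv.sq_lipschitz hκv' hx hy
  have hwc : ContinuousOn w (Icc 0 1) := hv.sol.cont.pow 2
  have hwb : ∀ x ∈ Icc (0 : ℝ) 1, |w x| ≤ B ^ 2 := fun x hx => by
    have := (hv.norm_le hκv' x hx).1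
    simp only [hw]
    rw [abs_pow]
    exact pow_le_pow_left₀ (abs_nonneg _) this 2
  have hSI := hv.sqBound_le hκv'
  have key : ∀ ω : Fin (N ^ 4) → unitInterval,
      (l - sampledEigenvalue (N ^ 4) N J q (sampleSeq ω)) ^ 2 ≤
      2 / sqBound ^ 2 * (∑ i : Fin (N ^ 4), cellErr q w (N ^ 4) i (ω i)) ^ 2 +
        2 * E ^ 2 / N ^ 20 := by
    intro ω
    set s := sampleSeq ω with hs
    have hs' : ∀ i, s i ∈ Icc (0 : ℝ) 1 := sampleSeq_mem ω
    have hP := fun i hi => cellPot_bound hq hn hN0 hn4 hs' (l := i) hi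
    have hR := fun x hx => abs_sub_stepFun_le hq hn hN0 hs' (x := x) hx
    obtain ⟨μ, hμ, hμ1, y, dy, hy, hy1⟩ :=
      exists_near_stepEigenvalue (Nat.mul_pos hn hN0) hP J
    have hκy : ∀ x ∈ Icc (0 : ℝ) 1, 4 < μ - stepFun (N ^ 4 * N) (cellPot N
        (fun i => cellLeft q (N ^ 4) i (s i)) (cellDiff q (N ^ 4))) x ∧
        μ - stepFun (N ^ 4 * N) (cellPot N
        (fun i => cellLeft q (N ^ 4) i (s i)) (cellDiff q (N ^ 4))) x < 16 := fun x _ => by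
      have := stepFun_bound (Nat.mul_pos hn hN0) hP x
      exact ⟨by linarith [hμ.1, this.2], by linarith [hμ.2, this.1]⟩
    obtain ⟨hint, hexp⟩ := hv.expansion hy hκv hκy hv1 hy1 hR
    have h1 := integral_sub_stepFun hq hwc hwL hn hN0 hint
    have h2 : ∑ i ∈ Finset.range (N ^ 4), cellErr q w (N ^ 4) i (s i) =
        ∑ i : Fin (N ^ 4), cellErr q w (N ^ 4) i (ω i) := by
      rw [Finset.sum_range]
      refine Finset.sum_congr rfl fun i _ => ?_
      simp [hs, sampleSeq]
    rw [h2] at h1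
    set Z := ∑ i : Fin (N ^ 4), cellErr q w (N ^ 4) i (ω i)
    set I := ∫ x in (0 : ℝ)..1, v x ^ 2
    set T := ∫ x in (0 : ℝ)..1, (q x - stepFun (N ^ 4 * N) (cellPot N
        (fun i => cellLeft q (N ^ 4) i (s i)) (cellDiff q (N ^ 4))) x) * v x ^ 2
    have hRR : (1 / ((N ^ 4 : ℕ) : ℝ) ^ 2 + 1 / (N ^ 4 * N : ℕ)) ^ 2 ≤ 4 / N ^ 10 := by
      have : 1 / ((N ^ 4 : ℕ) : ℝ) ^ 2 + 1 / (N ^ 4 * N : ℕ) ≤ 2 / N ^ 5 := by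
        have e1 : ((N ^ 4 * N : ℕ) : ℝ) = N ^ 5 := by push_cast; ring
        have e2 : ((N ^ 4 : ℕ) : ℝ) ^ 2 = (N : ℝ) ^ 8 := by push_cast; ring
        rw [e1, e2]
        have : 1 / (N : ℝ) ^ 8 ≤ 1 / N ^ 5 :=
          one_div_le_one_div_of_le (by positivity) (pow_le_pow_right₀ hN' (by norm_num))
        have e3 : 2 / (N : ℝ) ^ 5 = 1 / N ^ 5 + 1 / N ^ 5 := by ring
        linarith
      calc _ ≤ (2 / (N : ℝ) ^ 5) ^ 2 := pow_le_pow_left₀ (by positivity) this 2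
        _ = 4 / N ^ 10 := by ring
    have hm2 : 2 * B ^ 2 / (N ^ 4 * N : ℕ) ^ 2 = 2 * B ^ 2 / N ^ 10 := by
      push_cast; congr 1; ring
    have h3 : |(l - μ) * I| ≤ |Z| + (2 * B ^ 2 + 16 * B ^ 3) / N ^ 10 := by
      have h4 : 4 * B ^ 3 * (1 / ((N ^ 4 : ℕ) : ℝ) ^ 2 + 1 / (N ^ 4 * N : ℕ)) ^ 2 ≤
          4 * B ^ 3 * (4 / N ^ 10) := mul_le_mul_of_nonneg_left hRR (by positivity)
      have e : (l - μ) * I = ((l - μ) * I - T) + (T - Z) + Z := by ring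
      rw [e]
      refine (abs_add_three _ _ _).trans ?_
      have h5 := hexp.trans h4
      rw [hm2] at h1
      have e6 : (2 * B ^ 2 + 16 * B ^ 3) / (N : ℝ) ^ 10 =
        2 * B ^ 2 / N ^ 10 + 4 * B ^ 3 * (4 / N ^ 10) := by ring
      linarith
    have h6 : |l - μ| ≤ |Z| / sqBound + (2 * B ^ 2 + 16 * B ^ 3) / sqBound / N ^ 10 := by
      have h7 : |l - μ| * sqBound ≤ |(l - μ) * I| := by
        rw [abs_mul, abs_of_pos (hS.trans_le hSI)]
        exact mul_le_mul_of_nonneg_left hSI (abs_nonneg _)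
      rw [← le_div_iff₀ hS] at h7
      refine h7.trans ((div_le_div_of_nonneg_right h3 hS.le).trans (le_of_eq ?_))
      ring
    have h8 : (2 : ℝ) / 2 ^ J ≤ 2 / N ^ 10 :=
      div_le_div_of_nonneg_left zero_le_two (by positivity) (by exact_mod_cast hJ)
    have h9 : |l - sampledEigenvalue (N ^ 4) N J q s| ≤ |Z| / sqBound + E / N ^ 10 := by
      have e : l - sampledEigenvalue (N ^ 4) N J q s =
        (l - μ) - (sampledEigenvalue (N ^ 4) N J q s - μ) := by ring
      rw [e]
      refine (abs_sub _ _).trans ?_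
      have e7 : E / (N : ℝ) ^ 10 = (2 * B ^ 2 + 16 * B ^ 3) / sqBound / N ^ 10 + 2 / N ^ 10 := by
        rw [hE]; ring
      have h10 : |sampledEigenvalue (N ^ 4) N J q s - μ| ≤ 2 / 2 ^ J := hμ1
      linarith
    rw [← sq_abs]
    calc |l - sampledEigenvalue (N ^ 4) N J q s| ^ 2 ≤ (|Z| / sqBound + E / N ^ 10) ^ 2 :=
          pow_le_pow_left₀ (abs_nonneg _) h9 2
      _ ≤ 2 * (|Z| / sqBound) ^ 2 + 2 * (E / N ^ 10) ^ 2 := by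
          nlinarith [sq_nonneg (|Z| / sqBound - E / N ^ 10)]
      _ = _ := by rw [div_pow, sq_abs]; ring
  have hX : ∀ i : Fin (N ^ 4), Continuous fun s : unitInterval => cellErr q w (N ^ 4) i s :=
    fun i => (continuousOn_cellErr hq hn i.2).comp_continuous continuous_subtype_val fun s => s.2
  have hsum := lintegral_sq_sum_le hX (a := B ^ 2 / (N ^ 4 : ℕ) ^ 3)
    (b := 2 * B ^ 2 / (N ^ 4 : ℕ) ^ 4) (fun i s => abs_cellErr_le hq hwc hwb hn i.2 s.2) fun i => by
      rw [integral_unitInterval]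
      exact abs_integral_cellErr_le hq hwc hwL hn i.2
  -- With `n = N^4` the variance part is `n · n^(-6) = N^(-20)` and the squared bias is `(n ·
  -- n^(-4))² = N^(-24)`.
  have hval : ((N ^ 4 : ℕ) : ℝ) * (B ^ 2 / (N ^ 4 : ℕ) ^ 3) ^ 2 +
      ((N ^ 4 : ℕ) * (2 * B ^ 2 / (N ^ 4 : ℕ) ^ 4)) ^ 2 ≤ (B ^ 4 + 4 * B ^ 4) / N ^ 20 := by
    have e : ((N ^ 4 : ℕ) : ℝ) * (B ^ 2 / (N ^ 4 : ℕ) ^ 3) ^ 2 +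
      ((N ^ 4 : ℕ) * (2 * B ^ 2 / (N ^ 4 : ℕ) ^ 4)) ^ 2 =
      B ^ 4 / N ^ 20 + 4 * B ^ 4 / N ^ 24 := by
      push_cast; field_simp; norm_num
    rw [e, add_div]
    have : 4 * B ^ 4 / (N : ℝ) ^ 24 ≤ 4 * B ^ 4 / N ^ 20 :=
      div_le_div_of_nonneg_left (by positivity) (by positivity)
        (pow_le_pow_right₀ hN' (by norm_num))
    linarith
  have hmeas : Measurable fun ω : Fin (N ^ 4) → unitInterval =>
      ENNReal.ofReal ((∑ i : Fin (N ^ 4), cellErr q w (N ^ 4) i (ω i)) ^ 2) := by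
    refine ENNReal.measurable_ofReal.comp ((Finset.measurable_fun_sum _ fun i _ => ?_).pow_const 2)
    exact (hX i).measurable.comp (measurable_pi_apply i)
  calc _ ≤ ∫⁻ ω, (ENNReal.ofReal (2 / sqBound ^ 2) * ENNReal.ofReal
        ((∑ i : Fin (N ^ 4), cellErr q w (N ^ 4) i (ω i)) ^ 2) +
        ENNReal.ofReal (2 * E ^ 2 / N ^ 20))
        ∂(Measure.pi fun _ : Fin (N ^ 4) => (volume : Measure unitInterval)) := by
        refine lintegral_mono fun ω => ?_
        rw [← ENNReal.ofReal_mul (by positivity), ← ENNReal.ofReal_add (by positivity)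
          (by positivity)]
        exact ENNReal.ofReal_le_ofReal (key ω)
    _ = ENNReal.ofReal (2 / sqBound ^ 2) * (∫⁻ ω, ENNReal.ofReal
        ((∑ i : Fin (N ^ 4), cellErr q w (N ^ 4) i (ω i)) ^ 2)
        ∂(Measure.pi fun _ : Fin (N ^ 4) => (volume : Measure unitInterval))) +
        ENNReal.ofReal (2 * E ^ 2 / N ^ 20) := by
        rw [lintegral_add_right _ measurable_const, lintegral_const_mul _ hmeas]
        simp
    _ ≤ ENNReal.ofReal (2 / sqBound ^ 2) * ENNReal.ofReal ((B ^ 4 + 4 * B ^ 4) / N ^ 20) +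
        ENNReal.ofReal (2 * E ^ 2 / N ^ 20) := by
        gcongr
        exact hsum.trans (ENNReal.ofReal_le_ofReal hval)
    _ = _ := by
        rw [← ENNReal.ofReal_mul (by positivity), ← ENNReal.ofReal_add (by positivity)
          (by positivity), div_pow, Real.sq_sqrt hD0.le]
        congr 1
        rw [hD]; ring

/-! ### Measurability of the computed eigenvalue -/

theorem measurable_cellIter {Ω : Type*} [MeasurableSpace Ω] (τ : ℝ) {P : Ω → ℕ → ℝ}
    (hP : ∀ l, Measurable fun ω => P ω l) {μ : Ω → ℝ} (hμ : Measurable μ) (l : ℕ) :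
    Measurable fun ω => cellIter τ (P ω) (μ ω) l := by
  induction l with
  | zero => exact measurable_const
  | succ l ih =>
    have hκ : Measurable fun ω => √(μ ω - P ω l) := (hμ.sub (hP l)).sqrt
    have hc : Measurable fun ω => Real.cos (√(μ ω - P ω l) * τ) := (hκ.mul_const τ).cos
    have hs : Measurable fun ω => Real.sin (√(μ ω - P ω l) * τ) := (hκ.mul_const τ).sin
    exact ((ih.fst.mul hc).add ((ih.snd.mul hs).div hκ)).prodMk
      ((ih.snd.mul hc).sub (ih.fst.mul (hκ.mul hs)))

theorem measurable_bisect {Ω : Type*} [MeasurableSpace Ω] {G : Ω → ℝ → ℝ}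
    (hG : ∀ μ : Ω → ℝ, Measurable μ → Measurable fun ω => G ω (μ ω)) (j : ℕ) :
    Measurable fun ω => bisect (G ω) j := by
  induction j with
  | zero => exact measurable_const
  | succ j ih =>
    have h := hG _ ih
    exact ih.add (measurable_const.mul (h.div (continuous_abs.measurable.comp h)))

theorem measurable_stepEigenvalue {Ω : Type*} [MeasurableSpace Ω] (m J : ℕ) {P : Ω → ℕ → ℝ}
    (hP : ∀ l, Measurable fun ω => P ω l) : Measurable fun ω => stepEigenvalue m (P ω) J :=
  measurable_bisect (fun _ hμ => (measurable_cellIter _ hP hμ m).fst) J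

theorem cellIter_congr {τ : ℝ} {P P' : ℕ → ℝ} {μ : ℝ} {m : ℕ} (h : ∀ l < m, P l = P' l) :
    ∀ l ≤ m, cellIter τ P μ l = cellIter τ P' μ l := by
  intro l
  induction l with
  | zero => exact fun _ => rfl
  | succ l ih => intro hl; rw [cellIter, cellIter, ih (by omega), h l (by omega)]

theorem stepEigenvalue_congr {P P' : ℕ → ℝ} {m : ℕ} (h : ∀ l < m, P l = P' l) (J : ℕ) :
    stepEigenvalue m P J = stepEigenvalue m P' J := by
  have : ∀ μ, cellIter (1 / m) P μ m = cellIter (1 / m) P' μ m :=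
    fun μ => cellIter_congr h m le_rfl
  simp only [stepEigenvalue, this]

theorem cellPot_congr {n k : ℕ} {A A' B B' : ℕ → ℝ} (hA : ∀ i < n, A i = A' i)
    (hB : ∀ i < n, B i = B' i) : ∀ l < n * k, cellPot k A B l = cellPot k A' B' l := by
  intro l hl
  have hi : l / k < n := Nat.div_lt_of_lt_mul (by rw [mul_comm]; exact hl)
  rw [cellPot, cellPot, hA _ hi, hB _ hi]

/-! ### Nonadaptive algorithms -/

/-- The algorithm that evaluates at `M` given random points. -/
noncomputable abbrev RandAlg.nonadaptive (Ω : Type) [mΩ : MeasurableSpace Ω] (P : Measure Ω)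
    [isProb : IsProbabilityMeasure P] (M : ℕ) (t : ℕ → Ω → unitInterval)
    (f : Ω → (ℕ → ℝ) → ℝ) : RandAlg where
  Ω := Ω
  mΩ := mΩ
  P := P
  isProb := isProb
  point ω h := t h.length ω
  isDone _ h := decide (M ≤ h.length)
  out ω h := f ω fun j => (h.map Prod.snd).getD j 0

namespace RandAlg

section nonadaptive

variable {Ω : Type} [mΩ : MeasurableSpace Ω] {P : Measure Ω} [isProb : IsProbabilityMeasure P]
  {M : ℕ} {t : ℕ → Ω → unitInterval} {f : Ω → (ℕ → ℝ) → ℝ} {q : ℝ → ℝ}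

theorem nonadaptive_hist (ω : Ω) (k : ℕ) : (nonadaptive Ω P M t f).hist q ω k =
    (List.range (min k M)).map fun j => (t j ω, q (t j ω)) := by
  induction k with
  | zero => simp [hist]
  | succ k ih =>
    rw [hist, ih]
    by_cases h : M ≤ k
    · simp [min_eq_right h, min_eq_right (h.trans (Nat.le_succ k))]
    · rw [min_eq_left (by omega : k ≤ M), min_eq_left (by omega : k + 1 ≤ M), List.range_succ,
        List.map_append]
      simp [h]

theorem nonadaptive_count (ω : Ω) : (nonadaptive Ω P M t f).count q ω = M := by
  refine le_antisymm (iSup_le fun k => ?_) (le_iSup_of_le M ?_)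
  · rw [nonadaptive_hist]; simp
  · rw [nonadaptive_hist]; simp

theorem nonadaptive_output (ω : Ω) : (nonadaptive Ω P M t f).output q ω =
    f ω fun j => if j < M then q (t j ω) else 0 := by
  classical
  have h : ∃ k, (nonadaptive Ω P M t f).isDone ω ((nonadaptive Ω P M t f).hist q ω k) = true :=
    ⟨M, by rw [nonadaptive_hist]; simp⟩
  have hs := Nat.find_spec h
  have hM : M ≤ Nat.find h := by
    rw [nonadaptive_hist] at hs
    simpa [nonadaptive] using hs
  rw [output, dif_pos h, nonadaptive_hist, min_eq_right hM]
  change f ω _ = _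
  congr 1
  ext j
  by_cases hj : j < M <;> simp [hj]

theorem nonadaptive_isMeasurable (ht : ∀ j, Measurable (t j))
    (hf : ∀ v : ℕ → Ω → ℝ, (∀ j, Measurable (v j)) → Measurable fun ω => f ω fun j => v j ω) :
    (nonadaptive Ω P M t f).IsMeasurable := by
  intro q hq
  have hqc : Measurable fun x : unitInterval => q x :=
    (continuousOn_iff_continuous_domRestrict.1 (classQ_continuousOn hq)).measurable
  refine ⟨fun i => ?_, ?_, ?_⟩
  · have : (nonadaptive Ω P M t f).samplePoint q i = if i < M then t i else fun _ => 0 := by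
      ext1 ω
      rw [samplePoint, nonadaptive_hist]
      by_cases h : i < M
      · simp [h, Nat.succ_le_of_lt h]
      · rw [min_eq_right (by omega)]
        simp [h]
    rw [this]
    split_ifs
    · exact ht i
    · exact measurable_const
  · have : (nonadaptive Ω P M t f).count q = fun _ => (M : ℝ≥0∞) := funext nonadaptive_count
    rw [this]; exact measurable_const
  · have : (nonadaptive Ω P M t f).output q = fun ω => f ω fun j => if j < M then q (t j ω) else 0 :=
      funext nonadaptive_output
    rw [this]
    refine hf (fun j ω => if j < M then q (t j ω) else 0) fun j => ?_
    by_cases h : j < M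
    · simp only [h, if_true]; exact hqc.comp (ht j)
    · simp only [h, if_false]; exact measurable_const

end nonadaptive

end RandAlg

/-! ### The randomized algorithm -/

theorem rpow_half_le_of_le {x : ℝ≥0∞} {y : ℝ} (hy : 0 ≤ y) (h : x ≤ ENNReal.ofReal (y ^ 2)) :
    x ^ (1 / 2 : ℝ) ≤ ENNReal.ofReal y := by
  refine (ENNReal.rpow_le_rpow h (by norm_num)).trans (le_of_eq ?_)
  rw [ENNReal.ofReal_rpow_of_nonneg (sq_nonneg y) (by norm_num), ← Real.sqrt_eq_rpow,
    Real.sqrt_sq hy]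

theorem exists_randAlg : ∃ C : ℝ, 0 < C ∧ ∀ N : ℕ, 2 ≤ N → ∃ A : RandAlg, A.IsMeasurable ∧
    A.error ≤ ENNReal.ofReal (C / N ^ 10) ∧ A.card ≤ (3 * N ^ 4 : ℕ) := by
  obtain ⟨C, hC, hb⟩ := exists_sampledEigenvalue_bound
  refine ⟨C, hC, fun N hN => ?_⟩
  have hN0 : 0 < N := by omega
  set n := N ^ 4 with hn
  have hn0 : 0 < n := by positivity
  set J := Nat.clog 2 (N ^ 10) with hJdef
  have hJ : N ^ 10 ≤ 2 ^ J := Nat.le_pow_clog (by norm_num) _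
  -- Evaluations `3i`, `3i + 1`, `3i + 2` are at the left end, the right end and the random point of
  -- cell `i`. Common end points are evaluated twice, which only affects the constant.
  set u : ℕ → (Fin n → unitInterval) → ℝ := fun j ω =>
    if j % 3 = 0 then 0 else if j % 3 = 1 then 1 else sampleSeq ω (j / 3) with hu
  set t : ℕ → (Fin n → unitInterval) → unitInterval := fun j ω =>
    projIcc (0 : ℝ) 1 zero_le_one (((j / 3 : ℕ) + u j ω) / n) with ht
  set f : (Fin n → unitInterval) → (ℕ → ℝ) → ℝ := fun ω v => stepEigenvalue (n * N) (cellPot N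
    (fun i => v (3 * i + 2) - sampleSeq ω i * (v (3 * i + 1) - v (3 * i)))
    (fun i => v (3 * i + 1) - v (3 * i))) J with hf
  set P := Measure.pi fun _ : Fin n => (volume : Measure unitInterval)
  set A := RandAlg.nonadaptive (Fin n → unitInterval) P (3 * n) t f with hA
  have hu_meas : ∀ j, Measurable (u j) := fun j => by
    simp only [hu]
    split_ifs
    · exact measurable_const
    · exact measurable_const
    · exact measurable_sampleSeq _
  have hu_mem : ∀ j ω, u j ω ∈ Icc (0 : ℝ) 1 := fun j ω => by
    simp only [hu]
    split_ifs
    · exact ⟨le_rfl, zero_le_one⟩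
    · exact ⟨zero_le_one, le_rfl⟩
    · exact sampleSeq_mem _ _
  have hout : ∀ q ω, A.output q ω = sampledEigenvalue n N J q (sampleSeq ω) := by
    intro q ω
    refine (RandAlg.nonadaptive_output ω).trans ?_
    refine stepEigenvalue_congr (cellPot_congr ?_ ?_) J
    all_goals
      intro i hi
      obtain ⟨h0, h1, h2⟩ := cell_le hn0 hi
      have e0 : (t (3 * i) ω : ℝ) = i / n := by
        have a1 : 3 * i / 3 = i := by omega
        have a2 : 3 * i % 3 = 0 := by omega
        simp only [ht, hu, a1, a2, if_true, add_zero]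
        rw [projIcc_of_mem zero_le_one ⟨h0, h1.le.trans h2⟩]
      have e1 : (t (3 * i + 1) ω : ℝ) = (i + 1) / n := by
        have a1 : (3 * i + 1) / 3 = i := by omega
        have a2 : (3 * i + 1) % 3 = 1 := by omega
        simp only [ht, hu, a1, a2, if_true, one_ne_zero, if_false]
        rw [projIcc_of_mem zero_le_one ⟨h0.trans h1.le, h2⟩]
      have e2 : (t (3 * i + 2) ω : ℝ) = (i + sampleSeq ω i) / n := by
        have a1 : (3 * i + 2) / 3 = i := by omega
        have a2 : (3 * i + 2) % 3 = 2 := by omega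
        have hm := cell_mem hn0 i (sampleSeq_mem ω i)
        simp only [ht, hu, a1, a2, OfNat.ofNat_ne_zero, OfNat.ofNat_ne_one, if_false]
        rw [projIcc_of_mem zero_le_one ⟨h0.trans hm.1, hm.2.trans h2⟩]
      simp only [show 3 * i < 3 * n by omega, show 3 * i + 1 < 3 * n by omega,
        show 3 * i + 2 < 3 * n by omega, if_true, e0, e1, e2, cellLeft, cellDiff]
  refine ⟨A, RandAlg.nonadaptive_isMeasurable (fun j => ?_) fun v hv => ?_, ?_, ?_⟩
  · exact continuous_projIcc.measurable.comp (((hu_meas j).const_add _).div_const _)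
  · refine measurable_stepEigenvalue _ _ fun l => ?_
    exact ((hv _).sub ((measurable_sampleSeq _).mul ((hv _).sub (hv _)))).add
      (((hv _).sub (hv _)).mul_const _)
  · refine iSup₂_le fun q hq => rpow_half_le_of_le (by positivity) ?_
    simp only [hout]
    exact hb N J hN hJ q hq
  · refine iSup₂_le fun q hq => ?_
    have : ∀ ω, A.count q ω = (3 * n : ℕ) := fun ω => RandAlg.nonadaptive_count ω
    simp only [this]
    change ∫⁻ _, _ ∂P ≤ _
    rw [lintegral_const, measure_univ, mul_one]

/-! ### Programs without jumps -/

/-- The instruction is not a jump. -/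
def Instr.isStraight : Instr → Bool
  | .jumpLE _ _ _ => false
  | .jumpIdxLE _ _ _ => false
  | _ => true

/-- The instruction is a query. -/
def Instr.isQuery : Instr → Bool
  | .query _ _ => true
  | _ => false

section straight

variable (q : ℝ → ℝ) (ξ : ℕ → ℝ)

theorem pc_foldl_exec (L : List Instr) (hL : ∀ i ∈ L, i.isStraight) (s : Config) :
    (L.foldl (Instr.exec q ξ) s).pc = s.pc + L.length := by
  induction L generalizing s with
  | nil => rfl
  | cons i L ih =>
    rw [List.foldl_cons, ih fun j hj => hL j (List.mem_cons_of_mem i hj), List.length_cons]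
    have := hL i List.mem_cons_self
    cases i <;> simp_all [Instr.exec, Instr.isStraight] <;> omega

theorem queries_foldl_exec (L : List Instr) (s : Config) :
    (L.foldl (Instr.exec q ξ) s).queries = s.queries + L.countP Instr.isQuery := by
  induction L generalizing s with
  | nil => rfl
  | cons i L ih =>
    rw [List.foldl_cons, ih]
    cases i <;> (simp [Instr.exec, Instr.isQuery, List.countP_cons]; try omega)

theorem ops_foldl_exec (L : List Instr) (s : Config) :
    (L.foldl (Instr.exec q ξ) s).ops = s.ops + L.countP (fun i => !i.isQuery) := by
  induction L generalizing s with
  | nil => rfl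
  | cons i L ih =>
    rw [List.foldl_cons, ih]
    cases i <;> simp [Instr.exec, Instr.isQuery] <;> omega

end straight

namespace RandProgram

variable {A : RandProgram}

/-- Without jumps step `k` executes instruction `k`, so a run is a fold over the code. This is
enough because the program may depend on `ε`: all its loops are unrolled into the list. -/
theorem run_straight (hA : ∀ i ∈ A.code, i.isStraight) (q : ℝ → ℝ) (ω : A.Ω) (k : ℕ) :
    A.run q ω k = (A.code.take k).foldl (Instr.exec q fun j => A.ξ j ω)
      ⟨0, fun _ => 0, fun _ => 0, 0, 0, 0⟩ := by
  induction k with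
  | zero => rfl
  | succ k ih =>
    have hpc : (A.run q ω k).pc = min k A.code.length := by
      rw [ih, pc_foldl_exec _ _ _ fun i hi => hA i (List.mem_of_mem_take hi)]
      simp
    rw [run, step, hpc]
    by_cases h : k < A.code.length
    · rw [min_eq_left h.le, List.getElem?_eq_getElem h, List.take_succ_eq_append_getElem h,
        List.foldl_append, ← ih]
      rfl
    · rw [min_eq_right (not_lt.1 h), List.getElem?_eq_none le_rfl, ih,
        List.take_of_length_le (not_lt.1 h), List.take_of_length_le (by omega)]

theorem count_straight (hA : ∀ i ∈ A.code, i.isStraight) (q : ℝ → ℝ) (ω : A.Ω) :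
    A.count q ω ≤ (A.code.countP Instr.isQuery : ℕ) := by
  refine iSup_le fun k => ?_
  rw [run_straight hA, queries_foldl_exec, zero_add]
  exact_mod_cast (List.take_sublist k A.code).countP_le

theorem opCount_straight (hA : ∀ i ∈ A.code, i.isStraight) (q : ℝ → ℝ) (ω : A.Ω) :
    A.opCount q ω ≤ (A.code.countP (fun i => !i.isQuery) : ℕ) := by
  refine iSup_le fun k => ?_
  rw [run_straight hA, ops_foldl_exec, zero_add]
  exact_mod_cast (List.take_sublist k A.code).countP_le

theorem output_straight (hA : ∀ i ∈ A.code, i.isStraight) (q : ℝ → ℝ) (ω : A.Ω) :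
    A.output q ω = (A.code.foldl (Instr.exec q fun j => A.ξ j ω)
      ⟨0, fun _ => 0, fun _ => 0, 0, 0, 0⟩).reg 0 := by
  have h : A.HaltedAt q ω A.code.length := by
    rw [HaltedAt, run_straight hA, List.take_length, pc_foldl_exec _ _ _ hA]
    simp
  rw [A.output_eq_of_halted h, run_straight hA, List.take_length]

end RandProgram

/-! ### The program -/

/-- Sampling in cell `i` of `n`: the coefficients of the linear function are put into the registers
`20 + 2 i` and `21 + 2 i`. -/
noncomputable def sampleCode (n i : ℕ) : List Instr :=
  [.const 7 (i / n), .query 8 7, .const 7 ((i + 1) / n), .query 9 7,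
    .arith .sub (21 + 2 * i) 9 8, .rand 11, .const 7 i, .arith .add 7 7 11, .const 8 n,
    .arith .div 7 7 8, .query 9 7, .arith .mul 8 11 (21 + 2 * i), .arith .sub (20 + 2 * i) 9 8]

/-- One step of length `τ` of the solution in the registers `1` and `2`. -/
noncomputable def stepCode (τ σ : ℝ) (i : ℕ) : List Instr :=
  [.const 10 σ, .arith .mul 10 (21 + 2 * i) 10, .arith .add 10 (20 + 2 * i) 10,
    .arith .sub 3 0 10, .elem .sqrt 3 3, .const 4 τ, .arith .mul 4 3 4, .elem .sin 5 4,
    .elem .cos 6 4, .arith .mul 7 1 6, .arith .mul 8 2 5, .arith .div 8 8 3, .arith .add 7 7 8,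
    .arith .mul 8 2 6, .arith .mul 9 3 5, .arith .mul 9 1 9, .arith .sub 2 8 9, .copy 1 7]

/-- The solution at `1` for the parameter in register `0`. -/
noncomputable def shootCode (n k : ℕ) : List Instr :=
  [.const 1 0, .const 2 1] ++ (List.range (n * k)).flatMap fun l =>
    stepCode (1 / (n * k : ℕ)) ((((l % k : ℕ) : ℝ) + 1 / 2) / k) (l / k)

/-- One bisection step for the parameter in register `0`. -/
noncomputable def bisectCode (n k j : ℕ) : List Instr :=
  shootCode n k ++ [.elem .abs 3 1, .arith .div 3 1 3, .const 4 (2 / 2 ^ (j + 1)),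
    .arith .mul 3 4 3, .arith .add 0 0 3]

/-- The whole program. -/
noncomputable def eigenCode (n k J : ℕ) : List Instr :=
  (List.range n).flatMap (sampleCode n) ++ [.const 0 10] ++
    (List.range J).flatMap (bisectCode n k)

section exec

variable {q : ℝ → ℝ} {ξ : ℕ → ℝ}

/-- Registers below `20` are scratch, those from `20` on hold the coefficients of the cells. The
auxiliary facts `a1` to `a5` in this and the next proofs only separate register numbers. -/
theorem exec_sampleCode (n i : ℕ) (s : Config) :
    ((sampleCode n i).foldl (Instr.exec q ξ) s).draws = s.draws + 1 ∧
    ((sampleCode n i).foldl (Instr.exec q ξ) s).reg (21 + 2 * i) =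
      q (projIcc (0 : ℝ) 1 zero_le_one ((i + 1) / n)) - q (projIcc (0 : ℝ) 1 zero_le_one (i / n)) ∧
    ((sampleCode n i).foldl (Instr.exec q ξ) s).reg (20 + 2 * i) =
      q (projIcc (0 : ℝ) 1 zero_le_one ((i + ξ s.draws) / n)) - ξ s.draws *
      (q (projIcc (0 : ℝ) 1 zero_le_one ((i + 1) / n)) -
        q (projIcc (0 : ℝ) 1 zero_le_one (i / n))) ∧
    ∀ d, 20 ≤ d → d ≠ 20 + 2 * i → d ≠ 21 + 2 * i →
      ((sampleCode n i).foldl (Instr.exec q ξ) s).reg d = s.reg d := by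
  have a1 : ∀ r < 20, (20 + 2 * i = r) = False := fun r hr => by simp; omega
  have a2 : ∀ r < 20, (21 + 2 * i = r) = False := fun r hr => by simp; omega
  have a3 : ∀ r < 20, (r = 21 + 2 * i) = False := fun r hr => by simp; omega
  have a4 : (21 + 2 * i = 20 + 2 * i) = False := by simp
  refine ⟨rfl, ?_, ?_, fun d hd h1 h2 => ?_⟩
  · simp [sampleCode, Instr.exec, ArithOp.eval, a2]
  · simp [sampleCode, Instr.exec, ArithOp.eval, a2]
  · have a5 : ∀ r < 20, (d = r) = False := fun r hr => by simp; omega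
    simp [sampleCode, Instr.exec, Function.update_apply, a5, h1, h2]

theorem exec_stepCode (τ σ : ℝ) (i : ℕ) (s : Config) :
    ((stepCode τ σ i).foldl (Instr.exec q ξ) s).reg 0 = s.reg 0 ∧
    (((stepCode τ σ i).foldl (Instr.exec q ξ) s).reg 1,
      ((stepCode τ σ i).foldl (Instr.exec q ξ) s).reg 2) =
      cellStep τ (s.reg 0 - (s.reg (20 + 2 * i) + s.reg (21 + 2 * i) * σ)) (s.reg 1, s.reg 2) ∧
    ∀ d, 20 ≤ d → ((stepCode τ σ i).foldl (Instr.exec q ξ) s).reg d = s.reg d := by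
  have a1 : ∀ r < 20, (20 + 2 * i = r) = False := fun r hr => by simp; omega
  have a2 : ∀ r < 20, (21 + 2 * i = r) = False := fun r hr => by simp; omega
  refine ⟨?_, ?_, fun d hd => ?_⟩
  · simp [stepCode, Instr.exec, Function.update_apply]
  · simp [stepCode, Instr.exec, ArithOp.eval, ElemFun.eval, cellStep, a1, a2]
  · have a5 : ∀ r < 20, (d = r) = False := fun r hr => by simp; omega
    simp [stepCode, Instr.exec, Function.update_apply, a5]

theorem exec_shootCode {n k : ℕ} {P : ℕ → ℝ} (s : Config)
    (hP : ∀ l < n * k, s.reg (20 + 2 * (l / k)) +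
      s.reg (21 + 2 * (l / k)) * ((((l % k : ℕ) : ℝ) + 1 / 2) / k) = P l) :
    ((shootCode n k).foldl (Instr.exec q ξ) s).reg 0 = s.reg 0 ∧
    ((shootCode n k).foldl (Instr.exec q ξ) s).reg 1 =
      (cellIter (1 / (n * k : ℕ)) P (s.reg 0) (n * k)).1 ∧
    ∀ d, 20 ≤ d → ((shootCode n k).foldl (Instr.exec q ξ) s).reg d = s.reg d := by
  rw [shootCode, List.foldl_append]
  set s' := List.foldl (Instr.exec q ξ) s [.const 1 0, .const 2 1] with hs'
  have h0 : s'.reg 0 = s.reg 0 := by simp [hs', Instr.exec]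
  have h1 : s'.reg 1 = 0 := by simp [hs', Instr.exec]
  have h2 : s'.reg 2 = 1 := by simp [hs', Instr.exec]
  have hd : ∀ d, 20 ≤ d → s'.reg d = s.reg d := fun d hd => by
    have a5 : ∀ r < 20, (d = r) = False := fun r hr => by simp; omega
    simp [hs', Instr.exec, a5]
  have key : ∀ l ≤ n * k, ∀ t, t = ((List.range l).flatMap fun l =>
      stepCode (1 / (n * k : ℕ)) ((((l % k : ℕ) : ℝ) + 1 / 2) / k) (l / k)).foldl
        (Instr.exec q ξ) s' → t.reg 0 = s.reg 0 ∧
      (t.reg 1, t.reg 2) = cellIter (1 / (n * k : ℕ)) P (s.reg 0) l ∧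
      ∀ d, 20 ≤ d → t.reg d = s.reg d := by
    intro l
    induction l with
    | zero =>
      intro _ t ht
      have ht : t = s' := ht
      rw [ht, h0, h1, h2]
      exact ⟨rfl, rfl, hd⟩
    | succ l ih =>
      intro hl t ht
      obtain ⟨i0, i1, i2⟩ := ih (by omega) _ rfl
      rw [List.range_succ, List.flatMap_append, List.foldl_append, List.flatMap_singleton] at ht
      obtain ⟨j0, j1, j2⟩ := exec_stepCode (q := q) (ξ := ξ) (1 / (n * k : ℕ))
        ((((l % k : ℕ) : ℝ) + 1 / 2) / k) (l / k) (((List.range l).flatMap fun l =>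
        stepCode (1 / (n * k : ℕ)) ((((l % k : ℕ) : ℝ) + 1 / 2) / k) (l / k)).foldl
        (Instr.exec q ξ) s')
      rw [← ht] at j0 j1 j2
      refine ⟨j0.trans i0, ?_, fun d hd => (j2 d hd).trans (i2 d hd)⟩
      rw [j1, i0, i1, i2 _ (by omega), i2 _ (by omega), hP l (by omega)]
      rfl
  obtain ⟨k0, k1, k2⟩ := key _ le_rfl _ rfl
  exact ⟨k0, by rw [← k1], k2⟩

/-- The machine division has the same convention at zero as `bisect`, so the five instructions after
shooting are one bisection step even at an exact zero. -/
theorem exec_bisectCode {n k : ℕ} {P : ℕ → ℝ} (s : Config)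
    (hP : ∀ l < n * k, s.reg (20 + 2 * (l / k)) +
      s.reg (21 + 2 * (l / k)) * ((((l % k : ℕ) : ℝ) + 1 / 2) / k) = P l) (J : ℕ) :
    ((([Instr.const 0 10] ++ (List.range J).flatMap (bisectCode n k)).foldl (Instr.exec q ξ) s).reg 0 =
      stepEigenvalue (n * k) P J) ∧
    ∀ d, 20 ≤ d → (([Instr.const 0 10] ++ (List.range J).flatMap (bisectCode n k)).foldl
      (Instr.exec q ξ) s).reg d = s.reg d := by
  induction J with
  | zero =>
    refine ⟨by simp [Instr.exec, stepEigenvalue, bisect], fun d hd => ?_⟩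
    have a5 : (d = 0) = False := by simp; omega
    simp [Instr.exec, a5]
  | succ J ih =>
    obtain ⟨i0, i1⟩ := ih
    rw [List.range_succ, List.flatMap_append, ← List.append_assoc, List.foldl_append,
      List.flatMap_singleton]
    set t := ([Instr.const 0 10] ++ (List.range J).flatMap (bisectCode n k)).foldl (Instr.exec q ξ) s
    rw [bisectCode, List.foldl_append]
    obtain ⟨j0, j1, j2⟩ := exec_shootCode (q := q) (ξ := ξ) (P := P) t fun l hl => by
      rw [i1 _ (by omega), i1 _ (by omega), hP l hl]
    set u := (shootCode n k).foldl (Instr.exec q ξ) t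
    constructor
    · have e : ∀ u : Config, ([Instr.elem .abs 3 1, .arith .div 3 1 3, .const 4 (2 / 2 ^ (J + 1)),
          .arith .mul 3 4 3, .arith .add 0 0 3].foldl (Instr.exec q ξ) u).reg 0 =
          u.reg 0 + 2 / 2 ^ (J + 1) * (u.reg 1 / |u.reg 1|) := fun u => by
        simp [Instr.exec, ArithOp.eval, ElemFun.eval]
      rw [e, j0, j1, i0]
      rfl
    · intro d hd
      have a5 : ∀ r < 20, (d = r) = False := fun r hr => by simp; omega
      rw [← i1 d hd, ← j2 d hd]
      simp [Instr.exec, a5]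

/-- Random numbers in `[0,1]` keep all query points in their cells, where the projection built into
a query is the identity. -/
theorem exec_eigenCode {n k J : ℕ} (hn : 0 < n) (hξ : ∀ i, ξ i ∈ Icc (0 : ℝ) 1) (s : Config)
    (hs : s.draws = 0) : ((eigenCode n k J).foldl (Instr.exec q ξ) s).reg 0 =
      sampledEigenvalue n k J q ξ := by
  have key : ∀ i ≤ n, ∀ t, t = ((List.range i).flatMap (sampleCode n)).foldl (Instr.exec q ξ) s →
      t.draws = i ∧ ∀ j < i, t.reg (20 + 2 * j) = cellLeft q n j (ξ j) ∧
      t.reg (21 + 2 * j) = cellDiff q n j := by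
    intro i
    induction i with
    | zero => intro _ t ht; rw [ht]; exact ⟨hs, fun j hj => absurd hj (by omega)⟩
    | succ i ih =>
      intro hi t ht
      obtain ⟨i0, i1⟩ := ih (by omega) _ rfl
      rw [List.range_succ, List.flatMap_append, List.foldl_append, List.flatMap_singleton] at ht
      obtain ⟨j0, j1, j2, j3⟩ := exec_sampleCode (q := q) (ξ := ξ) n i
        (((List.range i).flatMap (sampleCode n)).foldl (Instr.exec q ξ) s)
      rw [← ht, i0] at j0 j2
      rw [← ht] at j1 j3
      refine ⟨j0, fun j hj => ?_⟩
      rcases Nat.lt_succ_iff_lt_or_eq.1 hj with h | rfl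
      · rw [j3 _ (by omega) (by omega) (by omega), j3 _ (by omega) (by omega) (by omega)]
        exact i1 j h
      · obtain ⟨h0, h1, h2⟩ := cell_le hn (i := j) (by omega)
        have hm := cell_mem hn j (hξ j)
        rw [projIcc_of_mem zero_le_one ⟨h0, h1.le.trans h2⟩,
          projIcc_of_mem zero_le_one ⟨h0.trans h1.le, h2⟩] at j1 j2
        rw [projIcc_of_mem zero_le_one ⟨h0.trans hm.1, hm.2.trans h2⟩] at j2
        exact ⟨j2, j1⟩
  obtain ⟨-, hk⟩ := key n le_rfl _ rfl
  rw [eigenCode, List.append_assoc, List.foldl_append]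
  refine (exec_bisectCode _ (fun l hl => ?_) J).1
  have hi : l / k < n := Nat.div_lt_of_lt_mul (by rw [mul_comm]; exact hl)
  obtain ⟨h1, h2⟩ := hk _ hi
  rw [h1, h2]
  rfl

end exec

theorem countP_flatMap_range (p : Instr → Bool) {f : ℕ → List Instr} {c : ℕ}
    (h : ∀ i, (f i).countP p = c) (n : ℕ) : ((List.range n).flatMap f).countP p = n * c := by
  induction n with
  | zero => simp
  | succ n ih => rw [List.range_succ, List.flatMap_append, List.countP_append, ih,
      List.flatMap_singleton, h, Nat.succ_mul]

theorem isStraight_eigenCode (n k J : ℕ) : ∀ i ∈ eigenCode n k J, i.isStraight := by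
  have h1 : ∀ i, ∀ a ∈ sampleCode n i, a.isStraight := fun i => by
    simp [sampleCode, Instr.isStraight]
  have h2 : ∀ τ σ i, ∀ a ∈ stepCode τ σ i, a.isStraight := fun τ σ i => by
    simp [stepCode, Instr.isStraight]
  have h3 : ∀ a ∈ shootCode n k, a.isStraight := by
    intro a ha
    rw [shootCode, List.mem_append, List.mem_flatMap] at ha
    rcases ha with ha | ⟨l, -, ha⟩
    · revert a; simp [Instr.isStraight]
    · exact h2 _ _ _ a ha
  have h4 : ∀ j, ∀ a ∈ bisectCode n k j, a.isStraight := by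
    intro j a ha
    rw [bisectCode, List.mem_append] at ha
    rcases ha with ha | ha
    · exact h3 a ha
    · revert a; simp [Instr.isStraight]
  intro a ha
  rw [eigenCode, List.mem_append, List.mem_append, List.mem_flatMap, List.mem_flatMap] at ha
  rcases ha with (⟨l, -, ha⟩ | ha) | ⟨l, -, ha⟩
  · exact h1 l a ha
  · revert a; simp [Instr.isStraight]
  · exact h4 l a ha

theorem queries_eigenCode (n k J : ℕ) : (eigenCode n k J).countP Instr.isQuery = 3 * n := by
  have h1 : ∀ i, (sampleCode n i).countP Instr.isQuery = 3 := fun _ => rfl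
  have h2 : ∀ j, (bisectCode n k j).countP Instr.isQuery = 0 := fun j => by
    rw [bisectCode, shootCode, List.countP_append, List.countP_append,
      countP_flatMap_range _ (c := 0) fun l => by simp [stepCode, Instr.isQuery]]
    simp [Instr.isQuery]
  rw [eigenCode, List.countP_append, List.countP_append, countP_flatMap_range _ h1,
    countP_flatMap_range _ h2]
  simp [Instr.isQuery, mul_comm]

/-- Ten operations per cell, one initialization of the parameter, and per bisection step eighteen
per subcell, two to start shooting and five to update. -/
theorem ops_eigenCode (n k J : ℕ) : (eigenCode n k J).countP (fun i => !i.isQuery) =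
    10 * n + 1 + J * (18 * (n * k) + 7) := by
  have h1 : ∀ i, (sampleCode n i).countP (fun i => !i.isQuery) = 10 := fun _ => rfl
  have h2 : ∀ j, (bisectCode n k j).countP (fun i => !i.isQuery) = 18 * (n * k) + 7 := fun j => by
    rw [bisectCode, shootCode, List.countP_append, List.countP_append,
      countP_flatMap_range _ (c := 18) fun l => by simp [stepCode, Instr.isQuery]]
    simp [Instr.isQuery]
    ring
  rw [eigenCode, List.countP_append, List.countP_append, countP_flatMap_range _ h1,
    countP_flatMap_range _ h2]
  simp [Instr.isQuery, mul_comm]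

/-- The program that computes the sampled eigenvalue. -/
noncomputable abbrev eigenProgram (n k J : ℕ) : RandProgram where
  code := eigenCode n k J
  Ω := Fin n → unitInterval
  mΩ := inferInstance
  P := Measure.pi fun _ : Fin n => (volume : Measure unitInterval)
  isProb := inferInstance
  ξ i ω := sampleSeq ω i
  measurable_ξ := measurable_sampleSeq

theorem exists_randProgram : ∃ C : ℝ, 0 < C ∧ ∀ N : ℕ, 2 ≤ N → ∃ A : RandProgram,
    A.error ≤ ENNReal.ofReal (C / N ^ 10) ∧ ∀ c : ℝ, 0 < c → A.cost c ≤
      ENNReal.ofReal (c * (3 * N ^ 4) +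
        (10 * N ^ 4 + 1 + Nat.clog 2 (N ^ 10) * (18 * N ^ 5 + 7))) := by
  obtain ⟨C, hC, hb⟩ := exists_sampledEigenvalue_bound
  refine ⟨C, hC, fun N hN => ?_⟩
  have hN0 : 0 < N := by omega
  set J := Nat.clog 2 (N ^ 10)
  have hJ : N ^ 10 ≤ 2 ^ J := Nat.le_pow_clog (by norm_num) _
  have hst := isStraight_eigenCode (N ^ 4) N J
  refine ⟨eigenProgram (N ^ 4) N J, ?_, fun c hc => ?_⟩
  · refine iSup₂_le fun q hq => rpow_half_le_of_le (by positivity) ?_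
    have : ∀ ω, (eigenProgram (N ^ 4) N J).output q ω =
        sampledEigenvalue (N ^ 4) N J q (sampleSeq ω) := fun ω =>
      (RandProgram.output_straight hst q ω).trans
        (exec_eigenCode (by positivity) (sampleSeq_mem ω) _ rfl)
    simp only [this]
    exact hb N J hN hJ q hq
  · refine iSup₂_le fun q hq => rpow_half_le_of_le (by positivity) ?_
    have h : ∀ ω, (ENNReal.ofReal c * (eigenProgram (N ^ 4) N J).count q ω +
        (eigenProgram (N ^ 4) N J).opCount q ω) ^ 2 ≤ ENNReal.ofReal ((c * (3 * N ^ 4) +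
        (10 * N ^ 4 + 1 + J * (18 * N ^ 5 + 7))) ^ 2) := by
      intro ω
      rw [ENNReal.ofReal_pow (by positivity)]
      refine pow_le_pow_left₀ zero_le ?_ 2
      rw [ENNReal.ofReal_add (by positivity) (by positivity), ENNReal.ofReal_mul hc.le]
      refine add_le_add (mul_le_mul_right ?_ _) ?_
      · refine (RandProgram.count_straight hst q ω).trans (le_of_eq ?_)
        rw [queries_eigenCode, ← ENNReal.ofReal_natCast]
        push_cast; rfl
      · refine (RandProgram.opCount_straight hst q ω).trans (le_of_eq ?_)
        rw [ops_eigenCode, ← ENNReal.ofReal_natCast]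
        congr 1
        push_cast; ring
    refine (lintegral_mono h).trans (le_of_eq ?_)
    rw [lintegral_const, measure_univ, mul_one]

/-! ### The choice of the number of cells -/

/-- `N` is `(C/ε)^(1/10)` rounded up, at most twice that number; hence the factors `16 = 2^4` and
`32 = 2^5`. From `2^(J-1) < N^10 ≤ 2^10 C/ε` and `log (1/ε) ≥ 1` (base two) follows `J ≤ (12 + log
C) log (1/ε)`, and `311 = 11 + 25 · 12`. -/
theorem exists_size {C ε : ℝ} (hC : 1 ≤ C) (hε : 0 < ε) (hε2 : ε < 1 / 2) : ∃ N : ℕ, 2 ≤ N ∧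
    C / N ^ 10 ≤ ε ∧ (N : ℝ) ^ 4 ≤ 16 * C ^ (2 / 5 : ℝ) * ε ^ (-(2 / 5) : ℝ) ∧
    (10 * N ^ 4 + 1 + Nat.clog 2 (N ^ 10) * (18 * N ^ 5 + 7) : ℝ) ≤
      32 * C ^ (1 / 2 : ℝ) * (311 + 25 * Real.logb 2 C) *
        (ε ^ (-(1 / 2) : ℝ) * Real.logb 2 (1 / ε)) := by
  have hC0 : 0 < C := by linarith
  set x := (C / ε) ^ (1 / 10 : ℝ) with hx
  have hCε : 1 < C / ε := by rw [one_lt_div hε]; linarith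
  have hx1 : 1 < x := Real.one_lt_rpow hCε (by norm_num)
  have hxp : ∀ k : ℕ, x ^ k = C ^ (k / 10 : ℝ) * ε ^ (-(k / 10 : ℝ)) := fun k => by
    rw [hx, ← Real.rpow_natCast, ← Real.rpow_mul (by positivity), Real.div_rpow hC0.le hε.le,
      Real.rpow_neg hε.le, div_eq_mul_inv]
    congr 2 <;> ring_nf
  have hx10 : x ^ 10 = C / ε := by
    rw [hx, ← Real.rpow_natCast, ← Real.rpow_mul (by positivity)]
    norm_num
  set N := ⌈x⌉₊ with hN
  have hxN : x ≤ N := Nat.le_ceil x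
  have hNx : (N : ℝ) ≤ 2 * x := by
    have := Nat.ceil_lt_add_one (by linarith : 0 ≤ x)
    rw [← hN] at this
    linarith
  have hN2 : 2 ≤ N := by
    have : (1 : ℝ) < N := hx1.trans_le hxN
    exact_mod_cast this
  have hN1 : (1 : ℝ) ≤ N := hx1.le.trans hxN
  have hNk : ∀ k : ℕ, (N : ℝ) ^ k ≤ 2 ^ k * x ^ k := fun k => by
    rw [← mul_pow]; exact pow_le_pow_left₀ (by linarith) hNx k
  set J := Nat.clog 2 (N ^ 10) with hJ
  set l := Real.logb 2 (1 / ε) with hl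
  have hl1 : 1 ≤ l := by
    rw [hl, Real.le_logb_iff_rpow_le (by norm_num) (by positivity), Real.rpow_one,
      le_div_iff₀ hε]
    linarith
  have hCl : 0 ≤ Real.logb 2 C := Real.logb_nonneg (by norm_num) hC
  have hJl : (J : ℝ) ≤ (12 + Real.logb 2 C) * l := by
    have h1 : 2 ^ (J - 1) < N ^ 10 := by
      have := Nat.pow_pred_clog_lt_self (b := 2) (by norm_num) (x := N ^ 10)
        (Nat.one_lt_pow (by norm_num) (by omega))
      simpa [hJ] using this
    have h2 : (2 : ℝ) ^ ((J - 1 : ℕ) : ℝ) ≤ 2 ^ 10 * (C * (1 / ε)) := by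
      rw [Real.rpow_natCast, mul_one_div, ← hx10]
      exact le_trans (by exact_mod_cast h1.le) (hNk 10)
    rw [← Real.le_logb_iff_rpow_le (by norm_num) (by positivity),
      Real.logb_mul (by norm_num) (by positivity), Real.logb_mul (by positivity) (by positivity),
      Real.logb_pow, Real.logb_self_eq_one (by norm_num)] at h2
    have h3 : (J : ℝ) ≤ (J - 1 : ℕ) + 1 := by
      have : J ≤ (J - 1) + 1 := by omega
      exact_mod_cast this
    push_cast at h2
    nlinarith
  refine ⟨N, hN2, ?_, ?_, ?_⟩
  · rw [div_le_iff₀ (by positivity), mul_comm, ← div_le_iff₀ hε, ← hx10]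
    exact pow_le_pow_left₀ (by linarith) hxN 10
  · refine (hNk 4).trans (le_of_eq ?_)
    rw [hxp]; norm_num; ring
  · have h4 : (N : ℝ) ^ 4 ≤ N ^ 5 := pow_le_pow_right₀ hN1 (by norm_num)
    have h5 : (1 : ℝ) ≤ N ^ 5 := one_le_pow₀ hN1
    have h6 : (10 * N ^ 4 + 1 + J * (18 * N ^ 5 + 7) : ℝ) ≤ N ^ 5 * (11 + 25 * J) := by
      have : (J : ℝ) * 1 ≤ J * N ^ 5 := mul_le_mul_of_nonneg_left h5 (Nat.cast_nonneg J)
      nlinarith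
    have h7 : (11 + 25 * J : ℝ) ≤ (311 + 25 * Real.logb 2 C) * l := by nlinarith
    refine h6.trans ((mul_le_mul (hNk 5) h7 (by positivity) (by positivity)).trans (le_of_eq ?_))
    rw [hxp]; norm_num; ring

end SturmLiouville

/-! ### Assembly of the lower and upper bounds -/

theorem mainTheorem4 :
    (∀ q ∈ SturmLiouville.classQ,
      IsLeast {l | SturmLiouville.IsEigenvalue q l} (SturmLiouville.smallestEigenvalue q)) ∧
    ∃ a₁ a₂ a₃ ε₀ : ℝ, 0 < a₁ ∧ 0 < a₂ ∧ 0 < a₃ ∧ 0 < ε₀ ∧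
      ∀ ε : ℝ, 0 < ε → ε < ε₀ →
        (ENNReal.ofReal (a₁ * ε ^ (-(2 / 5) : ℝ)) ≤ SturmLiouville.nRan ε ∧
          SturmLiouville.nRan ε ≤ ENNReal.ofReal (a₂ * ε ^ (-(2 / 5) : ℝ))) ∧
        ∀ c : ℝ, 0 < c →
          ENNReal.ofReal (a₁ * c * ε ^ (-(2 / 5) : ℝ)) ≤ SturmLiouville.compRan c ε ∧
          SturmLiouville.compRan c ε ≤
            ENNReal.ofReal (a₂ * c * ε ^ (-(2 / 5) : ℝ) +
              a₃ * (ε ^ (-(1 / 2) : ℝ) * Real.logb 2 (1 / ε))) := by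
  refine ⟨fun q hq => (SturmLiouville.exists_eigenpair hq).1, ?_⟩
  obtain ⟨α, ε₁, hα, hε₁, hlow⟩ := SturmLiouville.exists_lower_bound
  obtain ⟨C₁, -, hA⟩ := SturmLiouville.exists_randAlg
  obtain ⟨C₂, -, hB⟩ := SturmLiouville.exists_randProgram
  set C := max 1 (max C₁ C₂) with hC
  have hC1 : 1 ≤ C := le_max_left _ _
  have hC₁ : C₁ ≤ C := (le_max_left _ _).trans (le_max_right _ _)
  have hC₂ : C₂ ≤ C := (le_max_right _ _).trans (le_max_right _ _)
  have hC0 : 0 < C := by linarith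
  have hCl : 0 ≤ Real.logb 2 C := Real.logb_nonneg (by norm_num) hC1
  -- The factor `48` is `3 · 16`: three evaluations per cell and `N^4 ≤ 16 C^(2/5) ε^(-2/5)` cells.
  -- The same constant serves the evaluation part of the program.
  refine ⟨α, 48 * C ^ (2 / 5 : ℝ), 32 * C ^ (1 / 2 : ℝ) * (311 + 25 * Real.logb 2 C),
    min ε₁ (1 / 2), hα, by positivity, by positivity, by positivity, fun ε hε hε0 => ?_⟩
  obtain ⟨N, hN, hN1, hN2, hN3⟩ := SturmLiouville.exists_size hC1 hε (hε0.trans_le (min_le_right _ _))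
  have hε1 := hε0.trans_le (min_le_left _ _)
  have herr : ∀ C' ≤ C, ENNReal.ofReal (C' / N ^ 10) ≤ ENNReal.ofReal ε := fun C' h =>
    ENNReal.ofReal_le_ofReal ((div_le_div_of_nonneg_right h (by positivity)).trans hN1)
  refine ⟨⟨?_, ?_⟩, fun c hc => ⟨?_, ?_⟩⟩
  · refine le_iInf₂ fun A hAm => le_iInf fun hAe => ?_
    obtain ⟨q, hq, h⟩ := hlow ε hε hε1 (A.toTraceMethod hAm) fun q hq => A.lintegral_sq_le hε hAe hq
    exact h.trans (A.le_card hq)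
  · obtain ⟨A, hAm, hAe, hAc⟩ := hA N hN
    refine (iInf₂_le_of_le A hAm (iInf_le_of_le (hAe.trans (herr _ hC₁)) hAc)).trans ?_
    rw [← ENNReal.ofReal_natCast]
    refine ENNReal.ofReal_le_ofReal ?_
    push_cast
    linarith
  · refine le_iInf₂ fun A hAe => ?_
    obtain ⟨q, hq, h⟩ := hlow ε hε hε1 A.toTraceMethod fun q hq => A.lintegral_sq_le hε hAe hq
    refine le_trans ?_ (A.le_cost c hq)
    rw [mul_comm α, mul_assoc, ENNReal.ofReal_mul hc.le]
    gcongr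
    exact h
  · obtain ⟨A, hAe, hAc⟩ := hB N hN
    refine (iInf₂_le_of_le A (hAe.trans (herr _ hC₂)) (hAc c hc)).trans ?_
    refine ENNReal.ofReal_le_ofReal (add_le_add ?_ hN3)
    calc c * (3 * (N : ℝ) ^ 4) ≤ c * (3 * (16 * C ^ (2 / 5 : ℝ) * ε ^ (-(2 / 5) : ℝ))) := by gcongr
      _ = _ := by ring
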